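/- For a directed acyclic graph (dag) $G=(V,E)$ with $n$ vertices and $m$ edges and thresholds $t_1>0$, $t_2$, a \emph{satisfying utility function} is a map $\alpha:V\to\mathbb R$ with $\alpha(v)-\alpha(u)\ge t_1$ whenever $(u,v)\in E$ and $\alpha(v)-\alpha(u)\le t_2$ whenever $(u,v)\notin E$. Let $\lambda=\lambda(G)$ be the least ratio $t_2/t_1$ for which one exists. The dag is \emph{degenerate} if it models a weak order, i.e. if for some $f:V\to\mathbb R$ one has $(u,v)\in E\iff f(u)<f(v)$; then $\lambda(G)=0$. Connectedness and cliques of $G$ refer to its underlying undirected graph. Algorithms run on a unit-cost random access machine whose arithmetic operations are addition and subtraction of integers; constants in $O(\cdot)$ are absolute. Let $G$ be a connected nondegenerate dag and $i$ an integer with $1\le i\le\lambda$. (1) Given $G$ (as a list of edges), $i$, integers $t_1>0$ and $t_2$ with $t_2/t_1=\lambda$, and an integer-valued satisfying utility function $\alpha$ for $(t_1,t_2)$, a clique $K$ of $G$ with $\omega(G)\le i\,|K|$, where $\omega(G)$ is the maximum size of a clique of $G$, can be found in time $$O\!\left(\frac{\lambda}{i}\; m^{(\lfloor \lambda/i\rfloor+1)/2}\right).$$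 More precisely, within this time one can find a maximum clique $K$ of the graph obtained from $G$ by deleting all edges $(u,v)$ with $\alpha(v)-\alpha(u)<i\,t_1$ (that is, with utility difference less than $i$ when utilities are scaled so that $t_1=1$), and this $K$ is a clique of $G$ with $\omega(G)\le i\,|K|$. (2) Given only $G$ (as a list of edges) and $i$, a clique $K$ of $G$ with $\omega(G)\le i\,|K|$ can be found in time $$O\!\left(\frac{nm}{\lambda}+\frac{\lambda}{i}\; m^{(\lfloor \lambda/i\rfloor+1)/2}\right).$$ -/

import Mathlib

/-! ### Double-threshold digraphs -/

/-- A directed acyclic graph: no vertex lies on a directed cycle. -/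
def IsDag {V : Type*} (G : Digraph V) : Prop :=
  ∀ v, ¬ Relation.TransGen G.Adj v v

/-- A dag is connected if its underlying undirected graph is connected. -/
def DagConnected {V : Type*} (G : Digraph V) : Prop :=
  G.toSimpleGraphInclusive.Connected

/-- `α` is a satisfying utility function for the thresholds `(t₁, t₂)`. -/
def IsSatisfying {V : Type*} (G : Digraph V) (t₁ t₂ : ℝ) (α : V → ℝ) : Prop :=
  (∀ u v, G.Adj u v → t₁ ≤ α v - α u) ∧ (∀ u v, ¬ G.Adj u v → α v - α u ≤ t₂)

/-- The ratios `t₂ / t₁` of the pairs of thresholds for which a satisfying utility function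
exists. -/
def satisfiableRatios {V : Type*} (G : Digraph V) : Set ℝ :=
  {r | ∃ t₁ t₂ : ℝ, 0 < t₁ ∧ r = t₂ / t₁ ∧ ∃ α : V → ℝ, IsSatisfying G t₁ t₂ α}

/-- `λ(G)`, the least satisfiable ratio. It is `0` for a degenerate dag. -/
noncomputable def lam {V : Type*} (G : Digraph V) : ℝ := sInf (satisfiableRatios G)

/-- A dag is degenerate if it models a weak order: for some utility function, the edges are
exactly the pairs with increasing utility. -/
def IsDegenerate {V : Type*} (G : Digraph V) : Prop :=
  ∃ f : V → ℝ, ∀ u v, G.Adj u v ↔ f u < f v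

/-- The number of edges. -/
noncomputable def edgeCount {V : Type*} (G : Digraph V) : ℕ := {p : V × V | G.Adj p.1 p.2}.ncard

/-- The graph obtained from `G` by deleting the edges whose utility difference is less
than `d`. -/
def deleteShort {V : Type*} (G : Digraph V) (α : V → ℝ) (d : ℝ) : Digraph V where
  Adj u v := G.Adj u v ∧ d ≤ α v - α u

/-- `K` is a clique of `G` and the maximum clique size of `G` is at most `i` times its size. -/
def IsCliqueWithinFactor {V : Type*} (G : Digraph V) (i : ℕ) (K : Finset V) : Prop :=
  G.toSimpleGraphInclusive.IsClique (K : Set V) ∧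
    G.toSimpleGraphInclusive.cliqueNum ≤ i * K.card

/-! ### A unit-cost random access machine with addition and subtraction -/

/-- The memory: cells addressed by integers (the cells with negative addresses are a second
one-sided tape of registers), each holding an integer. -/
abbrev Memory := ℤ → ℤ

/-- Expressions. There is no multiplication, division or bitwise operation. -/
inductive RamExpr where
  /-- a constant of the program -/
  | lit (c : ℤ) : RamExpr
  /-- the content of the cell whose address is the value of `e` -/
  | cell (e : RamExpr) : RamExpr
  | plus (e f : RamExpr) : RamExpr
  | minus (e f : RamExpr) : RamExpr

/-- The value of an expression. -/
def RamExpr.eval (M : Memory) : RamExpr → ℤ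
  | .lit c => c
  | .cell e => M (e.eval M)
  | .plus e f => e.eval M + f.eval M
  | .minus e f => e.eval M - f.eval M

/-- The number of elementary operations spent on evaluating an expression. -/
def RamExpr.cost : RamExpr → ℕ
  | .lit _ => 1
  | .cell e => e.cost + 1
  | .plus e f => e.cost + f.cost + 1
  | .minus e f => e.cost + f.cost + 1

/-- Programs. A condition `e` means that the value of `e` is positive. -/
inductive RamProg where
  | skip : RamProg
  /-- store the value of `e` in the cell whose address is the value of `a` -/
  | assign (a e : RamExpr) : RamProg
  | seq (P Q : RamProg) : RamProg
  | branch (e : RamExpr) (P Q : RamProg) : RamProg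
  /-- repeat `P` as long as `e` is positive -/
  | loop (e : RamExpr) (P : RamProg) : RamProg

/-- `Runs P M t M'`: started on the memory `M`, the program `P` halts with memory `M'` after
`t` elementary steps. -/
inductive Runs : RamProg → Memory → ℕ → Memory → Prop where
  | skip (M : Memory) : Runs .skip M 1 M
  | assign (a e : RamExpr) (M : Memory) :
      Runs (.assign a e) M (a.cost + e.cost + 1) (Function.update M (a.eval M) (e.eval M))
  | seq {P Q : RamProg} {M M' M'' : Memory} {s t : ℕ} :
      Runs P M s M' → Runs Q M' t M'' → Runs (.seq P Q) M (s + t) M''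
  | branch_true {e : RamExpr} {P Q : RamProg} {M M' : Memory} {t : ℕ} :
      0 < e.eval M → Runs P M t M' → Runs (.branch e P Q) M (e.cost + 1 + t) M'
  | branch_false {e : RamExpr} {P Q : RamProg} {M M' : Memory} {t : ℕ} :
      e.eval M ≤ 0 → Runs Q M t M' → Runs (.branch e P Q) M (e.cost + 1 + t) M'
  | loop_true {e : RamExpr} {P : RamProg} {M M' M'' : Memory} {s t : ℕ} :
      0 < e.eval M → Runs P M s M' → Runs (.loop e P) M' t M'' →
        Runs (.loop e P) M (e.cost + 1 + s + t) M''
  | loop_false {e : RamExpr} {P : RamProg} {M : Memory} :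
      e.eval M ≤ 0 → Runs (.loop e P) M (e.cost + 1) M

/-- The initial memory: the input words in the cells `0, 1, 2, …`, and `0` elsewhere. -/
def initMemory (x : List ℤ) : Memory :=
  fun a => if 0 ≤ a then x.getD a.toNat 0 else 0

/-- `L` lists every edge of `G` exactly once, in any order. -/
def IsEdgeList {n : ℕ} (G : Digraph (Fin n)) (L : List (Fin n × Fin n)) : Prop :=
  L.Nodup ∧ ∀ u v, (u, v) ∈ L ↔ G.Adj u v

/-- The end points of the edges of the list, edge after edge. -/
def edgeWords {n : ℕ} (L : List (Fin n × Fin n)) : List ℤ :=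
  L.flatMap fun p => [((p.1 : ℕ) : ℤ), ((p.2 : ℕ) : ℤ)]

/-- The input `(G, i)`: the words `n`, `m`, `i`, then the edges. -/
def graphInput {n : ℕ} (i : ℕ) (L : List (Fin n × Fin n)) : List ℤ :=
  [(n : ℤ), (L.length : ℤ), (i : ℤ)] ++ edgeWords L

/-- The input `(G, i, t₁, t₂, α)`: the words `n`, `m`, `i`, `t₁`, `t₂`, then the `n` values of
`α`, then the edges. -/
def utilityInput {n : ℕ} (i : ℕ) (t₁ t₂ : ℤ) (α : Fin n → ℤ) (L : List (Fin n × Fin n)) :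
    List ℤ :=
  [(n : ℤ), (L.length : ℤ), (i : ℤ), t₁, t₂] ++ List.ofFn α ++ edgeWords L

/-- The memory `M` holds the output `K`: the number of elements of `K` in the cell `0`, and the
elements, in some order, in the cells that follow it. -/
def HoldsOutput {n : ℕ} (M : Memory) (K : Finset (Fin n)) : Prop :=
  ∃ l : List (Fin n), l.Nodup ∧ l.toFinset = K ∧ M 0 = (l.length : ℤ) ∧
    ∀ j : Fin l.length, M ((j : ℤ) + 1) = ((l.get j : ℕ) : ℤ)

/-- The function `(λ/i) · m ^ ((⌊λ/i⌋ + 1) / 2)` of `G` and `i`. -/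
noncomputable def cliqueBound {V : Type*} (G : Digraph V) (i : ℕ) : ℝ :=
  (lam G / i) * (edgeCount G : ℝ) ^ (((⌊lam G / i⌋₊ : ℝ) + 1) / 2)

/-! Put `d = i t₁` and `k = ⌊λ / i⌋`, so that `(k + 1) d > t₂` and every ordered pair of vertices
with utility difference at least `(k + 1) d` is an edge. In topological order a clique becomes a
chain: a list in which each vertex is an out-neighbour of all earlier ones. In the graph of the
edges with difference at least `d`, a vertex `c` appended to a chain has to be compared with the
last `k` vertices only. Any earlier vertex `p` lies `d` below the first of these, which lies `k d`
below `c`; so `(p, c)` is a long edge automatically (`hasWindows_longList`). Hence chains are the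
walks of an automaton whose states are the chains of at most `k` vertices and whose transitions are
the chains of at most `k + 1` vertices. Its transitions can be ordered so that a walk uses later and
later ones (`lt_of_target_eq_dropLast`), and a longest walk, which is a maximum clique, is found by
dynamic programming (`findBest_ok`, `length_le_best`).

The transitions are enumerated level by level. A chain is extended by trying only the out-neighbours
of its vertex of least out-degree. The sum of these least degrees over all chains of `q + 1`
vertices is at most `m ^ ((q + 2) / 2)` (`candidateCount_sq_le`): for one vertex it is the number of
edges, for two vertices Cauchy–Schwarz applies, and two further vertices cost a factor `m`. Since
only chains of at most `k` vertices are extended, the exponent is `(k + 1) / 2`. A trial takes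
constant time in a trie with suffix links: `a :: l` can be extended by `c` exactly if `l` can and
`c` is an out-neighbour of `a`.

For the approximation factor, utilities rise by at least `t₁` per step along a clique of `G`. Every
`i`-th vertex of it therefore gives a clique of the graph of long edges
(`IsOutChain.exists_longList`).

Without given utilities, the ratios `R = 2 i, 3 i, …` are tested for a utility function with
differences at least `1` on edges and less than `R` on nonadjacent pairs. The first success is at `R
= (k + 1) i`; it yields `k` and utilities that serve as well as optimal ones. A test works in the
manner of Bellman and Ford on integers `a N + b`, where the small summand `b` encodes strictness. In
one phase nonadjacent pairs are relaxed once, and then all edges in topological order, in time `O(n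
+ m)`. If a solution exists, the value `(a, b)` is witnessed by `a + b R + b + 1` distinct vertices
(`IsTraced.step`), so that `O(n / R)` phases decide. The total cost of the tests is `O(n m / λ)` if
`k ≤ 2`, and otherwise it is dominated by the clique stage (`searchCost_le`).

The algorithms are written in a small language of bounded loops over named arrays, which is
translated to the machine with a constant factor loss (`Cmd.exists_runs`). Multiples of `n` are
tabulated, as the machine does not multiply. Large tables need no initialisation, as the memory
starts with zeros. -/

set_option linter.constructorNameAsVariable false

/-! ### A language of bounded loops over named arrays -/

/-- The names of the arrays. A scalar variable is an array that is used at the index `0` only. -/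
inductive Reg where
  | inp | out | n | m | i | eb | t1 | t2 | rr | row | e | u | v | w | c | p | q | t | x | j | id
  | s | cnt | cr | lo | sz | bs | deg | nb | ind | ord | pos | tl | pdeg | pnb | padj | al | d
  | k | acc | hdeg | hnb | hadj | last | fst | par | suf | mdv | tgt | rowt | chd | best | chc
  | cur | lim1 | lim2 | lim3 | lim4 | fnd | big | rat | ratBig | iBig | phases | val | keyA
  | keyB | val' | keyA' | keyB' | bad | chg | srt1 | srt2 | ct | bk | o | fl | cand | y | z
  deriving DecidableEq

/-- The number of an array name. -/
def Reg.code (r : Reg) : ℤ := r.ctorIdx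

theorem Reg.code_nonneg (r : Reg) : 0 ≤ r.code := by
  cases r <;> decide

theorem Reg.code_lt (r : Reg) : r.code < 128 := by
  cases r <;> decide

theorem Reg.code_injective : Function.Injective Reg.code := by
  have h : Function.LeftInverse (fun z : ℤ => Reg.ofNat z.toNat) Reg.code := by
    intro r
    cases r <;> rfl
  exact h.injective

/-- States: the contents of all arrays. -/
abbrev St := Reg → ℤ → ℤ

/-- Change one array entry. -/
def St.set (σ : St) (r : Reg) (a v : ℤ) : St :=
  Function.update σ r (Function.update (σ r) a v)

@[simp] theorem St.set_self (σ : St) (r : Reg) (a v : ℤ) :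
    σ.set r a v r = Function.update (σ r) a v := by
  simp [St.set]

@[simp] theorem St.set_of_ne (σ : St) {r r' : Reg} (h : r' ≠ r) (a v : ℤ) :
    σ.set r a v r' = σ r' := by
  simp [St.set, h]

/-- Expressions over array entries. -/
inductive Ex where
  | lit (c : ℤ) : Ex
  | arr (r : Reg) (e : Ex) : Ex
  | add (e f : Ex) : Ex
  | sub (e f : Ex) : Ex

instance : Add Ex := ⟨Ex.add⟩
instance : Sub Ex := ⟨Ex.sub⟩
instance (k : ℕ) : OfNat Ex k := ⟨Ex.lit (k : ℤ)⟩
instance : Coe Reg Ex := ⟨fun r => Ex.arr r (Ex.lit 0)⟩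

/-- The entry of an array at an index. -/
infixl:80 " # " => Ex.arr

/-- The value of an expression. -/
def Ex.eval (σ : St) : Ex → ℤ
  | .lit c => c
  | .arr r e => σ r (e.eval σ)
  | .add e f => e.eval σ + f.eval σ
  | .sub e f => e.eval σ - f.eval σ

@[simp] theorem Ex.eval_lit (σ : St) (c : ℤ) : (Ex.lit c).eval σ = c := rfl
@[simp] theorem Ex.eval_arr (σ : St) (r : Reg) (e : Ex) : (r # e).eval σ = σ r (e.eval σ) := rfl
@[simp] theorem Ex.eval_add (σ : St) (e f : Ex) : (e + f).eval σ = e.eval σ + f.eval σ := rfl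
@[simp] theorem Ex.eval_sub (σ : St) (e f : Ex) : (e - f).eval σ = e.eval σ - f.eval σ := rfl
@[simp] theorem Ex.eval_ofNat (σ : St) (k : ℕ) [k.AtLeastTwo] :
    (ofNat(k) : Ex).eval σ = ofNat(k) := rfl
@[simp] theorem Ex.eval_zero (σ : St) : (0 : Ex).eval σ = 0 := rfl
@[simp] theorem Ex.eval_one (σ : St) : (1 : Ex).eval σ = 1 := rfl

/-- Commands. -/
inductive Cmd where
  | skip : Cmd
  /-- store the value of `e` in the array `r` at the index `a` -/
  | wr (r : Reg) (a e : Ex) : Cmd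
  | seq (c d : Cmd) : Cmd
  /-- a conditional: is the value of `e` positive? -/
  | ite (e : Ex) (c d : Cmd) : Cmd
  /-- `for i = 0, …, e - 1 do c`; the number of rounds is kept in `lim` -/
  | loop (i lim : Reg) (e : Ex) (c : Cmd) : Cmd

/-- Sequential composition. -/
infixr:60 " ;; " => Cmd.seq

/-- Assignment to a scalar variable. -/
def Cmd.asg (r : Reg) (e : Ex) : Cmd := .wr r 0 e

/-- The effect of a command. -/
def Cmd.exec : Cmd → St → St
  | .skip, σ => σ
  | .wr r a e, σ => σ.set r (a.eval σ) (e.eval σ)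
  | .seq c d, σ => d.exec (c.exec σ)
  | .ite e c d, σ => if 0 < e.eval σ then c.exec σ else d.exec σ
  | .loop i lim e c, σ =>
      (fun s => (c.exec s).set i 0 (c.exec s i 0 + 1))^[(e.eval σ).toNat]
        ((σ.set lim 0 (e.eval σ)).set i 0 0)

/-- One round of a loop: the body and the increment. -/
def Cmd.step (i : Reg) (c : Cmd) (s : St) : St := (c.exec s).set i 0 (c.exec s i 0 + 1)

/-- The number of steps of a command, where all expressions cost the same. -/
def Cmd.cost : Cmd → St → ℕ
  | .skip, _ => 1
  | .wr _ _ _, _ => 1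
  | .seq c d, σ => c.cost σ + d.cost (c.exec σ)
  | .ite e c d, σ => (if 0 < e.eval σ then c.cost σ else d.cost σ) + 1
  | .loop i lim e c, σ =>
      ∑ t ∈ Finset.range (e.eval σ).toNat,
        (c.cost ((Cmd.step i c)^[t] ((σ.set lim 0 (e.eval σ)).set i 0 0)) + 1) + 1

/-- The arrays that a command may change. -/
def Cmd.writes : Cmd → List Reg
  | .skip => []
  | .wr r _ _ => [r]
  | .seq c d => c.writes ++ d.writes
  | .ite _ c d => c.writes ++ d.writes
  | .loop i lim _ c => i :: lim :: c.writes

/-- Loop bodies do not change the loop variable and the number of rounds. -/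
def Cmd.Wf : Cmd → Bool
  | .skip => true
  | .wr _ _ _ => true
  | .seq c d => c.Wf && d.Wf
  | .ite _ c d => c.Wf && d.Wf
  | .loop i lim _ c => c.Wf && decide (i ≠ lim) && decide (i ∉ c.writes) && decide (lim ∉ c.writes)

theorem Cmd.exec_loop (i lim : Reg) (e : Ex) (c : Cmd) (σ : St) :
    (Cmd.loop i lim e c).exec σ =
      (Cmd.step i c)^[(e.eval σ).toNat] ((σ.set lim 0 (e.eval σ)).set i 0 0) := rfl

/-- The frame rule. As `writes` is syntactic, `decide` proves that a given array is untouched; this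
carries facts past whole subprograms. -/
theorem Cmd.exec_of_notMem_writes (c : Cmd) (σ : St) {r : Reg} (h : r ∉ c.writes) :
    c.exec σ r = σ r := by
  induction c generalizing σ with
  | skip => rfl
  | wr r' a e =>
    simp only [Cmd.writes, List.mem_singleton] at h
    simp [Cmd.exec, h]
  | seq c d hc hd =>
    simp only [Cmd.writes, List.mem_append, not_or] at h
    simp [Cmd.exec, hc _ h.1, hd _ h.2]
  | ite e c d hc hd =>
    simp only [Cmd.writes, List.mem_append, not_or] at h
    simp only [Cmd.exec]
    split_ifs
    exacts [hc _ h.1, hd _ h.2]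
  | loop i lim e c hc =>
    simp only [Cmd.writes, List.mem_cons, not_or] at h
    rw [Cmd.exec_loop]
    have key : ∀ (k : ℕ) (s : St), (Cmd.step i c)^[k] s r = s r := by
      intro k
      induction k with
      | zero => intro s; rfl
      | succ k ih =>
        intro s
        rw [Function.iterate_succ_apply, ih, Cmd.step, St.set_of_ne _ h.1, hc _ h.2.2]
    rw [key, St.set_of_ne _ h.1, St.set_of_ne _ h.2.1]

/-! ### Compilation -/

/-- The address of an array entry. -/
def Reg.addr (r : Reg) (a : ℤ) : ℤ := -r.code - 1 - 128 * a

/-- Codes lie between `0` and `127`, so the arrays are interleaved with period `128`. Entries with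
nonnegative index have negative addresses, away from the cells of the input and the output. -/
theorem Reg.addr_inj {r r' : Reg} {a a' : ℤ} : r.addr a = r'.addr a' ↔ r = r' ∧ a = a' := by
  constructor
  · intro h
    have h1 := r.code_nonneg
    have h2 := r'.code_nonneg
    have h3 := r.code_lt
    have h4 := r'.code_lt
    simp only [Reg.addr] at h
    exact ⟨Reg.code_injective (by omega), by omega⟩
  · rintro ⟨rfl, rfl⟩
    rfl

/-- The state that a memory represents. -/
def Memory.view (M : Memory) : St := fun r a => M (r.addr a)

theorem Memory.view_update (M : Memory) (r : Reg) (a v : ℤ) :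
    Memory.view (Function.update M (r.addr a) v) = M.view.set r a v := by
  funext r' a'
  by_cases h : r' = r
  · subst h
    by_cases h' : a' = a
    · subst h'
      simp [Memory.view]
    · have : r'.addr a' ≠ r'.addr a := fun H => h' (Reg.addr_inj.1 H).2
      simp [Memory.view, h', this]
  · have : r'.addr a' ≠ r.addr a := fun H => h (Reg.addr_inj.1 H).1
    simp [Memory.view, h, this]

/-- An expression for `128` times the value of `e`. -/
def RamExpr.mul128 (e : RamExpr) : RamExpr := (fun f => f.plus f)^[7] e

/-- Seven doublings replace the multiplication. The expression grows by a constant factor, so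
addressing an array entry takes constant time. -/
theorem RamExpr.eval_mul128 (M : Memory) (e : RamExpr) : e.mul128.eval M = 128 * e.eval M := by
  simp only [RamExpr.mul128, Function.iterate_succ, Function.comp, Function.iterate_zero, id,
    RamExpr.eval]
  ring

/-- An expression for the address of an array entry. -/
def Reg.addrExpr (r : Reg) (e : RamExpr) : RamExpr := .minus (.lit (-r.code - 1)) e.mul128

theorem Reg.eval_addrExpr (M : Memory) (r : Reg) (e : RamExpr) :
    (r.addrExpr e).eval M = r.addr (e.eval M) := by
  simp [Reg.addrExpr, RamExpr.eval, RamExpr.eval_mul128, Reg.addr]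

/-- The translation of expressions. -/
def Ex.compile : Ex → RamExpr
  | .lit c => .lit c
  | .arr r e => .cell (r.addrExpr e.compile)
  | .add e f => .plus e.compile f.compile
  | .sub e f => .minus e.compile f.compile

theorem Ex.eval_compile (M : Memory) (e : Ex) : e.compile.eval M = e.eval M.view := by
  induction e with
  | lit c => rfl
  | arr r e ih => simp [Ex.compile, RamExpr.eval, Reg.eval_addrExpr, ih, Ex.eval, Memory.view]
  | add e f he hf => simp [Ex.compile, RamExpr.eval, he, hf, Ex.eval]
  | sub e f he hf => simp [Ex.compile, RamExpr.eval, he, hf, Ex.eval]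

/-- The translation of commands. -/
def Cmd.compile : Cmd → RamProg
  | .skip => .skip
  | .wr r a e => .assign (r.addrExpr a.compile) e.compile
  | .seq c d => .seq c.compile d.compile
  | .ite e c d => .branch e.compile c.compile d.compile
  | .loop i lim e c =>
      .seq (.assign (lim.addrExpr (.lit 0)) e.compile) <|
        .seq (.assign (i.addrExpr (.lit 0)) (.lit 0)) <|
          .loop (Ex.sub lim i).compile <|
            .seq c.compile (.assign (i.addrExpr (.lit 0)) (Ex.add i (.lit 1)).compile)

/-- Induction on the number `k` of rounds that remain. By the frame rule the body preserves `i` and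
`lim`, so each round lowers this number by one. The constant is `K` plus the fixed price of one test
and one increment. -/
theorem Cmd.exists_runs_loop {i lim : Reg} {c : Cmd} {K : ℕ} (hil : i ≠ lim)
    (hi : i ∉ c.writes) (hlim : lim ∉ c.writes)
    (hc : ∀ M : Memory, ∃ (t : ℕ) (M' : Memory), Runs c.compile M t M' ∧
      M'.view = c.exec M.view ∧ t ≤ K * c.cost M.view) (k : ℕ) :
    ∀ M : Memory, (M.view lim 0 - M.view i 0).toNat = k → ∃ (t : ℕ) (M' : Memory),
      Runs (.loop (Ex.sub lim i).compile (.seq c.compile (.assign (i.addrExpr (.lit 0))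
        (Ex.add i (.lit 1)).compile))) M t M' ∧
      M'.view = (Cmd.step i c)^[k] M.view ∧
      t ≤ (K + (Ex.sub lim i).compile.cost + (i.addrExpr (.lit 0)).cost +
        (Ex.add i (.lit 1)).compile.cost + 2) *
        (∑ t ∈ Finset.range k, (c.cost ((Cmd.step i c)^[t] M.view) + 1) + 1) := by
  induction k with
  | zero =>
    intro M hM
    refine ⟨_, M, Runs.loop_false ?_, rfl, ?_⟩
    · rw [Ex.eval_compile]
      simp only [Ex.eval]
      omega
    · simp only [Finset.range_zero, Finset.sum_empty]
      omega
  | succ k ih =>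
    intro M hM
    obtain ⟨s, M₁, hr, hv, hs⟩ := hc M
    set M₂ : Memory := Function.update M₁ (i.addr 0) (M₁.view i 0 + 1) with hM₂
    have hv₂ : M₂.view = Cmd.step i c M.view := by
      rw [hM₂, Memory.view_update, hv, Cmd.step]
    obtain ⟨t, M', hr', hv', ht⟩ := ih M₂ (by
      rw [hv₂, Cmd.step, St.set_of_ne _ hil.symm, St.set_self,
        Cmd.exec_of_notMem_writes _ _ hi, Cmd.exec_of_notMem_writes _ _ hlim]
      simp only [Function.update_self]
      omega)
    refine ⟨_, M', Runs.loop_true (t := t) ?_ (Runs.seq hr (Runs.assign _ _ _)) ?_, ?_, ?_⟩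
    · rw [Ex.eval_compile]
      simp only [Ex.eval]
      omega
    · rw [Reg.eval_addrExpr, Ex.eval_compile]
      exact hr'
    · rw [hv', hv₂, Function.iterate_succ_apply]
    · rw [Finset.sum_range_succ']
      simp only [hv₂, Function.iterate_succ_apply, Function.iterate_zero, id] at ht ⊢
      nlinarith

/-- Absorbs the fixed cost `E` of setting up a loop: the cost of a loop is at least `1` even if it
has no rounds. -/
theorem add_le_mul_succ {A S t : ℕ} (E : ℕ) (h : t ≤ A * (S + 1)) :
    E + t ≤ (A + E) * (S + 1) := by
  nlinarith

/-- The constant depends on the text of the command only: each of its finitely many expressions has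
a fixed cost on the machine, whereas every source step counts as `1`. -/
theorem Cmd.exists_runs (c : Cmd) (h : c.Wf) : ∃ K : ℕ, ∀ M : Memory, ∃ (t : ℕ) (M' : Memory),
    Runs c.compile M t M' ∧ M'.view = c.exec M.view ∧ t ≤ K * c.cost M.view := by
  induction c with
  | skip => exact ⟨1, fun M => ⟨1, M, Runs.skip M, rfl, le_rfl⟩⟩
  | wr r a e =>
    refine ⟨(r.addrExpr a.compile).cost + e.compile.cost + 1,
      fun M => ⟨_, _, Runs.assign _ _ M, ?_, ?_⟩⟩
    · rw [Reg.eval_addrExpr, Memory.view_update, Ex.eval_compile, Ex.eval_compile]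
      rfl
    · simp [Cmd.cost]
  | seq c d hc hd =>
    simp only [Cmd.Wf, Bool.and_eq_true] at h
    obtain ⟨K₁, hc⟩ := hc h.1
    obtain ⟨K₂, hd⟩ := hd h.2
    refine ⟨K₁ + K₂, fun M => ?_⟩
    obtain ⟨s, M₁, hr, hv, hs⟩ := hc M
    obtain ⟨t, M₂, hr', hv', ht⟩ := hd M₁
    refine ⟨_, M₂, Runs.seq hr hr', ?_, ?_⟩
    · rw [hv', hv]
      rfl
    · rw [hv] at ht
      simp only [Cmd.cost]
      nlinarith
  | ite e c d hc hd =>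
    simp only [Cmd.Wf, Bool.and_eq_true] at h
    obtain ⟨K₁, hc⟩ := hc h.1
    obtain ⟨K₂, hd⟩ := hd h.2
    refine ⟨K₁ + K₂ + e.compile.cost + 1, fun M => ?_⟩
    by_cases he : 0 < e.eval M.view
    · obtain ⟨s, M₁, hr, hv, hs⟩ := hc M
      refine ⟨_, M₁, Runs.branch_true (by rwa [Ex.eval_compile]) hr, ?_, ?_⟩
      · simp [Cmd.exec, he, hv]
      · simp only [Cmd.cost, he, if_true]
        nlinarith
    · obtain ⟨s, M₁, hr, hv, hs⟩ := hd M
      refine ⟨_, M₁, Runs.branch_false (by rw [Ex.eval_compile]; omega) hr, ?_, ?_⟩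
      · simp [Cmd.exec, he, hv]
      · simp only [Cmd.cost, he, if_false]
        nlinarith
  | loop i lim e c hc =>
    simp only [Cmd.Wf, Bool.and_eq_true, decide_eq_true_eq] at h
    obtain ⟨⟨⟨h₁, h₂⟩, h₃⟩, h₄⟩ := h
    obtain ⟨K, hc⟩ := hc h₁
    refine ⟨K + (Ex.sub lim i).compile.cost + (i.addrExpr (.lit 0)).cost +
        (Ex.add i (.lit 1)).compile.cost + 2 + (lim.addrExpr (.lit 0)).cost + e.compile.cost + 1 +
        (i.addrExpr (.lit 0)).cost + 2, fun M => ?_⟩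
    set M₁ : Memory := Function.update M (lim.addr 0) (e.eval M.view) with hM₁
    set M₂ : Memory := Function.update M₁ (i.addr 0) 0 with hM₂
    have hv₂ : M₂.view = (M.view.set lim 0 (e.eval M.view)).set i 0 0 := by
      rw [hM₂, hM₁, Memory.view_update, Memory.view_update]
    obtain ⟨t, M', hr, hv, ht⟩ := Cmd.exists_runs_loop h₂ h₃ h₄ hc (e.eval M.view).toNat M₂ (by
      rw [hv₂, St.set_self, St.set_of_ne _ h₂.symm]
      simp)
    refine ⟨_, M', Runs.seq (Runs.assign _ _ _) (Runs.seq (t := t) (Runs.assign _ _ _) ?_), ?_, ?_⟩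
    · rw [Reg.eval_addrExpr, Reg.eval_addrExpr, Ex.eval_compile]
      exact hr
    · rw [hv, hv₂, Cmd.exec_loop]
    · rw [hv₂] at ht
      simp only [Cmd.cost, RamExpr.cost]
      refine (le_of_eq ?_).trans ((add_le_mul_succ ((lim.addrExpr (.lit 0)).cost +
        e.compile.cost + 1 + ((i.addrExpr (.lit 0)).cost + 2)) ht).trans (le_of_eq ?_))
      · ring
      · ring

/-! ### Reasoning about commands -/

/-- The command `c` started in the state `σ` takes at most `T` steps and establishes `Q`. -/
def Cmd.Ok (c : Cmd) (σ : St) (Q : St → Prop) (T : ℕ) : Prop := Q (c.exec σ) ∧ c.cost σ ≤ T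

/-- The new postcondition may be derived with the help of the frame rule, so specifications need not
list what is left unchanged. -/
theorem Cmd.Ok.mono {c : Cmd} {σ : St} {Q Q' : St → Prop} {T T' : ℕ} (h : c.Ok σ Q T)
    (hQ : ∀ s, (∀ r, r ∉ c.writes → s r = σ r) → Q s → Q' s) (hT : T ≤ T') : c.Ok σ Q' T' :=
  ⟨hQ _ (fun _ hr => c.exec_of_notMem_writes σ hr) h.1, h.2.trans hT⟩

theorem Cmd.Ok.seq {c d : Cmd} {σ : St} {Q Q' : St → Prop} {T T' T'' : ℕ} (h : c.Ok σ Q T)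
    (h' : ∀ s, (∀ r, r ∉ c.writes → s r = σ r) → Q s → d.Ok s Q' T') (hT : T + T' ≤ T'') :
    (c.seq d).Ok σ Q' T'' := by
  have := h' _ (fun _ hr => c.exec_of_notMem_writes σ hr) h.1
  exact ⟨this.1, (Nat.add_le_add h.2 this.2).trans hT⟩

theorem Cmd.Ok.ite {e : Ex} {c d : Cmd} {σ : St} {Q : St → Prop} {T T' : ℕ}
    (hc : 0 < e.eval σ → c.Ok σ Q T) (hd : e.eval σ ≤ 0 → d.Ok σ Q T) (hT : T + 1 ≤ T') :
    (Cmd.ite e c d).Ok σ Q T' := by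
  by_cases h : 0 < e.eval σ
  · have := hc h
    simp only [Cmd.Ok, Cmd.exec, Cmd.cost, h, if_true]
    exact ⟨this.1, by linarith [this.2]⟩
  · have := hd (not_lt.1 h)
    simp only [Cmd.Ok, Cmd.exec, Cmd.cost, h, if_false]
    exact ⟨this.1, by linarith [this.2]⟩

theorem Cmd.Ok.wr {r : Reg} {a e : Ex} {σ : St} {Q : St → Prop} {T : ℕ}
    (h : Q (σ.set r (a.eval σ) (e.eval σ))) (hT : 1 ≤ T) : (Cmd.wr r a e).Ok σ Q T := ⟨h, hT⟩

theorem Cmd.Ok.asg {r : Reg} {e : Ex} {σ : St} {Q : St → Prop} {T : ℕ}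
    (h : Q (σ.set r 0 (e.eval σ))) (hT : 1 ≤ T) : (Cmd.asg r e).Ok σ Q T := ⟨h, hT⟩

theorem Cmd.Ok.skip {σ : St} {Q : St → Prop} {T : ℕ}
    (h : Q σ) (hT : 1 ≤ T) : Cmd.skip.Ok σ Q T := ⟨h, hT⟩

/-- The rule for loops: an invariant `I` that is indexed by the number of rounds completed, and
a bound on the cost of each round. -/
theorem Cmd.Ok.loop {i lim : Reg} {e : Ex} {c : Cmd} {σ : St} {Q : St → Prop} {N : ℕ} {T' : ℕ}
    (I : ℕ → St → Prop) (T : ℕ → ℕ) (hi : i ∉ c.writes)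
    (hN : e.eval σ = N) (h0 : I 0 ((σ.set lim 0 N).set i 0 0))
    (hstep : ∀ t : ℕ, t < N → ∀ s : St, (∀ r, r ∉ (Cmd.loop i lim e c).writes → s r = σ r) → s i 0 = t → I t s →
      c.Ok s (fun s' => I (t + 1) (s'.set i 0 ((t + 1 : ℕ) : ℤ))) (T t))
    (hQ : ∀ s : St, (∀ r, r ∉ (Cmd.loop i lim e c).writes → s r = σ r) → I N s → Q s)
    (hT : ∑ t ∈ Finset.range N, (T t + 1) + 1 ≤ T') :
    (Cmd.loop i lim e c).Ok σ Q T' := by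
  set σ₀ : St := (σ.set lim 0 N).set i 0 0 with hσ₀
  have key : ∀ t ≤ N, (∀ r, r ∉ (Cmd.loop i lim e c).writes → (Cmd.step i c)^[t] σ₀ r = σ r) ∧
      (Cmd.step i c)^[t] σ₀ i 0 = t ∧ I t ((Cmd.step i c)^[t] σ₀) := by
    intro t
    induction t with
    | zero =>
      intro _
      refine ⟨?_, by simp [hσ₀], h0⟩
      intro r hr
      simp only [Cmd.writes, List.mem_cons, not_or] at hr
      simp [hσ₀, hr.1, hr.2.1]
    | succ t ih =>
      intro ht
      obtain ⟨h₁, h₂, h₃⟩ := ih (by omega)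
      have h₄ := (hstep t (by omega) _ h₁ h₂ h₃).1
      have h₅ : (Cmd.step i c)^[t + 1] σ₀ =
          (c.exec ((Cmd.step i c)^[t] σ₀)).set i 0 ((t + 1 : ℕ) : ℤ) := by
        rw [Function.iterate_succ_apply', Cmd.step, Cmd.exec_of_notMem_writes _ _ hi, h₂]
        simp
      refine ⟨?_, by simp [h₅], by rw [h₅]; exact h₄⟩
      intro r hr
      have hr' := hr
      simp only [Cmd.writes, List.mem_cons, not_or] at hr'
      rw [h₅, St.set_of_ne _ hr'.1, Cmd.exec_of_notMem_writes _ _ hr'.2.2, h₁ r hr]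
  refine ⟨?_, ?_⟩
  · rw [Cmd.exec_loop, hN, Int.toNat_natCast]
    exact hQ _ (key N le_rfl).1 (key N le_rfl).2.2
  · simp only [Cmd.cost, hN, Int.toNat_natCast]
    refine le_trans (Nat.add_le_add_right (Finset.sum_le_sum fun t ht => ?_) 1) hT
    have ht := Finset.mem_range.1 ht
    obtain ⟨h₁, h₂, h₃⟩ := key t ht.le
    exact Nat.add_le_add_right (hstep t ht _ h₁ h₂ h₃).2 1

theorem Cmd.ok_of_exec {c : Cmd} {σ : St} {Q : St → Prop} {T : ℕ} (h : Q (c.exec σ))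
    (hT : c.cost σ ≤ T) : c.Ok σ Q T := ⟨h, hT⟩

/-- The rule for loops with an invariant that also bounds the number of steps taken so far. -/
theorem Cmd.Ok.loop_potential {i lim : Reg} {e : Ex} {c : Cmd} {σ : St} {Q : St → Prop} {N : ℕ}
    {T' : ℕ} (I : ℕ → ℕ → St → Prop) (hi : i ∉ c.writes)
    (hN : e.eval σ = N) (h0 : I 0 0 ((σ.set lim 0 N).set i 0 0))
    (hstep : ∀ t : ℕ, t < N → ∀ (a : ℕ) (s : St),
      (∀ r, r ∉ (Cmd.loop i lim e c).writes → s r = σ r) → s i 0 = t → I t a s →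
      ∃ T, c.Ok s (fun s' => I (t + 1) (a + T + 1) (s'.set i 0 ((t + 1 : ℕ) : ℤ))) T)
    (hQ : ∀ (a : ℕ) (s : St), (∀ r, r ∉ (Cmd.loop i lim e c).writes → s r = σ r) → I N a s →
      Q s ∧ a + 1 ≤ T') :
    (Cmd.loop i lim e c).Ok σ Q T' := by
  set σ₀ : St := (σ.set lim 0 N).set i 0 0 with hσ₀
  have key : ∀ t ≤ N, (∀ r, r ∉ (Cmd.loop i lim e c).writes → (Cmd.step i c)^[t] σ₀ r = σ r) ∧
      (Cmd.step i c)^[t] σ₀ i 0 = t ∧ ∃ a, I t a ((Cmd.step i c)^[t] σ₀) ∧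
        ∑ x ∈ Finset.range t, (c.cost ((Cmd.step i c)^[x] σ₀) + 1) ≤ a := by
    intro t
    induction t with
    | zero =>
      intro _
      refine ⟨?_, by simp [hσ₀], 0, h0, by simp⟩
      intro r hr
      simp only [Cmd.writes, List.mem_cons, not_or] at hr
      simp [hσ₀, hr.1, hr.2.1]
    | succ t ih =>
      intro ht
      obtain ⟨h₁, h₂, a, h₃, h₄⟩ := ih (by omega)
      obtain ⟨T, h₅, h₆⟩ := hstep t (by omega) _ _ h₁ h₂ h₃
      have h₇ : (Cmd.step i c)^[t + 1] σ₀ =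
          (c.exec ((Cmd.step i c)^[t] σ₀)).set i 0 ((t + 1 : ℕ) : ℤ) := by
        rw [Function.iterate_succ_apply', Cmd.step, Cmd.exec_of_notMem_writes _ _ hi, h₂]
        simp
      refine ⟨?_, by simp [h₇], _, by rw [h₇]; exact h₅, ?_⟩
      · intro r hr
        have hr' := hr
        simp only [Cmd.writes, List.mem_cons, not_or] at hr'
        rw [h₇, St.set_of_ne _ hr'.1, Cmd.exec_of_notMem_writes _ _ hr'.2.2, h₁ r hr]
      · rw [Finset.sum_range_succ]
        omega
  obtain ⟨h₁, h₂, a, h₃, h₄⟩ := key N le_rfl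
  obtain ⟨h₅, h₆⟩ := hQ a _ h₁ h₃
  refine ⟨?_, ?_⟩
  · rw [Cmd.exec_loop, hN, Int.toNat_natCast]
    exact h₅
  · simp only [Cmd.cost, hN, Int.toNat_natCast]
    exact (Nat.add_le_add_right h₄ 1).trans h₆

theorem Cmd.Ok.wr_seq {r : Reg} {a e : Ex} {d : Cmd} {σ : St} {Q : St → Prop} {T T' : ℕ}
    (x y : ℤ) (ha : a.eval σ = x) (he : e.eval σ = y) (h : d.Ok (σ.set r x y) Q T)
    (hT : T + 1 ≤ T') : (Cmd.wr r a e ;; d).Ok σ Q T' := by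
  subst ha he
  exact ⟨h.1, (Nat.add_le_add_left h.2 1).trans (by omega)⟩

theorem Cmd.Ok.asg_seq {r : Reg} {e : Ex} {d : Cmd} {σ : St} {Q : St → Prop} {T T' : ℕ}
    (y : ℤ) (he : e.eval σ = y) (h : d.Ok (σ.set r 0 y) Q T)
    (hT : T + 1 ≤ T') : (Cmd.asg r e ;; d).Ok σ Q T' := Cmd.Ok.wr_seq 0 y rfl he h hT

/-! ### Adjacency lists and matrices in memory -/

/-- Uniqueness of division with remainder: the rows of a table of row length `n` do not overlap. -/
theorem mul_add_inj {n a b c d : ℕ} (hb : b < n) (hd : d < n) :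
    (a : ℤ) * n + b = (c : ℤ) * n + d ↔ a = c ∧ b = d := by
  constructor
  · intro h
    have h' : a * n + b = c * n + d := by exact_mod_cast h
    have h1 : (a * n + b) / n = a := by
      rw [mul_comm, Nat.mul_add_div (by omega), Nat.div_eq_of_lt hb, add_zero]
    have h2 : (c * n + d) / n = c := by
      rw [mul_comm, Nat.mul_add_div (by omega), Nat.div_eq_of_lt hd, add_zero]
    have : a = c := by rw [← h1, ← h2, h']
    subst this
    exact ⟨rfl, by omega⟩
  · rintro ⟨rfl, rfl⟩
    rfl

/-- The array `row` holds the multiples of `n`. -/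
def IsRowTable (n len : ℕ) (row : ℤ → ℤ) : Prop := ∀ u : ℕ, u < len → row u = u * n

/-- The arrays `deg` and `nb` hold the lists `out u`: entry `c` of the list `out u` is at the
index `u * n + c`. -/
structure IsAdjList (n : ℕ) (deg nb : ℤ → ℤ) (out : ℕ → List ℕ) : Prop where
  deg_eq : ∀ u : ℕ, u < n → deg u = (out u).length
  nb_eq : ∀ u : ℕ, u < n → ∀ (c : ℕ) (h : c < (out u).length), nb ((u : ℤ) * n + c) = (out u)[c]
  length_le : ∀ u : ℕ, u < n → (out u).length ≤ n

/-- The array `adj` holds the adjacency matrix of the lists `out u`. -/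
def IsAdjMat (n : ℕ) (adj : ℤ → ℤ) (out : ℕ → List ℕ) : Prop :=
  ∀ u v : ℕ, u < n → v < n → adj ((u : ℤ) * n + v) = if v ∈ out u then 1 else 0

/-- The hypothesis on the length keeps the new entry inside row `u`, so no other list is
overwritten. -/
theorem IsAdjList.push {n : ℕ} {deg nb : ℤ → ℤ} {out : ℕ → List ℕ} (h : IsAdjList n deg nb out)
    {u : ℕ} (hu : u < n) (v : ℕ) (hlen : (out u).length < n) :
    IsAdjList n (Function.update deg u (deg u + 1))
      (Function.update nb ((u : ℤ) * n + deg u) v)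
      (Function.update out u (out u ++ [v])) := by
  refine ⟨?_, ?_, ?_⟩
  · intro w hw
    by_cases hwu : w = u
    · subst hwu
      simp [h.deg_eq w hw]
    · simp [hwu, h.deg_eq w hw]
  · intro w hw c hc
    by_cases hwu : w = u
    · subst hwu
      simp only [Function.update_self, List.length_append, List.length_singleton] at hc
      simp only [Function.update_self, h.deg_eq w hw]
      by_cases hc' : c = (out w).length
      · subst hc'
        simp
      · rw [Function.update_of_ne (by
          rw [Ne, mul_add_inj (by omega) hlen]; tauto), h.nb_eq w hw c (by omega),
          List.getElem_append_left]
    · simp only [Function.update_of_ne hwu] at hc ⊢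
      rw [Function.update_of_ne, h.nb_eq w hw c hc]
      rw [h.deg_eq u hu, Ne, mul_add_inj (hc.trans_le (h.length_le w hw)) hlen]
      tauto
  · intro w hw
    by_cases hwu : w = u
    · subst hwu
      simp; omega
    · simp [hwu, h.length_le w hw]

theorem IsAdjMat.push {n : ℕ} {adj : ℤ → ℤ} {out : ℕ → List ℕ} (h : IsAdjMat n adj out)
    {u v : ℕ} (hv : v < n) :
    IsAdjMat n (Function.update adj ((u : ℤ) * n + v) 1)
      (Function.update out u (out u ++ [v])) := by
  intro w x hw hx
  by_cases hwx : w = u ∧ x = v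
  · obtain ⟨rfl, rfl⟩ := hwx
    simp
  · rw [Function.update_of_ne (by rw [Ne, mul_add_inj hx hv]; exact hwx), h w x hw hx]
    by_cases hwu : w = u
    · subst hwu
      have : x ≠ v := by tauto
      simp [this]
    · simp [hwu]

section Programs

open Reg Cmd

/-- Fill the table of the multiples of `n`. -/
def rowTable : Cmd :=
  asg rr 0 ;;
  asg big (n + 4) ;;
  loop x lim1 big (wr row x rr ;; asg rr (rr + n))

/-- Read the edges into adjacency lists and count the incoming edges of each vertex. -/
def readEdges : Cmd :=
  loop e lim1 m (
    asg u (inp # (eb + e + e)) ;;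
    asg v (inp # (eb + e + e + 1)) ;;
    wr nb (row # u + deg # u) v ;;
    wr deg u (deg # u + 1) ;;
    wr ind v (ind # v + 1))

end Programs

/-- Multiples of `n` arise by repeated addition. The number `n + 4` of rounds is kept in `big`,
where it later serves as a base `N > n` for the pairs `a N + b`. -/
theorem rowTable_ok (n : ℕ) (σ : St) (hn : σ .n 0 = n) :
    rowTable.Ok σ (fun s => IsRowTable n (n + 4) (s .row) ∧ s .big 0 = n + 4) (3 * n + 20) := by
  refine Cmd.Ok.seq (Cmd.Ok.asg (Q := fun s => s .rr 0 = 0) (by simp) le_rfl) ?_ (T' := 3 * n + 18)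
    (by omega)
  intro s hf hs
  refine Cmd.Ok.seq (Cmd.Ok.asg (Q := fun s => s .big 0 = n + 4 ∧ s .rr 0 = 0) ?_ le_rfl) ?_
    (T' := 3 * n + 15) (by omega)
  · simp [hs, hf .n (by decide), hn]
  clear hs
  intro s' hf' hs'
  have hn' : s' .n 0 = n := by rw [hf' _ (by decide), hf _ (by decide), hn]
  refine Cmd.Ok.loop (N := n + 4)
    (fun t s => s .rr 0 = (t : ℤ) * n ∧ IsRowTable n t (s .row)) (fun _ => 2) (by decide) ?_ ?_ ?_
    ?_ ?_
  · simp [hs'.1]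
  · simp [hs'.2, IsRowTable]
  · rintro t ht s hf hx ⟨h1, h2⟩
    refine Cmd.ok_of_exec ?_ (by simp [Cmd.cost, Cmd.asg])
    have := hf .n (by decide)
    simp only [Cmd.exec, Cmd.asg, Ex.eval_arr, Ex.eval_lit, hx, h1, Ex.eval_add, Ex.eval_zero]
    constructor
    · simp [h1, this, hn']
      ring
    · intro u hu
      simp
      by_cases hut : u = t
      · simp [hut]
      · rw [Function.update_of_ne (by exact_mod_cast hut)]
        exact h2 u (by omega)
  · rintro s hf ⟨_, h⟩
    exact ⟨h, by rw [hf _ (by decide), hs'.1]⟩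
  · simp; omega

/-- The second components of the pairs in `L` with first component `u`. -/
def outList (L : List (ℕ × ℕ)) (u : ℕ) : List ℕ := (L.filter (fun p => p.1 = u)).map Prod.snd

theorem mem_outList {L : List (ℕ × ℕ)} {u v : ℕ} : v ∈ outList L u ↔ (u, v) ∈ L := by
  simp only [outList, List.mem_map, List.mem_filter, decide_eq_true_eq]
  constructor
  · rintro ⟨⟨a, b⟩, ⟨h, rfl⟩, rfl⟩
    exact h
  · intro h
    exact ⟨(u, v), ⟨h, rfl⟩, rfl⟩

theorem outList_nodup {L : List (ℕ × ℕ)} (h : L.Nodup) (u : ℕ) : (outList L u).Nodup := by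
  refine List.Nodup.map_on ?_ (h.filter _)
  rintro ⟨a, b⟩ hx ⟨c, d⟩ hy hxy
  simp only [List.mem_filter, decide_eq_true_eq] at hx hy
  simp only at hxy
  rw [hxy, hx.2, hy.2]

theorem List.Nodup.length_le_of_lt {l : List ℕ} (h : l.Nodup) {n : ℕ} (hl : ∀ a ∈ l, a < n) :
    l.length ≤ n := by
  have := (h.subperm (l₂ := List.range n) fun a ha => List.mem_range.2 (hl a ha)).length_le
  simpa using this

theorem outList_append_singleton (L : List (ℕ × ℕ)) (p : ℕ × ℕ) :
    outList (L ++ [p]) = Function.update (outList L) p.1 (outList L p.1 ++ [p.2]) := by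
  funext u
  by_cases h : u = p.1
  · subst h
    simp [outList]
  · simp [outList, h, Ne.symm h]

/-- `L` is a list of edges between numbers less than `n` without repetition. -/
structure IsEdges (n : ℕ) (L : List (ℕ × ℕ)) : Prop where
  nodup : L.Nodup
  lt : ∀ p ∈ L, p.1 < n ∧ p.2 < n

theorem readEdges_ok (n b : ℕ) (L : List (ℕ × ℕ)) (hL : IsEdges n L) (σ : St)
    (hm : σ .m 0 = L.length) (heb : σ .eb 0 = b) (hrow : IsRowTable n (n + 4) (σ .row))
    (hinp : ∀ (e : ℕ) (he : e < L.length),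
      σ .inp ((b + e + e : ℕ) : ℤ) = L[e].1 ∧ σ .inp ((b + e + e + 1 : ℕ) : ℤ) = L[e].2)
    (hdeg : ∀ a : ℕ, σ .deg a = 0) (hind : ∀ a : ℕ, σ .ind a = 0) :
    readEdges.Ok σ (fun s => IsAdjList n (s .deg) (s .nb) (outList L) ∧
      ∀ v : ℕ, v < n → s .ind v = L.countP (fun p => p.2 = v)) (6 * L.length + 1) := by
  refine Cmd.Ok.loop (N := L.length)
    (fun t s => IsAdjList n (s .deg) (s .nb) (outList (L.take t)) ∧
      ∀ v : ℕ, v < n → s .ind v = (L.take t).countP (fun p => p.2 = v)) (fun _ => 5) (by decide)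
      ?_ ?_ ?_ ?_ ?_
  · simp [hm]
  · refine ⟨⟨?_, ?_, ?_⟩, ?_⟩ <;> simp [outList, hdeg, hind]
  · rintro t ht s hf hx ⟨h1, h2⟩
    refine Cmd.ok_of_exec ?_ (by simp [Cmd.cost, Cmd.asg])
    obtain ⟨i1, i2⟩ := hinp t ht
    obtain ⟨l1, l2⟩ := hL.lt L[t] (List.getElem_mem ht)
    have r1 : s .row ((L[t].1 : ℕ) : ℤ) = (L[t].1 : ℕ) * (n : ℤ) := by
      rw [hf .row (by decide)]; exact hrow _ (by omega)
    have e1 : s .eb 0 = b := by rw [hf .eb (by decide), heb]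
    rw [← hf .inp (by decide)] at i1 i2
    push_cast at i1 i2
    simp only [Cmd.exec, Cmd.asg, Ex.eval_arr, Ex.eval_lit, hx, Ex.eval_add, Ex.eval_zero,
      Ex.eval_one, St.set_self, St.set_of_ne, ne_eq, reduceCtorEq, not_false_eq_true, e1, i1, i2,
      Function.update_self, r1]
    have htake : L.take (t + 1) = L.take t ++ [L[t]] := by simp
    refine ⟨?_, ?_⟩
    · rw [htake, outList_append_singleton]
      refine h1.push l1 _ ?_
      -- There is room for the new entry: even with it, the list is a sublist of a repetition-free
      -- list of numbers below `n`.
      have hs : (outList L L[t].1).length ≤ n := (outList_nodup hL.nodup _).length_le_of_lt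
        fun a ha => (hL.lt _ (mem_outList.1 ha)).2
      have hs' : ((outList (L.take (t + 1)) L[t].1)).length ≤ (outList L L[t].1).length := by
        simp only [outList, List.length_map]
        exact ((List.take_sublist _ _).filter _).length_le
      rw [htake, outList_append_singleton] at hs'
      simp at hs'
      omega
    · intro v hv
      rw [htake, List.countP_append]
      by_cases hv' : v = L[t].2
      · subst hv'
        simp [h2 _ hv]
      · rw [Function.update_of_ne (by exact_mod_cast hv'), h2 _ hv]
        simp [Ne.symm hv']
  · rintro s hf ⟨h1, h2⟩
    simpa using And.intro h1 h2
  · simp; omega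

/-! ### Topological sorting -/

/-- The number of edges of `E \ D` into `v`. -/
def indegree (E D : Finset (ℕ × ℕ)) (v : ℕ) : ℕ := ((E \ D).filter (fun p => p.2 = v)).card

theorem indegree_eq_zero {E D : Finset (ℕ × ℕ)} {v : ℕ} :
    indegree E D v = 0 ↔ ∀ x, (x, v) ∈ E → (x, v) ∈ D := by
  simp only [indegree, Finset.card_eq_zero, Finset.filter_eq_empty_iff, Finset.mem_sdiff]
  constructor
  · intro h x hx
    by_contra hxD
    exact h ⟨hx, hxD⟩ rfl
  · rintro h ⟨x, w⟩ ⟨h1, h2⟩ rfl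
    exact h2 (h x h1)

theorem indegree_insert_self {E D : Finset (ℕ × ℕ)} {u v : ℕ} (h : (u, v) ∈ E)
    (h' : (u, v) ∉ D) : indegree E (insert (u, v) D) v + 1 = indegree E D v := by
  have : (E \ insert (u, v) D).filter (fun p => p.2 = v) =
      ((E \ D).filter (fun p => p.2 = v)).erase (u, v) := by
    ext p
    simp only [Finset.mem_filter, Finset.mem_sdiff, Finset.mem_insert, Finset.mem_erase]
    tauto
  rw [indegree, indegree, this, Finset.card_erase_add_one]
  simp [h, h']

theorem indegree_insert_of_ne {E D : Finset (ℕ × ℕ)} {u v w : ℕ} (h : w ≠ v) :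
    indegree E (insert (u, v) D) w = indegree E D w := by
  rw [indegree, indegree]
  congr 1
  ext ⟨a, b⟩
  simp only [Finset.mem_filter, Finset.mem_sdiff, Finset.mem_insert, Prod.mk.injEq]
  constructor
  · tauto
  · rintro ⟨⟨h1, h2⟩, rfl⟩
    tauto

/-- The state of the topological sort when the edges in `D` have been removed and the list `qs`
of vertices has been found. -/
structure IsPartialOrder' (n : ℕ) (E D : Finset (ℕ × ℕ)) (qs : List ℕ) : Prop where
  nodup : qs.Nodup
  mem_iff : ∀ v, v ∈ qs ↔ v < n ∧ ∀ x, (x, v) ∈ E → (x, v) ∈ D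
  forward : ∀ (j : ℕ) (h : j < qs.length), ∀ x, (x, qs[j]) ∈ E → x ∈ qs.take j
  source : ∀ p ∈ D, p.1 ∈ qs

/-- The arrays of the topological sort. -/
structure IsSortState (n : ℕ) (E D : Finset (ℕ × ℕ)) (qs : List ℕ) (s : St) : Prop where
  pord : IsPartialOrder' n E D qs
  tl_eq : s .tl 0 = qs.length
  ord_eq : ∀ (j : ℕ) (h : j < qs.length), s .ord j = qs[j]
  ind_eq : ∀ v : ℕ, v < n → s .ind v = indegree E D v

/-- A vertex is found when its last incoming edge is removed. The sources of removed edges are in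
`qs` already, so all predecessors of `v` precede it. -/
theorem IsPartialOrder'.insert_push {n : ℕ} {E D : Finset (ℕ × ℕ)} {qs : List ℕ}
    (h : IsPartialOrder' n E D qs) {u v : ℕ} (hv : v < n) (hE : (u, v) ∈ E) (hD : (u, v) ∉ D)
    (hu : u ∈ qs) (h0 : indegree E (insert (u, v) D) v = 0) :
    IsPartialOrder' n E (insert (u, v) D) (qs ++ [v]) := by
  have hvq : v ∉ qs := fun hvq => hD (((h.mem_iff v).1 hvq).2 u hE)
  have h0' := indegree_eq_zero.1 h0
  refine ⟨?_, ?_, ?_, ?_⟩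
  · rw [List.nodup_append]
    simp only [List.nodup_singleton, List.mem_singleton]
    refine ⟨h.nodup, trivial, ?_⟩
    rintro a ha b rfl rfl
    exact hvq ha
  · intro w
    rw [List.mem_append, List.mem_singleton, h.mem_iff]
    constructor
    · rintro (⟨h1, h2⟩ | rfl)
      · exact ⟨h1, fun x hx => Finset.mem_insert_of_mem (h2 x hx)⟩
      · exact ⟨hv, h0'⟩
    · rintro ⟨h1, h2⟩
      by_cases hw : w = v
      · exact Or.inr hw
      · refine Or.inl ⟨h1, fun x hx => ?_⟩
        have := h2 x hx
        simp only [Finset.mem_insert, Prod.mk.injEq] at this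
        tauto
  · intro j hj x hx
    simp only [List.length_append, List.length_singleton] at hj
    by_cases hj' : j < qs.length
    · rw [List.getElem_append_left hj'] at hx
      rw [List.take_append_of_le_length hj'.le]
      exact h.forward j hj' x hx
    · have : j = qs.length := by omega
      subst this
      simp only [List.getElem_append_right (le_refl _), Nat.sub_self, List.getElem_cons_zero] at hx
      simp only [List.take_left]
      have := h0' x hx
      simp only [Finset.mem_insert, Prod.mk.injEq] at this
      rcases this with ⟨rfl, _⟩ | h1
      · exact hu
      · exact h.source _ h1
  · intro p hp
    rw [List.mem_append]
    rcases Finset.mem_insert.1 hp with rfl | hp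
    · exact Or.inl hu
    · exact Or.inl (h.source p hp)

theorem IsPartialOrder'.insert_of_ne_zero {n : ℕ} {E D : Finset (ℕ × ℕ)} {qs : List ℕ}
    (h : IsPartialOrder' n E D qs) {u v : ℕ} (hu : u ∈ qs)
    (h0 : indegree E (insert (u, v) D) v ≠ 0) :
    IsPartialOrder' n E (insert (u, v) D) qs := by
  refine ⟨h.nodup, ?_, h.forward, ?_⟩
  · intro w
    rw [h.mem_iff]
    constructor
    · rintro ⟨h1, h2⟩
      exact ⟨h1, fun x hx => Finset.mem_insert_of_mem (h2 x hx)⟩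
    · rintro ⟨h1, h2⟩
      by_cases hw : w = v
      · subst hw
        exact absurd (indegree_eq_zero.2 h2) h0
      · refine ⟨h1, fun x hx => ?_⟩
        have := h2 x hx
        simp only [Finset.mem_insert, Prod.mk.injEq] at this
        tauto
  · intro p hp
    rcases Finset.mem_insert.1 hp with rfl | hp
    · exact hu
    · exact h.source p hp

/-- If every edge out of a vertex found has been removed then all vertices have been found. -/
theorem IsPartialOrder'.mem_of_acyclic {n : ℕ} {E D : Finset (ℕ × ℕ)} {qs : List ℕ}
    (h : IsPartialOrder' n E D qs) (hwf : WellFounded fun x v => (x, v) ∈ E)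
    (hE : ∀ p ∈ E, p.1 < n) (hD : ∀ p ∈ E, p.1 ∈ qs → p ∈ D) {v : ℕ} (hv : v < n) :
    v ∈ qs := by
  by_contra hvq
  obtain ⟨w, ⟨hw, hwq⟩, hmin⟩ := hwf.has_min {w | w < n ∧ w ∉ qs} ⟨v, hv, hvq⟩
  refine hwq ((h.mem_iff w).2 ⟨hw, fun x hx => hD _ hx ?_⟩)
  by_contra hxq
  exact hmin x ⟨hE _ hx, hxq⟩ hx

section Programs

open Reg Cmd

/-- Append the vertex `v` to the list of the vertices found. -/
def pushVertex : Cmd := wr ord tl v ;; asg tl (tl + 1)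

/-- Find the vertices without incoming edges. -/
def sortInit : Cmd := asg tl 0 ;; loop v lim1 n (ite (1 - ind # v) pushVertex skip)

/-- Remove the edges out of the vertex `u`. -/
def removeEdges : Cmd :=
  loop c lim2 (deg # u) (
    asg v (nb # (row # u + c)) ;;
    wr ind v (ind # v - 1) ;;
    ite (1 - ind # v) pushVertex skip)

/-- Remove the edges, vertex by vertex. -/
def sortMain : Cmd := loop p lim1 n (asg u (ord # p) ;; wr pos u p ;; removeEdges)

end Programs

theorem sortInit_ok (n : ℕ) (E : Finset (ℕ × ℕ)) (σ : St) (hn : σ .n 0 = n)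
    (hind : ∀ v : ℕ, v < n → σ .ind v = indegree E ∅ v) :
    sortInit.Ok σ (fun s => ∃ qs, IsSortState n E ∅ qs s) (4 * n + 2) := by
  refine Cmd.Ok.seq (Cmd.Ok.asg (Q := fun s => s .tl 0 = 0) (by simp) le_rfl) ?_ (T' := 4 * n + 1)
    (by omega)
  intro s hf hs
  have hind : ∀ v : ℕ, v < n → s .ind v = indegree E ∅ v := by
    rw [hf .ind (by decide)]; exact hind
  refine Cmd.Ok.loop (N := n) (fun t s => ∃ qs : List ℕ, qs.Nodup ∧
    (∀ v, v ∈ qs ↔ v < t ∧ indegree E ∅ v = 0) ∧ s .tl 0 = qs.length ∧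
    ∀ (j : ℕ) (h : j < qs.length), s .ord j = qs[j]) (fun _ => 3) (by decide) ?_ ?_ ?_ ?_ ?_
  · simp [hf .n (by decide), hn]
  · exact ⟨[], by simp, by simp, by simp [hs], by simp⟩
  · rintro t ht s' hf' hx ⟨qs, h1, h2, h3, h4⟩
    have hi : s' .ind t = indegree E ∅ t := by rw [hf' .ind (by decide)]; exact hind t ht
    refine Cmd.Ok.ite (T := 2) ?_ ?_ le_rfl
    · intro h
      simp [hx, hi] at h
      refine Cmd.ok_of_exec ⟨qs ++ [t], ?_⟩ (by simp [Cmd.cost, Cmd.asg, pushVertex])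
      have htq : t ∉ qs := by simp [h2]
      refine ⟨?_, ?_, ?_, ?_⟩
      · rw [List.nodup_append]
        simp only [List.nodup_singleton, List.mem_singleton]
        refine ⟨h1, trivial, ?_⟩
        rintro a ha b rfl rfl
        exact htq ha
      · intro v
        rw [List.mem_append, h2, List.mem_singleton]
        constructor
        · rintro (⟨h5, h6⟩ | rfl)
          · exact ⟨by omega, h6⟩
          · exact ⟨by omega, h⟩
        · rintro ⟨h5, h6⟩
          by_cases hv : v = t
          · exact Or.inr hv
          · exact Or.inl ⟨by omega, h6⟩
      · simp [pushVertex, Cmd.exec, Cmd.asg, h3]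
      · intro j hj
        simp only [List.length_append, List.length_singleton] at hj
        simp only [pushVertex, Cmd.exec, Cmd.asg, Ex.eval_arr, Ex.eval_lit, hx, h3, ne_eq,
          reduceCtorEq, not_false_eq_true, St.set_of_ne, St.set_self]
        by_cases hj' : j = qs.length
        · subst hj'
          simp
        · rw [Function.update_of_ne (by exact_mod_cast hj'), h4 j (by omega),
            List.getElem_append_left]
    · intro h
      simp [hx, hi] at h
      refine Cmd.ok_of_exec ⟨qs, h1, ?_, by simpa [Cmd.exec] using h3,
        by simpa [Cmd.exec] using h4⟩ (by simp [Cmd.cost])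
      intro v
      rw [h2]
      constructor
      · rintro ⟨h5, h6⟩
        exact ⟨by omega, h6⟩
      · rintro ⟨h5, h6⟩
        refine ⟨?_, h6⟩
        have : v ≠ t := by
          rintro rfl
          omega
        omega
  · rintro s' hf' ⟨qs, h1, h2, h3, h4⟩
    refine ⟨qs, ⟨h1, ?_, ?_, by simp⟩, h3, h4, ?_⟩
    · intro v
      rw [h2, indegree_eq_zero]
    · intro j hj x hx
      have h5 := ((h2 _).1 (List.getElem_mem hj)).2
      simpa using indegree_eq_zero.1 h5 x hx
    · rw [hf' .ind (by decide)]
      exact hind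
  · simp; omega

theorem removeEdges_ok (n : ℕ) (E D : Finset (ℕ × ℕ)) (qs : List ℕ) (out : ℕ → List ℕ) (u : ℕ)
    (σ : St) (h : IsSortState n E D qs σ) (hu : u < n) (huq : u ∈ qs) (hσ : σ .u 0 = u)
    (hadj : IsAdjList n (σ .deg) (σ .nb) out) (hrow : IsRowTable n (n + 4) (σ .row))
    (hout : (out u).Nodup) (hE : ∀ v ∈ out u, (u, v) ∈ E ∧ (u, v) ∉ D ∧ v < n) :
    removeEdges.Ok σ (fun s => ∃ qs', qs <+: qs' ∧
      IsSortState n E (D ∪ (out u).toFinset.image (fun v => (u, v))) qs' s)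
      (6 * (out u).length + 1) := by
  refine Cmd.Ok.loop (N := (out u).length) (fun t s => ∃ qs', qs <+: qs' ∧
      IsSortState n E (D ∪ ((out u).take t).toFinset.image (fun v => (u, v))) qs' s)
      (fun _ => 5) (by decide) ?_ ?_ ?_ ?_ ?_
  · simp [hσ, hadj.deg_eq u hu]
  · refine ⟨qs, List.prefix_rfl, ?_⟩
    simpa using ⟨h.pord, h.tl_eq, h.ord_eq, h.ind_eq⟩
  · rintro t ht s hf hx ⟨qs', hpre, hs⟩
    set D' := D ∪ ((out u).take t).toFinset.image (fun v => (u, v)) with hD'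
    have hset : D ∪ ((out u).take (t + 1)).toFinset.image (fun v => (u, v)) =
        insert (u, (out u)[t]) D' := by
      rw [hD', ← List.take_append_getElem ht, List.toFinset_append, Finset.image_union,
        ← Finset.union_assoc]
      ext x
      simp
    obtain ⟨hv1, hv2, hv3⟩ := hE _ (List.getElem_mem ht)
    have hvD : (u, (out u)[t]) ∉ D' := by
      simp only [hD', Finset.mem_union, hv2, false_or, Finset.mem_image, List.mem_toFinset,
        Prod.mk.injEq, true_and, exists_eq_right]
      intro hmem
      obtain ⟨j, hj, hj'⟩ := List.mem_iff_getElem.1 hmem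
      rw [List.getElem_take, hout.getElem_inj_iff] at hj'
      simp at hj
      omega
    rw [hset]
    have e1 : s .u 0 = u := by rw [hf .u (by decide), hσ]
    have e2 : s .row u = (u : ℤ) * n := by rw [hf .row (by decide), hrow u (by omega)]
    have e3 : s .nb ((u : ℤ) * n + t) = (out u)[t] := by
      rw [hf .nb (by decide), hadj.nb_eq u hu t ht]
    have hlt : IsSortState n E D' qs' s := hs
    set v := (out u)[t] with hv
    have hind := hs.ind_eq v hv3
    have hins := indegree_insert_self hv1 hvD
    set s1 : St := (s.set .v 0 v).set .ind v (s .ind v - 1) with hs1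
    refine Cmd.Ok.seq (T := 1) (T' := 4)
      (Cmd.Ok.asg (Q := fun s' => s' = s.set .v 0 v) ?_ le_rfl) ?_ (by omega)
    · simp [e1, e2, hx, e3]
    rintro _ - rfl
    refine Cmd.Ok.seq (T := 1) (T' := 3)
      (Cmd.Ok.wr (Q := fun s' => s' = s1) ?_ le_rfl) ?_ (by omega)
    · simp [hs1]
    rintro _ - rfl
    have hindall : ∀ w : ℕ, w < n → s1 .ind w = indegree E (insert (u, v) D') w := by
      intro w hw
      simp only [hs1, St.set_self, ne_eq, reduceCtorEq, not_false_eq_true, St.set_of_ne]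
      by_cases hwv : w = v
      · subst hwv
        simp only [Function.update_self]
        omega
      · rw [Function.update_of_ne (by exact_mod_cast hwv), indegree_insert_of_ne hwv,
          hs.ind_eq w hw]
    have htl : s1 .tl 0 = qs'.length := by simp [hs1, hs.tl_eq]
    have hord : ∀ (j : ℕ) (h : j < qs'.length), s1 .ord j = qs'[j] := by
      simpa [hs1] using hs.ord_eq
    have hv' : s1 .v 0 = v := by simp [hs1]
    have huq' := hpre.subset huq
    have hiv := hindall v hv3
    clear_value s1
    refine Cmd.Ok.ite (T := 2) ?_ ?_ le_rfl
    · intro h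
      simp [hv', hiv] at h
      have hp := hs.pord.insert_push hv3 hv1 hvD huq' (by omega)
      refine Cmd.ok_of_exec ⟨qs' ++ [v], hpre.trans (List.prefix_append _ _), hp, ?_, ?_, ?_⟩
        (by simp [Cmd.cost, Cmd.asg, pushVertex])
      · simp [pushVertex, Cmd.exec, Cmd.asg, htl]
      · intro j hj
        simp only [List.length_append, List.length_singleton] at hj
        simp only [pushVertex, Cmd.exec, Cmd.asg, Ex.eval_arr, Ex.eval_lit, hv', htl, ne_eq,
          reduceCtorEq, not_false_eq_true, St.set_of_ne, St.set_self]
        by_cases hj' : j = qs'.length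
        · subst hj'
          simp
        · rw [Function.update_of_ne (by exact_mod_cast hj'), hord j (by omega),
            List.getElem_append_left]
      · simpa [pushVertex, Cmd.exec, Cmd.asg] using hindall
    · intro h
      simp [hv', hiv] at h
      refine Cmd.ok_of_exec ⟨qs', hpre, hs.pord.insert_of_ne_zero huq' (by omega),
        by simpa [Cmd.exec] using htl, by simpa [Cmd.exec] using hord,
        by simpa [Cmd.exec] using hindall⟩ (by simp [Cmd.cost])
  · rintro s hf ⟨qs', h1, h2⟩
    exact ⟨qs', h1, by simpa using h2⟩
  · simp; omega

/-- `qs` is a topological order of the vertices. -/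
structure IsTopoOrder (n : ℕ) (L : List (ℕ × ℕ)) (qs : List ℕ) : Prop where
  perm : qs.Perm (List.range n)
  forward : ∀ (a b : ℕ) (ha : a < qs.length) (hb : b < qs.length), (qs[a], qs[b]) ∈ L → a < b

theorem IsTopoOrder.nodup {n : ℕ} {L : List (ℕ × ℕ)} {qs : List ℕ} (h : IsTopoOrder n L qs) :
    qs.Nodup := h.perm.nodup_iff.2 List.nodup_range

theorem IsTopoOrder.length_eq {n : ℕ} {L : List (ℕ × ℕ)} {qs : List ℕ} (h : IsTopoOrder n L qs) :
    qs.length = n := by simpa using h.perm.length_eq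

theorem List.sum_map_range_eq (f : ℕ → ℕ) (n : ℕ) :
    ((List.range n).map f).sum = ∑ i ∈ Finset.range n, f i := by
  induction n with
  | zero => simp
  | succ n ih => simp [List.range_succ, Finset.sum_range_succ, ih]

theorem sum_length_outList {n : ℕ} {L : List (ℕ × ℕ)} (h : ∀ p ∈ L, p.1 < n) :
    ∑ u ∈ Finset.range n, (outList L u).length = L.length := by
  induction L with
  | nil => simp [outList]
  | cons p L ih =>
    have hp := h p (by simp)
    have : ∀ u, (outList (p :: L) u).length =
        (outList L u).length + if u = p.1 then 1 else 0 := by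
      intro u
      by_cases hu : u = p.1
      · subst hu
        simp [outList]
      · simp [outList, hu, Ne.symm hu]
    simp only [this, Finset.sum_add_distrib, ih fun q hq => h q (by simp [hq])]
    simp [hp]

theorem List.Perm.sum_map_range {qs : List ℕ} {n : ℕ} (h : qs.Perm (List.range n)) (f : ℕ → ℕ) :
    (qs.map f).sum = ∑ u ∈ Finset.range n, f u := by
  rw [(h.map f).sum_eq, List.sum_map_range_eq]

/-- The cost of a round is the out-degree of whichever vertex comes next, so the time spent is part
of the invariant. At the end `qs` is a permutation of all vertices and the out-degrees add up to the
number of edges. -/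
theorem sortMain_ok (n : ℕ) (L : List (ℕ × ℕ)) (hL : IsEdges n L)
    (hwf : WellFounded fun x v => (x, v) ∈ L) (σ : St) (hn : σ .n 0 = n)
    (hs : ∃ qs, IsSortState n L.toFinset ∅ qs σ)
    (hadj : IsAdjList n (σ .deg) (σ .nb) (outList L)) (hrow : IsRowTable n (n + 4) (σ .row)) :
    sortMain.Ok σ (fun s => ∃ qs, IsTopoOrder n L qs ∧
      ∀ (j : ℕ) (h : j < qs.length), s .ord j = qs[j] ∧ s .pos (qs[j] : ℕ) = j)
      (6 * L.length + 4 * n + 1) := by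
  have hwf' : WellFounded fun x v => (x, v) ∈ L.toFinset := by simpa using hwf
  -- The queue does not run dry before round `n`: if it did, all edges out of the vertices found
  -- would have been removed, and by acyclicity all `n` vertices would have been found.
  have hfull : ∀ (qs : List ℕ) (t : ℕ), IsPartialOrder' n L.toFinset
      (L.toFinset.filter fun p => p.1 ∈ qs.take t) qs → t < n → t < qs.length := by
    intro qs t h ht
    by_contra hlt
    rw [List.take_of_length_le (not_lt.1 hlt)] at h
    have hsub : List.range n ⊆ qs := fun v hv => h.mem_of_acyclic hwf'
      (fun p hp => (hL.lt p (List.mem_toFinset.1 hp)).1)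
      (fun p hp hpq => Finset.mem_filter.2 ⟨hp, hpq⟩) (List.mem_range.1 hv)
    have := (List.nodup_range.subperm hsub).length_le
    simp at this
    omega
  refine Cmd.Ok.loop_potential (N := n) (fun t a s => ∃ qs, IsSortState n L.toFinset
      (L.toFinset.filter fun p => p.1 ∈ qs.take t) qs s ∧
      (∀ (j : ℕ) (h : j < qs.length), j < t → s .pos (qs[j] : ℕ) = j) ∧
      a ≤ ((qs.take t).map fun u => 6 * (outList L u).length + 4).sum)
      (by decide) ?_ ?_ ?_ ?_
  · simp [hn]
  · obtain ⟨qs, h⟩ := hs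
    exact ⟨qs, by simpa using ⟨h.pord, h.tl_eq, h.ord_eq, h.ind_eq⟩, by simp, by simp⟩
  · rintro t ht a s hf hx ⟨qs, h1, h2, h3⟩
    have htq := hfull qs t h1.pord ht
    have hu : qs[t] < n := ((h1.pord.mem_iff _).1 (List.getElem_mem htq)).1
    have hordt := h1.ord_eq t htq
    refine ⟨6 * (outList L qs[t]).length + 3, Cmd.Ok.asg_seq qs[t] (by simp [hx, hordt])
      (Cmd.Ok.wr_seq qs[t] t (by simp) (by simp [hx]) ?_ le_rfl) le_rfl⟩
    refine (removeEdges_ok n L.toFinset (L.toFinset.filter fun p => p.1 ∈ qs.take t) qs (outList L)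
      qs[t] _ ⟨h1.pord, by simpa using h1.tl_eq, by simpa using h1.ord_eq,
        by simpa using h1.ind_eq⟩ hu (List.getElem_mem htq) (by simp) ?_ ?_
      (outList_nodup hL.nodup _) ?_).mono ?_ le_rfl
    · simpa [hf .deg (by decide), hf .nb (by decide)] using hadj
    · simpa [hf .row (by decide)] using hrow
    · intro v hv
      have hv' := mem_outList.1 hv
      refine ⟨List.mem_toFinset.2 hv', ?_, (hL.lt _ hv').2⟩
      simp only [Finset.mem_filter, List.mem_toFinset, not_and]
      intro _ hmem
      obtain ⟨j, hj, hj'⟩ := List.mem_iff_getElem.1 hmem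
      rw [List.getElem_take, h1.pord.nodup.getElem_inj_iff] at hj'
      simp at hj
      omega
    · rintro s' hf' ⟨qs', hpre, hs'⟩
      obtain ⟨r, rfl⟩ := hpre
      have htake : (qs ++ r).take (t + 1) = qs.take t ++ [qs[t]] := by
        rw [List.take_append_of_le_length (by omega)]
        simp
      refine ⟨qs ++ r, ?_, ?_, ?_⟩
      · have hset : L.toFinset.filter (fun p => p.1 ∈ (qs ++ r).take (t + 1)) =
            L.toFinset.filter (fun p => p.1 ∈ qs.take t) ∪
              (outList L qs[t]).toFinset.image (fun v => (qs[t], v)) := by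
          ext ⟨x, y⟩
          simp only [htake, Finset.mem_filter, List.mem_append, List.mem_singleton,
            Finset.mem_union, Finset.mem_image, List.mem_toFinset, Prod.mk.injEq, mem_outList]
          constructor
          · rintro ⟨h4, h5 | rfl⟩
            · exact Or.inl ⟨h4, h5⟩
            · exact Or.inr ⟨y, h4, rfl, rfl⟩
          · rintro (⟨h4, h5⟩ | ⟨_, h4, rfl, rfl⟩)
            · exact ⟨h4, Or.inl h5⟩
            · exact ⟨h4, Or.inr rfl⟩
        rw [hset]
        exact ⟨hs'.pord, by simpa using hs'.tl_eq, by simpa using hs'.ord_eq,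
          by simpa using hs'.ind_eq⟩
      · intro j hj hjt
        have hj' : j < qs.length := by omega
        rw [St.set_of_ne _ (by simp), hf' .pos (by decide), St.set_self, St.set_of_ne _ (by simp),
          List.getElem_append_left hj']
        by_cases hjt' : j = t
        · subst hjt'
          simp
        · rw [Function.update_of_ne, h2 j hj' (by omega)]
          rw [Ne, Nat.cast_inj, h1.pord.nodup.getElem_inj_iff]
          exact hjt'
      · rw [htake]
        simp only [List.map_append, List.sum_append, List.map_cons, List.map_nil, List.sum_cons,
          List.sum_nil]
        omega
  · rintro a s hf ⟨qs, h1, h2, h3⟩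
    have hlen : n ≤ qs.length := by
      rcases Nat.eq_zero_or_pos n with rfl | hpos
      · exact Nat.zero_le _
      by_contra hlt
      have hq : qs.take n = qs.take qs.length := by
        rw [List.take_of_length_le (by omega), List.take_length]
      have h4 := h1.pord
      rw [hq] at h4
      exact absurd (hfull qs qs.length h4 (by omega)) (lt_irrefl _)
    have hperm : qs.Perm (List.range n) := by
      refine ((h1.pord.nodup.subperm fun v hv => List.mem_range.2
        ((h1.pord.mem_iff v).1 hv).1).perm_of_length_le (by simpa using hlen))
    have hlen' : qs.length = n := by simpa using hperm.length_eq
    refine ⟨⟨qs, ⟨hperm, ?_⟩, fun j hj => ⟨h1.ord_eq j hj, h2 j hj (by omega)⟩⟩, ?_⟩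
    · intro a b ha hb hab
      have := h1.pord.forward b hb _ (List.mem_toFinset.2 hab)
      obtain ⟨j, hj, hj'⟩ := List.mem_iff_getElem.1 this
      rw [List.getElem_take, h1.pord.nodup.getElem_inj_iff] at hj'
      simp at hj
      omega
    · rw [List.take_of_length_le (by omega), hperm.sum_map_range] at h3
      have := sum_length_outList (n := n) (L := L) fun p hp => (hL.lt p hp).1
      simp only [Finset.sum_add_distrib, ← Finset.mul_sum, this] at h3
      simp at h3
      omega

/-! ### Relabelling the vertices by their positions in the topological order -/

/-- Lists of out-neighbours of an acyclic graph on the numbers less than `n` in which all edges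
go from smaller to larger numbers. -/
structure IsTopoGraph (n : ℕ) (out : ℕ → List ℕ) : Prop where
  nodup : ∀ p, (out p).Nodup
  lt : ∀ p, ∀ q ∈ out p, p < q
  bound : ∀ p, ∀ q ∈ out p, q < n

/-- The arrays `deg`, `nb`, `adj` represent the graph `out`. -/
structure IsGraph (n : ℕ) (deg nb adj : ℤ → ℤ) (out : ℕ → List ℕ) : Prop where
  list : IsAdjList n deg nb out
  mat : IsAdjMat n adj out

/-- The lists of out-neighbours with respect to the positions in `qs`. -/
def posList (L : List (ℕ × ℕ)) (qs : List ℕ) (p : ℕ) : List ℕ :=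
  if h : p < qs.length then (outList L qs[p]).map (fun v => qs.idxOf v) else []

theorem IsTopoOrder.mem_of_lt {n : ℕ} {L : List (ℕ × ℕ)} {qs : List ℕ} (h : IsTopoOrder n L qs)
    {v : ℕ} (hv : v < n) : v ∈ qs := h.perm.mem_iff.2 (List.mem_range.2 hv)

theorem IsTopoOrder.lt_of_mem {n : ℕ} {L : List (ℕ × ℕ)} {qs : List ℕ} (h : IsTopoOrder n L qs)
    {v : ℕ} (hv : v ∈ qs) : v < n := List.mem_range.1 (h.perm.mem_iff.1 hv)

theorem mem_posList {n : ℕ} {L : List (ℕ × ℕ)} {qs : List ℕ} (hL : IsEdges n L)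
    (h : IsTopoOrder n L qs) {p q : ℕ} :
    q ∈ posList L qs p ↔
      ∃ (hp : p < qs.length) (hq : q < qs.length), (qs[p], qs[q]) ∈ L := by
  constructor
  · intro hq
    rw [posList] at hq
    split_ifs at hq with hp
    · obtain ⟨v, hv, rfl⟩ := List.mem_map.1 hq
      have hv := mem_outList.1 hv
      have hvq := List.idxOf_lt_length_of_mem (h.mem_of_lt (hL.lt _ hv).2)
      exact ⟨hp, hvq, by rwa [List.getElem_idxOf]⟩
    · simp at hq
  · rintro ⟨hp, hq, hpq⟩
    rw [posList, dif_pos hp]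
    exact List.mem_map.2 ⟨qs[q], mem_outList.2 hpq, h.nodup.idxOf_getElem q hq⟩

theorem IsTopoOrder.isTopoGraph {n : ℕ} {L : List (ℕ × ℕ)} {qs : List ℕ} (hL : IsEdges n L)
    (h : IsTopoOrder n L qs) : IsTopoGraph n (posList L qs) := by
  refine ⟨?_, ?_, ?_⟩
  · intro p
    rw [posList]
    split_ifs with hp
    · refine (outList_nodup hL.nodup _).map_on ?_
      intro x hx y hy hxy
      exact (List.idxOf_inj (h.mem_of_lt (hL.lt _ (mem_outList.1 hx)).2)).1 hxy
    · exact List.nodup_nil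
  · intro p q hq
    obtain ⟨hp, hq, hpq⟩ := (mem_posList hL h).1 hq
    exact h.forward p q hp hq hpq
  · intro p q hq
    obtain ⟨hp, hq, hpq⟩ := (mem_posList hL h).1 hq
    rwa [h.length_eq] at hq

theorem sum_length_posList {n : ℕ} {L : List (ℕ × ℕ)} {qs : List ℕ} (hL : IsEdges n L)
    (h : IsTopoOrder n L qs) : ∑ p ∈ Finset.range n, (posList L qs p).length = L.length := by
  rw [← sum_length_outList fun p hp => (hL.lt p hp).1,
    ← h.perm.sum_map_range (fun u => (outList L u).length), ← List.sum_map_range_eq]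
  congr 1
  refine List.ext_getElem (by simp [h.length_eq]) ?_
  intro p h1 h2
  have hp : p < qs.length := by simpa using h2
  simp [posList, hp]

section Programs

open Reg Cmd

/-- Record an edge from `p` to `q`. -/
def pushEdge (dg nbr mat : Reg) : Cmd :=
  wr nbr (row # p + dg # p) q ;; wr dg p (dg # p + 1) ;; wr mat (row # p + q) 1

/-- Translate the edges to positions. -/
def relabel : Cmd :=
  loop p lim1 n (
    asg u (ord # p) ;;
    loop c lim2 (deg # u) (asg q (pos # (nb # (row # u + c))) ;; pushEdge pdeg pnb padj))

end Programs

theorem IsGraph.push {n : ℕ} {deg nb adj : ℤ → ℤ} {out : ℕ → List ℕ} (h : IsGraph n deg nb adj out)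
    {u : ℕ} (hu : u < n) {v : ℕ} (hv : v < n) (hlen : (out u).length < n) :
    IsGraph n (Function.update deg u (deg u + 1))
      (Function.update nb ((u : ℤ) * n + deg u) v) (Function.update adj ((u : ℤ) * n + v) 1)
      (Function.update out u (out u ++ [v])) :=
  ⟨h.list.push hu v hlen, h.mat.push hv⟩

theorem relabel_ok (n : ℕ) (L : List (ℕ × ℕ)) (hL : IsEdges n L) (qs : List ℕ)
    (hqs : IsTopoOrder n L qs) (σ : St) (hn : σ .n 0 = n)
    (hord : ∀ (j : ℕ) (h : j < qs.length), σ .ord j = qs[j] ∧ σ .pos (qs[j] : ℕ) = j)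
    (hadj : IsAdjList n (σ .deg) (σ .nb) (outList L)) (hrow : IsRowTable n (n + 4) (σ .row))
    (h0 : ∀ a : ℤ, 0 ≤ a → σ .pdeg a = 0 ∧ σ .padj a = 0) :
    relabel.Ok σ (fun s => IsGraph n (s .pdeg) (s .pnb) (s .padj) (posList L qs))
      (5 * L.length + 3 * n + 1) := by
  have hlen := hqs.length_eq
  have htg := hqs.isTopoGraph hL
  refine Cmd.Ok.loop (N := n) (fun t s => IsGraph n (s .pdeg) (s .pnb) (s .padj)
    (fun p => if p < t then posList L qs p else []))
    (fun t => 5 * (posList L qs t).length + 2) (by decide) ?_ ?_ ?_ ?_ ?_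
  · simp [hn]
  · refine ⟨⟨?_, ?_, ?_⟩, ?_⟩
    · intro u hu
      simp [(h0 u (by positivity)).1]
    · simp
    · simp
    · intro u v hu hv
      simp [(h0 ((u : ℤ) * n + v) (by positivity)).2]
  · rintro t ht s hf hx h
    have htq : t < qs.length := by omega
    obtain ⟨h1, -⟩ := hord t htq
    rw [← hf .ord (by decide)] at h1
    have hpl : (posList L qs t).length = (outList L qs[t]).length := by simp [posList, htq]
    have hqt := hqs.lt_of_mem (List.getElem_mem htq)
    refine Cmd.Ok.asg_seq qs[t] (by simp [hx, h1]) ?_ le_rfl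
    refine Cmd.Ok.loop (N := (posList L qs t).length) (fun c s => IsGraph n (s .pdeg) (s .pnb)
      (s .padj) (Function.update (fun p => if p < t then posList L qs p else []) t
        ((posList L qs t).take c))) (fun _ => 4) (by decide) ?_ ?_ ?_ ?_ ?_
    · rw [hpl]
      simp [hf .deg (by decide), hadj.deg_eq _ hqt]
    · have : Function.update (fun p => if p < t then posList L qs p else []) t [] =
          fun p => if p < t then posList L qs p else [] := by
        rw [Function.update_eq_self_iff]; simp
      simpa [this] using h
    · rintro c hc s' hf' hx' h'
      have hc' : c < (outList L qs[t]).length := by omega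
      have hv := mem_outList.1 (List.getElem_mem hc')
      have hvn := (hL.lt _ hv).2
      have hvq := List.idxOf_lt_length_of_mem (hqs.mem_of_lt hvn)
      have e1 : s' .u 0 = qs[t] := by simp [hf' .u (by decide)]
      have e2 : s' .p 0 = t := by simp [hf' .p (by decide), hx]
      have e3 : s' .row = σ .row := by
        rw [hf' .row (by decide), St.set_of_ne _ (by simp), hf .row (by decide)]
      have e4 : s' .nb = σ .nb := by
        rw [hf' .nb (by decide), St.set_of_ne _ (by simp), hf .nb (by decide)]
      have e5 : s' .pos = σ .pos := by
        rw [hf' .pos (by decide), St.set_of_ne _ (by simp), hf .pos (by decide)]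
      have e6 := hadj.nb_eq _ hqt c hc'
      have e7 : (posList L qs t)[c] = qs.idxOf (outList L qs[t])[c] := by simp [posList, htq]
      have e8 := (hord _ hvq).2
      rw [List.getElem_idxOf, ← e7] at e8
      refine Cmd.ok_of_exec ?_ (by simp [Cmd.cost, Cmd.asg, pushEdge])
      have hbound : (posList L qs t)[c] < n := htg.bound _ _ (List.getElem_mem hc)
      have := h'.push ht (v := (posList L qs t)[c]) hbound
        (by
          have := (htg.nodup t).length_le_of_lt fun a ha => htg.bound t a ha
          rw [Function.update_self, List.length_take]
          omega)
      simp only [Function.update_self, Function.update_idem, List.take_append_getElem] at this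
      simpa [Cmd.exec, Cmd.asg, pushEdge, e1, e2, e3, e4, e5, hrow _ (show qs[t] < n + 4 by omega),
        hrow t (by omega), hx', e6, e8] using this
    · rintro s' hf' h'
      have : Function.update (fun p => if p < t then posList L qs p else []) t (posList L qs t) =
          fun p => if p < t + 1 then posList L qs p else [] := by
        funext p
        by_cases hp : p = t
        · subst hp; simp
        · simp only [Function.update_of_ne hp]
          congr 1
          simp only [eq_iff_iff]
          omega
      rw [List.take_length, this] at h'
      simpa using h'
    · simp; omega
  · rintro s hf h
    have : (fun p => if p < n then posList L qs p else []) = posList L qs := by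
      funext p
      by_cases hp : p < n
      · simp [hp]
      · simp [posList, hlen, hp]
    rwa [this] at h
  · have := sum_length_posList hL hqs
    simp only [Finset.sum_add_distrib, ← Finset.mul_sum, this]
    simp
    omega

/-! ### Deleting the short edges -/

/-- The out-neighbours that are left when the edges of length less than `D` are deleted. -/
def longList (a : ℕ → ℤ) (D : ℤ) (out : ℕ → List ℕ) (p : ℕ) : List ℕ :=
  (out p).filter (fun q => D ≤ a q - a p)

theorem IsTopoGraph.longList {n : ℕ} {out : ℕ → List ℕ} (h : IsTopoGraph n out) (a : ℕ → ℤ)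
    (D : ℤ) : IsTopoGraph n (longList a D out) :=
  ⟨fun p => (h.nodup p).filter _, fun p q hq => h.lt p q (List.mem_of_mem_filter hq),
    fun p q hq => h.bound p q (List.mem_of_mem_filter hq)⟩

section Programs

open Reg Cmd

/-- Delete the edges with utility difference less than `d`. -/
def filterEdges : Cmd :=
  loop p lim1 n (
    loop c lim2 (pdeg # p) (
      asg q (pnb # (row # p + c)) ;;
      ite (al # q - al # p - d + 1) (pushEdge hdeg hnb hadj) skip))

end Programs

theorem filterEdges_ok (n : ℕ) (out : ℕ → List ℕ) (hout : IsTopoGraph n out) (a : ℕ → ℤ) (D : ℤ)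
    (σ : St) (hn : σ .n 0 = n) (hd : σ .d 0 = D) (hal : ∀ p : ℕ, p < n → σ .al p = a p)
    (hg : IsGraph n (σ .pdeg) (σ .pnb) (σ .padj) out) (hrow : IsRowTable n (n + 4) (σ .row))
    (hnil : ∀ p, n ≤ p → out p = [])
    (h0 : ∀ a : ℤ, 0 ≤ a → σ .hdeg a = 0 ∧ σ .hadj a = 0) :
    filterEdges.Ok σ (fun s => IsGraph n (s .hdeg) (s .hnb) (s .hadj) (longList a D out))
      (6 * ∑ p ∈ Finset.range n, (out p).length + 2 * n + 1) := by
  refine Cmd.Ok.loop (N := n) (fun t s => IsGraph n (s .hdeg) (s .hnb) (s .hadj)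
    (fun p => if p < t then longList a D out p else []))
    (fun t => 6 * (out t).length + 1) (by decide) ?_ ?_ ?_ ?_ ?_
  · simp [hn]
  · refine ⟨⟨?_, ?_, ?_⟩, ?_⟩
    · intro u hu
      simp [(h0 u (by positivity)).1]
    · simp
    · simp
    · intro u v hu hv
      simp [(h0 ((u : ℤ) * n + v) (by positivity)).2]
  · rintro t ht s hf hx h
    refine Cmd.Ok.loop (N := (out t).length) (fun c s => IsGraph n (s .hdeg) (s .hnb)
      (s .hadj) (Function.update (fun p => if p < t then longList a D out p else []) t
        (((out t).take c).filter (fun q => D ≤ a q - a t)))) (fun _ => 5) (by decide) ?_ ?_ ?_ ?_ ?_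
    · simp [hf .pdeg (by decide), hx, hg.list.deg_eq t ht]
    · have : Function.update (fun p => if p < t then longList a D out p else []) t [] =
          fun p => if p < t then longList a D out p else [] := by
        rw [Function.update_eq_self_iff]; simp
      simpa [this] using h
    · rintro c hc s' hf' hx' h'
      have hbound : (out t)[c] < n := hout.bound _ _ (List.getElem_mem hc)
      have e2 : s' .p 0 = t := by simp [hf' .p (by decide), hx]
      have e3 : s' .row t = t * n := by
        rw [hf' .row (by decide), hf .row (by decide), hrow t (by omega)]
      have e4 : s' .pnb ((t : ℤ) * n + c) = (out t)[c] := by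
        rw [hf' .pnb (by decide), hf .pnb (by decide), hg.list.nb_eq t ht c hc]
      have e5 : s' .al t = a t := by
        rw [hf' .al (by decide), hf .al (by decide), hal t ht]
      have e6 : s' .al (out t)[c] = a (out t)[c] := by
        rw [hf' .al (by decide), hf .al (by decide), hal _ hbound]
      have e7 : s' .d 0 = D := by
        rw [hf' .d (by decide), hf .d (by decide), hd]
      refine Cmd.Ok.asg_seq (out t)[c] (by simp [hx', e2, e3, e4]) ?_ le_rfl
      refine Cmd.Ok.ite (T := 3) ?_ ?_ le_rfl
      · intro hpos
        simp [e2, e5, e6, e7] at hpos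
        refine Cmd.ok_of_exec ?_ (by simp [Cmd.cost, pushEdge])
        have := h'.push ht (v := (out t)[c]) hbound (by
          have h1 := (hout.nodup t).length_le_of_lt fun a ha => hout.bound t a ha
          have h2 := List.length_filter_le (fun q => decide (D ≤ a q - a t)) ((out t).take c)
          rw [List.length_take] at h2
          rw [Function.update_self]
          omega)
        simp only [Function.update_self, Function.update_idem] at this
        have hfil : ((out t).take (c + 1)).filter (fun q => D ≤ a q - a t) =
            ((out t).take c).filter (fun q => D ≤ a q - a t) ++ [(out t)[c]] := by
          rw [← List.take_append_getElem hc, List.filter_append]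
          simp
          omega
        rw [hfil]
        simpa [Cmd.exec, pushEdge, e2, e3] using this
      · intro hneg
        simp [e2, e5, e6, e7] at hneg
        refine Cmd.ok_of_exec ?_ (by simp [Cmd.cost])
        have hfil : ((out t).take (c + 1)).filter (fun q => D ≤ a q - a t) =
            ((out t).take c).filter (fun q => D ≤ a q - a t) := by
          rw [← List.take_append_getElem hc, List.filter_append]
          simp
          omega
        rw [hfil]
        simpa [Cmd.exec] using h'
    · rintro s' hf' h'
      have : Function.update (fun p => if p < t then longList a D out p else []) t
          ((out t).filter (fun q => D ≤ a q - a t)) =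
          fun p => if p < t + 1 then longList a D out p else [] := by
        funext p
        by_cases hp : p = t
        · subst hp; simp [longList]
        · simp only [Function.update_of_ne hp]
          congr 1
          simp only [eq_iff_iff]
          omega
      rw [List.take_length, this] at h'
      simpa using h'
    · simp; omega
  · rintro s hf h
    have : (fun p => if p < n then longList a D out p else []) = longList a D out := by
      funext p
      by_cases hp : p < n
      · simp [hp]
      · simp [longList, hnil p (not_lt.1 hp), hp]
    rwa [this] at h
  · simp only [Finset.sum_add_distrib, ← Finset.mul_sum]
    simp
    omega

/-! ### The chains of a graph, level by level -/

/-- `l` is a chain: a clique listed in topological order. -/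
structure IsOutChain (n : ℕ) (out : ℕ → List ℕ) (l : List ℕ) : Prop where
  pairwise : l.Pairwise fun p q => q ∈ out p
  bound : ∀ p ∈ l, p < n

theorem isOutChain_nil {n : ℕ} {out : ℕ → List ℕ} : IsOutChain n out [] := ⟨by simp, by simp⟩

theorem IsOutChain.sublist {n : ℕ} {out : ℕ → List ℕ} {l l' : List ℕ} (h : IsOutChain n out l)
    (hl : l'.Sublist l) : IsOutChain n out l' :=
  ⟨h.pairwise.sublist hl, fun p hp => h.bound p (hl.subset hp)⟩

theorem isOutChain_append {n : ℕ} {out : ℕ → List ℕ} {l l' : List ℕ} :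
    IsOutChain n out (l ++ l') ↔
      IsOutChain n out l ∧ IsOutChain n out l' ∧ ∀ p ∈ l, ∀ q ∈ l', q ∈ out p := by
  constructor
  · intro h
    exact ⟨h.sublist (List.sublist_append_left _ _), h.sublist (List.sublist_append_right _ _),
      (List.pairwise_append.1 h.pairwise).2.2⟩
  · rintro ⟨h1, h2, h3⟩
    refine ⟨List.pairwise_append.2 ⟨h1.pairwise, h2.pairwise, h3⟩, fun p hp => ?_⟩
    rcases List.mem_append.1 hp with hp | hp
    exacts [h1.bound p hp, h2.bound p hp]

/-- A vertex of minimum out-degree of a nonempty list. -/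
def minVertex (out : ℕ → List ℕ) : List ℕ → ℕ
  | [] => 0
  | p :: l => l.foldl (fun w c => if (out c).length < (out w).length then c else w) p

/-- Lets the vertex of least out-degree be maintained by one comparison when a chain grows; ties
keep the earlier vertex. -/
theorem minVertex_append_singleton (out : ℕ → List ℕ) {l : List ℕ} (h : l ≠ []) (c : ℕ) :
    minVertex out (l ++ [c]) =
      if (out c).length < (out (minVertex out l)).length then c else minVertex out l := by
  cases l with
  | nil => exact absurd rfl h
  | cons p l =>
    simp only [minVertex, List.cons_append, List.foldl_append, List.foldl_cons, List.foldl_nil]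
    rfl

theorem minVertex_mem (out : ℕ → List ℕ) {l : List ℕ} (h : l ≠ []) : minVertex out l ∈ l := by
  induction l using List.reverseRecOn with
  | nil => exact absurd rfl h
  | append_singleton l c ih =>
    by_cases hl : l = []
    · subst hl
      simp [minVertex]
    · rw [minVertex_append_singleton out hl]
      split_ifs
      · simp
      · exact List.mem_append_left _ (ih hl)

theorem length_out_minVertex_le (out : ℕ → List ℕ) {l : List ℕ} {p : ℕ} (h : p ∈ l) :
    (out (minVertex out l)).length ≤ (out p).length := by
  induction l using List.reverseRecOn generalizing p with
  | nil => simp at h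
  | append_singleton l c ih =>
    by_cases hl : l = []
    · subst hl
      simp only [List.nil_append, List.mem_singleton] at h
      simp [minVertex, h]
    · rw [minVertex_append_singleton out hl]
      rcases List.mem_append.1 h with h | h
      · have := ih h
        split_ifs <;> omega
      · rw [List.mem_singleton.1 h]
        split_ifs <;> omega

open Classical in
/-- The chains that extend the chain `l` by one vertex at the end. -/
noncomputable def extensions (n : ℕ) (out : ℕ → List ℕ) (l : List ℕ) : List (List ℕ) :=
  ((out (minVertex out l)).filter fun c => IsOutChain n out (l ++ [c])).map fun c => l ++ [c]

/-- The chains of length `q + 1`, in the order in which they are found. -/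
noncomputable def level (n : ℕ) (out : ℕ → List ℕ) : ℕ → List (List ℕ)
  | 0 => (List.range n).map fun v => [v]
  | q + 1 => (level n out q).flatMap (extensions n out)

/-- No extension is missed by looking at one vertex only: whatever extends a chain is an
out-neighbour of all its members, in particular of the one with the fewest. -/
theorem mem_extensions {n : ℕ} {out : ℕ → List ℕ} {l l' : List ℕ} (hl : l ≠ []) :
    l' ∈ extensions n out l ↔ ∃ c, l' = l ++ [c] ∧ IsOutChain n out (l ++ [c]) := by
  simp only [extensions, List.mem_map, List.mem_filter, decide_eq_true_eq]
  constructor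
  · rintro ⟨c, ⟨-, hc⟩, rfl⟩
    exact ⟨c, rfl, hc⟩
  · rintro ⟨c, rfl, hc⟩
    exact ⟨c, ⟨(isOutChain_append.1 hc).2.2 _ (minVertex_mem out hl) c (by simp), hc⟩, rfl⟩

theorem mem_level {n : ℕ} {out : ℕ → List ℕ} {q : ℕ} {l : List ℕ} :
    l ∈ level n out q ↔ l.length = q + 1 ∧ IsOutChain n out l := by
  induction q generalizing l with
  | zero =>
    simp only [level, List.mem_map, List.mem_range]
    constructor
    · rintro ⟨v, hv, rfl⟩
      exact ⟨rfl, by simp, by simpa using hv⟩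
    · rintro ⟨h1, h2⟩
      obtain ⟨v, rfl⟩ := List.length_eq_one_iff.1 h1
      exact ⟨v, h2.bound v (by simp), rfl⟩
  | succ q ih =>
    simp only [level, List.mem_flatMap]
    constructor
    · rintro ⟨l', h1, h2⟩
      obtain ⟨h3, h4⟩ := ih.1 h1
      obtain ⟨c, rfl, hc⟩ := (mem_extensions (by rintro rfl; simp at h3)).1 h2
      exact ⟨by simp [h3], hc⟩
    · rintro ⟨h1, h2⟩
      have hne : l ≠ [] := by rintro rfl; simp at h1
      have hl := List.dropLast_append_getLast hne
      refine ⟨l.dropLast, ih.2 ⟨by simp [h1], h2.sublist (List.dropLast_sublist l)⟩, ?_⟩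
      rw [mem_extensions (by intro h; have := congrArg List.length h; simp at this; omega)]
      exact ⟨_, hl.symm, by rwa [hl]⟩

theorem extensions_nodup {n : ℕ} {out : ℕ → List ℕ} (h : IsTopoGraph n out) (l : List ℕ) :
    (extensions n out l).Nodup := by
  refine ((h.nodup _).filter _).map ?_
  intro a b hab
  simpa using hab

theorem level_nodup {n : ℕ} {out : ℕ → List ℕ} (h : IsTopoGraph n out) (q : ℕ) :
    (level n out q).Nodup := by
  induction q with
  | zero => exact List.nodup_range.map fun a b hab => by simpa using hab
  | succ q ih =>
    rw [level, List.nodup_flatMap]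
    refine ⟨fun l _ => extensions_nodup h l, ?_⟩
    refine List.Pairwise.imp_of_mem ?_ ih
    intro a b ha hb hab l hla hlb
    have ha' : a ≠ [] := by rintro rfl; simpa using (mem_level.1 ha).1
    have hb' : b ≠ [] := by rintro rfl; simpa using (mem_level.1 hb).1
    obtain ⟨c, rfl, _⟩ := (mem_extensions ha').1 hla
    obtain ⟨d, hd, _⟩ := (mem_extensions hb').1 hlb
    exact hab (List.append_inj' hd rfl).1

/-- Extending a chain at its end keeps its first vertex, so the order of the first level is
inherited. The dynamic program relies on this order. -/
theorem level_pairwise_headD {n : ℕ} {out : ℕ → List ℕ} (q : ℕ) :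
    (level n out q).Pairwise fun a b => a.headD 0 ≤ b.headD 0 := by
  induction q with
  | zero =>
    rw [level, List.pairwise_map]
    exact List.pairwise_lt_range.imp fun h => by simpa using h.le
  | succ q ih =>
    rw [level, List.pairwise_flatMap]
    have key : ∀ a ∈ level n out q, ∀ l ∈ extensions n out a, l.headD 0 = a.headD 0 := by
      intro a ha l hl
      have ha' : a ≠ [] := by rintro rfl; simpa using (mem_level.1 ha).1
      obtain ⟨c, rfl, _⟩ := (mem_extensions ha').1 hl
      cases a with
      | nil => exact absurd rfl ha'
      | cons x a => rfl
    refine ⟨?_, ?_⟩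
    · intro a ha
      refine List.Pairwise.imp_of_mem ?_ (List.pairwise_of_forall (R := fun _ _ => True)
        fun _ _ => trivial)
      intro x y hx hy _
      rw [key a ha x hx, key a ha y hy]
    · refine List.Pairwise.imp_of_mem ?_ ih
      intro a b ha hb hab x hx y hy
      rw [key a ha x hx, key b hb y hy]
      exact hab

/-- The chains of length at most `q`, in the order in which they are found. -/
noncomputable def nodes (n : ℕ) (out : ℕ → List ℕ) : ℕ → List (List ℕ)
  | 0 => [[]]
  | q + 1 => nodes n out q ++ level n out q

theorem mem_nodes {n : ℕ} {out : ℕ → List ℕ} {q : ℕ} {l : List ℕ} :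
    l ∈ nodes n out q ↔ l.length ≤ q ∧ IsOutChain n out l := by
  induction q with
  | zero =>
    simp only [nodes, List.mem_singleton, Nat.le_zero, List.length_eq_zero_iff]
    constructor
    · rintro rfl
      exact ⟨rfl, isOutChain_nil⟩
    · exact fun h => h.1
  | succ q ih =>
    rw [nodes, List.mem_append, ih, mem_level]
    constructor
    · rintro (⟨h1, h2⟩ | ⟨h1, h2⟩)
      exacts [⟨by omega, h2⟩, ⟨by omega, h2⟩]
    · rintro ⟨h1, h2⟩
      rcases Nat.lt_or_ge q l.length with h | h
      exacts [Or.inr ⟨by omega, h2⟩, Or.inl ⟨h, h2⟩]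

/-- A tail of a chain can be extended by the vertices by which the chain can be extended, and
conversely if the first vertex is adjacent to the new one. -/
theorem isOutChain_append_singleton_iff {n : ℕ} {out : ℕ → List ℕ} {p : ℕ} {l : List ℕ} {c : ℕ}
    (h : IsOutChain n out (p :: l)) :
    IsOutChain n out (p :: l ++ [c]) ↔ IsOutChain n out (l ++ [c]) ∧ c ∈ out p := by
  constructor
  · intro h'
    exact ⟨h'.sublist (List.sublist_cons_self _ _),
      (isOutChain_append.1 h').2.2 p (by simp) c (by simp)⟩
  · rintro ⟨h1, h2⟩
    refine ⟨List.pairwise_cons.2 ⟨?_, h1.pairwise⟩, ?_⟩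
    · intro q hq
      rcases List.mem_append.1 hq with hq | hq
      · exact (List.pairwise_cons.1 h.pairwise).1 q hq
      · rwa [List.mem_singleton.1 hq]
    · intro q hq
      rcases List.mem_cons.1 hq with rfl | hq
      exacts [h.bound q (by simp), h1.bound q hq]

/-! ### The tree of chains in memory -/

/-- The chain that represents the state after the chain `l` has been read: its last `k`
vertices, if `l` has at most `k + 1` vertices. -/
def target (k : ℕ) (l : List ℕ) : List ℕ := if l.length ≤ k then l else l.tail

/-- The chains in `T` are represented in memory. The index of a chain in `T` is its number. -/
structure IsTrie (n k : ℕ) (out : ℕ → List ℕ) (T : List (List ℕ)) (s : St) : Prop where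
  nodup : T.Nodup
  head : T.head? = some []
  dropLast_mem : ∀ l ∈ T, l.dropLast ∈ T
  tail_mem : ∀ l ∈ T, l.tail ∈ T
  cnt_eq : s .cnt 0 = T.length
  cr_eq : s .cr 0 = T.length * n
  last_eq : ∀ (id : ℕ) (h : id < T.length), s .last id = (T[id].getLastD 0 : ℕ)
  fst_eq : ∀ (id : ℕ) (h : id < T.length), s .fst id = (T[id].headD 0 : ℕ)
  par_eq : ∀ (id : ℕ) (h : id < T.length), s .par id = (T.idxOf T[id].dropLast : ℕ)
  suf_eq : ∀ (id : ℕ) (h : id < T.length), s .suf id = (T.idxOf T[id].tail : ℕ)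
  mdv_eq : ∀ (id : ℕ) (h : id < T.length), s .mdv id = (minVertex out T[id] : ℕ)
  tgt_eq : ∀ (id : ℕ) (h : id < T.length), s .tgt id = (T.idxOf (target k T[id]) : ℕ)
  rowt_eq : ∀ id : ℕ, id < T.length → s .rowt id = id * n
  chd_eq : ∀ (id c : ℕ), c < n → s .chd ((id : ℤ) * n + c) =
    if h : id < T.length then (if T[id] ++ [c] ∈ T then (T.idxOf (T[id] ++ [c]) : ℤ) else 0) else 0

section Programs

open Reg Cmd

/-- Create a node for the extension of the chain number `id` by the vertex `v`. -/
def createNode : Cmd :=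
  wr last cnt v ;; wr fst cnt y ;; wr par cnt id ;; wr suf cnt s ;; wr mdv cnt z ;;
  wr tgt cnt o ;; wr rowt cnt cr ;; wr chd (rowt # id + v) cnt ;;
  asg cnt (cnt + 1) ;; asg cr (cr + n)

/-- Create the chains of length `1`. -/
def createRoot : Cmd :=
  asg cnt 1 ;; asg cr n ;;
  loop x lim1 n (
    asg v x ;; asg id 0 ;; asg s 0 ;; asg y x ;; asg z x ;; asg o cnt ;; createNode)

/-- Create the extensions of the chain number `id`, whose vertex of minimum degree is `w`. -/
def createExtensions : Cmd :=
  loop c lim3 (hdeg # w) (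
    asg v (hnb # (row # w + c)) ;;
    asg s (chd # (rowt # (suf # id) + v)) ;;
    asg y (fst # id) ;;
    ite s
      (ite (hadj # (row # y + v))
        (ite (hdeg # w - hdeg # v) (asg z v) (asg z w) ;;
          ite (k - x - 1) (asg o cnt) (asg o s) ;;
          createNode)
        skip)
      skip)

/-- Create the chains of length at most `k + 1`. -/
def createNodes : Cmd :=
  createRoot ;;
  asg lo 1 ;;
  loop x lim1 k (
    asg sz (cnt - lo) ;; asg bs lo ;; asg lo cnt ;;
    loop t lim2 sz (asg id (bs + t) ;; asg w (mdv # id) ;; createExtensions))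

end Programs

/-- The common pattern for the arrays of the tree: they grow by one entry at the index `T.length`.
Two functions `g` and `g'` are needed because entries that are node numbers refer to `T` before and
to `T ++ [l]` after the step; they agree on the old nodes. -/
theorem update_eq_append {α : Type*} {T : List α} {l : α} {f : ℤ → ℤ} {g g' : α → ℤ} {x : ℤ}
    (h : ∀ (id : ℕ) (h : id < T.length), f id = g T[id]) (hg : ∀ a ∈ T, g' a = g a)
    (hx : x = g' l) (id : ℕ) (hid : id < (T ++ [l]).length) :
    Function.update f (T.length : ℤ) x id = g' (T ++ [l])[id] := by
  simp only [List.length_append, List.length_singleton] at hid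
  by_cases h' : id = T.length
  · subst h'
    simp [hx]
  · have h'' : id < T.length := by omega
    rw [Function.update_of_ne (by exact_mod_cast h'), h id h'', List.getElem_append_left h'',
      hg _ (List.getElem_mem h'')]

theorem target_mem {T : List (List ℕ)} (h : ∀ l ∈ T, l.tail ∈ T) (k : ℕ) {l : List ℕ}
    (hl : l ∈ T) : target k l ∈ T := by
  rw [target]
  split_ifs
  exacts [hl, h l hl]

/-- Appending to `T` keeps the numbers of the old nodes, so the only old table entry that has to
change is the child entry of `P` at `c`. The target is looked up in the extended list since it may
be the new node itself. -/
theorem createNode_ok {n k : ℕ} {out : ℕ → List ℕ} {T : List (List ℕ)} {σ : St}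
    (h : IsTrie n k out T σ) {P : List ℕ} {c : ℕ} (hP : P ∈ T) (hc : c < n)
    (hl : P ++ [c] ∉ T) (htail : (P ++ [c]).tail ∈ T) (hn : σ .n 0 = n) (hv : σ .v 0 = c)
    (hid : σ .id 0 = T.idxOf P) (hs : σ .s 0 = T.idxOf (P ++ [c]).tail)
    (hy : σ .y 0 = ((P ++ [c]).headD 0 : ℕ)) (hz : σ .z 0 = (minVertex out (P ++ [c]) : ℕ))
    (ho : σ .o 0 = ((T ++ [P ++ [c]]).idxOf (target k (P ++ [c])) : ℕ)) :
    createNode.Ok σ (IsTrie n k out (T ++ [P ++ [c]])) 10 := by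
  refine Cmd.ok_of_exec ?_ (by simp [Cmd.cost, Cmd.asg, createNode])
  have hPlt : T.idxOf P < T.length := List.idxOf_lt_length_of_mem hP
  have hne : (T.length : ℤ) ≠ (T.idxOf P : ℕ) := by
    have := hPlt.ne'
    exact_mod_cast this
  have hrow := h.rowt_eq _ hPlt
  have hidx : ∀ a ∈ T, (T ++ [P ++ [c]]).idxOf a = T.idxOf a :=
    fun a ha => List.idxOf_append_of_mem ha
  constructor
  · rw [List.nodup_append]
    simp only [List.nodup_singleton, List.mem_singleton]
    refine ⟨h.nodup, trivial, ?_⟩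
    rintro a ha b rfl rfl
    exact hl ha
  · rw [List.head?_append, h.head]
    rfl
  · intro l hl'
    rcases List.mem_append.1 hl' with hl' | hl'
    · exact List.mem_append_left _ (h.dropLast_mem l hl')
    · rw [List.mem_singleton.1 hl', List.dropLast_concat]
      exact List.mem_append_left _ hP
  · intro l hl'
    rcases List.mem_append.1 hl' with hl' | hl'
    · exact List.mem_append_left _ (h.tail_mem l hl')
    · rw [List.mem_singleton.1 hl']
      exact List.mem_append_left _ htail
  · simp [createNode, Cmd.exec, Cmd.asg, h.cnt_eq]
  · simp [createNode, Cmd.exec, Cmd.asg, h.cr_eq, hn]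
    ring
  · simp only [createNode, Cmd.exec, Cmd.asg, ne_eq, reduceCtorEq, not_false_eq_true, St.set_of_ne,
      St.set_self, Ex.eval_arr, Ex.eval_lit, h.cnt_eq, hv]
    exact update_eq_append (g := fun l : List ℕ => (l.getLastD 0 : ℕ)) h.last_eq (fun _ _ => rfl) (by simp)
  · simp only [createNode, Cmd.exec, Cmd.asg, ne_eq, reduceCtorEq, not_false_eq_true, St.set_of_ne,
      St.set_self, Ex.eval_arr, Ex.eval_lit, h.cnt_eq, hy]
    exact update_eq_append (g := fun l : List ℕ => (l.headD 0 : ℕ)) h.fst_eq (fun _ _ => rfl) rfl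
  · simp only [createNode, Cmd.exec, Cmd.asg, ne_eq, reduceCtorEq, not_false_eq_true, St.set_of_ne,
      St.set_self, Ex.eval_arr, Ex.eval_lit, h.cnt_eq, hid]
    exact update_eq_append (g := fun l : List ℕ => (T.idxOf l.dropLast : ℕ))
      (g' := fun l : List ℕ => ((T ++ [P ++ [c]]).idxOf l.dropLast : ℕ)) h.par_eq
      (fun a ha => by rw [hidx _ (h.dropLast_mem a ha)]) (by simp [hidx P hP])
  · simp only [createNode, Cmd.exec, Cmd.asg, ne_eq, reduceCtorEq, not_false_eq_true, St.set_of_ne,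
      St.set_self, Ex.eval_arr, Ex.eval_lit, h.cnt_eq, hs]
    exact update_eq_append (g := fun l : List ℕ => (T.idxOf l.tail : ℕ))
      (g' := fun l : List ℕ => ((T ++ [P ++ [c]]).idxOf l.tail : ℕ)) h.suf_eq
      (fun a ha => by rw [hidx _ (h.tail_mem a ha)]) (by rw [hidx _ htail])
  · simp only [createNode, Cmd.exec, Cmd.asg, ne_eq, reduceCtorEq, not_false_eq_true, St.set_of_ne,
      St.set_self, Ex.eval_arr, Ex.eval_lit, h.cnt_eq, hz]
    exact update_eq_append (g := fun l : List ℕ => (minVertex out l : ℕ)) h.mdv_eq (fun _ _ => rfl) rfl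
  · simp only [createNode, Cmd.exec, Cmd.asg, ne_eq, reduceCtorEq, not_false_eq_true, St.set_of_ne,
      St.set_self, Ex.eval_arr, Ex.eval_lit, h.cnt_eq, ho]
    exact update_eq_append (g := fun l : List ℕ => (T.idxOf (target k l) : ℕ))
      (g' := fun l : List ℕ => ((T ++ [P ++ [c]]).idxOf (target k l) : ℕ)) h.tgt_eq
      (fun a ha => by rw [hidx _ (target_mem h.tail_mem k ha)]) rfl
  · intro id hid'
    simp only [createNode, Cmd.exec, Cmd.asg, ne_eq, reduceCtorEq, not_false_eq_true, St.set_of_ne,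
      St.set_self, Ex.eval_arr, Ex.eval_lit, h.cnt_eq, h.cr_eq]
    simp only [List.length_append, List.length_singleton] at hid'
    by_cases h' : id = T.length
    · subst h'
      simp
    · rw [Function.update_of_ne (by exact_mod_cast h'), h.rowt_eq id (by omega)]
  · intro id c' hc'
    simp only [createNode, Cmd.exec, Cmd.asg, ne_eq, reduceCtorEq, not_false_eq_true, St.set_of_ne,
      St.set_self, Ex.eval_arr, Ex.eval_lit, Ex.eval_add, h.cnt_eq, hv, hid,
      Function.update_of_ne hne.symm, hrow]
    by_cases heq : id = T.idxOf P ∧ c' = c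
    · obtain ⟨rfl, rfl⟩ := heq
      have h1 : T.idxOf P < (T ++ [P ++ [c']]).length := by simp; omega
      have h2 : (T ++ [P ++ [c']])[T.idxOf P] = P := by
        rw [List.getElem_append_left hPlt, List.getElem_idxOf]
      simp [h1, h2, List.idxOf_append_of_notMem hl, -List.length_append]
    · rw [Function.update_of_ne (by rw [Ne, mul_add_inj hc' hc]; exact heq), h.chd_eq id c' hc']
      rcases lt_trichotomy id T.length with hlt | rfl | hgt
      · have h1 : id < (T ++ [P ++ [c]]).length := by simp; omega
        have h2 : T[id] ++ [c'] ≠ P ++ [c] := by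
          intro h3
          obtain ⟨h4, h5⟩ := List.append_inj' h3 rfl
          refine heq ⟨?_, by simpa using h5⟩
          rw [← h4, h.nodup.idxOf_getElem]
        rw [dif_pos hlt, dif_pos h1, List.getElem_append_left hlt]
        by_cases h3 : T[id] ++ [c'] ∈ T
        · rw [if_pos h3, if_pos (List.mem_append_left _ h3), hidx _ h3]
        · rw [if_neg h3, if_neg]
          rw [List.mem_append, List.mem_singleton]
          tauto
      -- The row of the new node has no children: a chain in `T` that extends the new node would
      -- have it as a prefix, and `T` is closed under `dropLast`.
      · have h1 : T.length < (T ++ [P ++ [c]]).length := by simp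
        rw [dif_neg (lt_irrefl _), dif_pos h1, if_neg]
        simp only [List.getElem_append_right (le_refl _), Nat.sub_self, List.getElem_cons_zero]
        rw [List.mem_append, List.mem_singleton]
        rintro (h2 | h2)
        · have := h.dropLast_mem _ h2
          rw [List.dropLast_concat] at this
          exact hl this
        · have := congrArg List.length h2
          simp at this
      · rw [dif_neg (by omega), dif_neg (by simp; omega)]

theorem IsTrie.congr {n k : ℕ} {out : ℕ → List ℕ} {T : List (List ℕ)} {s s' : St}
    (h : IsTrie n k out T s) (hs : ∀ r ∈ [Reg.cnt, .cr, .last, .fst, .par, .suf, .mdv, .tgt, .rowt,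
      .chd], s' r = s r) : IsTrie n k out T s' := by
  simp only [List.mem_cons, List.not_mem_nil, or_false, forall_eq_or_imp, forall_eq] at hs
  obtain ⟨e1, e2, e3, e4, e5, e6, e7, e8, e9, e10⟩ := hs
  obtain ⟨h1, h2, h3, h4, h5, h6, h7, h8, h9, h10, h11, h12, h13, h14⟩ := h
  refine ⟨h1, h2, h3, h4, ?_, ?_, ?_, ?_, ?_, ?_, ?_, ?_, ?_, ?_⟩ <;> simpa only [e1, e2, e3, e4, e5, e6, e7, e8, e9, e10]

/-- A memory of zeros represents the tree of the empty chain. The number `0` is the root and, as the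
root is nobody's child, it also marks a missing child; so the child table needs no initialisation.
-/
theorem isTrie_nil {n k : ℕ} {out : ℕ → List ℕ} {s : St} (h1 : s .cnt 0 = 1) (h2 : s .cr 0 = n)
    (h0 : ∀ r ∈ [Reg.last, .fst, .par, .suf, .mdv, .tgt, .rowt, .chd], ∀ a : ℤ, 0 ≤ a → s r a = 0) :
    IsTrie n k out [[]] s := by
  have key : ∀ r ∈ [Reg.last, .fst, .par, .suf, .mdv, .tgt, .rowt, .chd], s r 0 = 0 :=
    fun r hr => h0 r hr 0 le_rfl
  have htarget : target k [] = [] := by simp [target]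
  constructor
  · simp
  · simp
  · simp
  · simp
  · simp [h1]
  · simp [h2]
  · intro id h
    simp only [List.length_singleton, Nat.lt_one_iff] at h
    subst h
    simp [key]
  · intro id h
    simp only [List.length_singleton, Nat.lt_one_iff] at h
    subst h
    simp [key]
  · intro id h
    simp only [List.length_singleton, Nat.lt_one_iff] at h
    subst h
    simp [key]
  · intro id h
    simp only [List.length_singleton, Nat.lt_one_iff] at h
    subst h
    simp [key]
  · intro id h
    simp only [List.length_singleton, Nat.lt_one_iff] at h
    subst h
    simp [key, minVertex]
  · intro id h
    simp only [List.length_singleton, Nat.lt_one_iff] at h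
    subst h
    simp [key, htarget]
  · intro id h
    simp only [List.length_singleton, Nat.lt_one_iff] at h
    subst h
    simp [key]
  · intro id c hc
    rw [h0 .chd (by simp) _ (by positivity)]
    split_ifs with h3 h4
    · simp at h4
    · rfl
    · rfl

theorem createRoot_ok {n k : ℕ} {out : ℕ → List ℕ} (hk : 1 ≤ k) (σ : St) (hn : σ .n 0 = n)
    (h0 : ∀ r ∈ [Reg.last, .fst, .par, .suf, .mdv, .tgt, .rowt, .chd], ∀ a : ℤ, 0 ≤ a → σ r a = 0) :
    createRoot.Ok σ (IsTrie n k out (nodes n out 1)) (17 * n + 3) := by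
  refine Cmd.Ok.asg_seq 1 rfl (Cmd.Ok.asg_seq n (by simp [hn]) ?_ le_rfl) (T := 17 * n + 2) le_rfl
  refine Cmd.Ok.loop (N := n)
    (fun t s => IsTrie n k out ([] :: (List.range t).map fun v => [v]) s) (fun _ => 16)
    (by decide) ?_ ?_ ?_ ?_ ?_
  · simp [hn]
  · refine isTrie_nil (by simp) (by simp) ?_
    intro r hr a ha
    rw [← h0 r hr a ha]
    simp only [List.mem_cons, List.not_mem_nil, or_false] at hr
    rcases hr with rfl | rfl | rfl | rfl | rfl | rfl | rfl | rfl <;> simp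
  · intro t ht s hf hx h
    have hsn : s .n 0 = n := by rw [hf .n (by decide)]; simp [hn]
    refine Cmd.Ok.asg_seq t (by simp [hx]) ?_ (T := 15) le_rfl
    refine Cmd.Ok.asg_seq 0 (by simp) ?_ (T := 14) le_rfl
    refine Cmd.Ok.asg_seq 0 (by simp) ?_ (T := 13) le_rfl
    refine Cmd.Ok.asg_seq t (by simp [hx]) ?_ (T := 12) le_rfl
    refine Cmd.Ok.asg_seq t (by simp [hx]) ?_ (T := 11) le_rfl
    refine Cmd.Ok.asg_seq (t + 1 : ℕ) (by simp [h.cnt_eq]) ?_ (T := 10) le_rfl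
    have hT : [] :: (List.range (t + 1)).map (fun v => [v]) =
        ([] :: (List.range t).map fun v => [v]) ++ [[] ++ [t]] := by
      simp [List.range_succ]
    have hnot : [] ++ [t] ∉ ([] :: (List.range t).map fun v => [v]) := by
      simp
    have htgt : target k ([] ++ [t]) = [] ++ [t] := by
      rw [target, if_pos (by simpa using hk)]
    rw [hT]
    refine (createNode_ok (P := []) (c := t) (h.congr ?_) (by simp) ht hnot (by simp) (by simp [hsn])
      (by simp) (by simp) (by simp) (by simp) (by simp [minVertex]) ?_).mono ?_ le_rfl
    · intro r hr
      simp only [List.mem_cons, List.not_mem_nil, or_false] at hr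
      rcases hr with rfl | rfl | rfl | rfl | rfl | rfl | rfl | rfl | rfl | rfl <;> simp
    · rw [htgt, List.idxOf_append_of_notMem hnot]
      simp
    · intro s' _ h'
      refine h'.congr ?_
      intro r hr
      simp only [List.mem_cons, List.not_mem_nil, or_false] at hr
      rcases hr with rfl | rfl | rfl | rfl | rfl | rfl | rfl | rfl | rfl | rfl <;> simp
  · intro s _ h
    exact h
  · simp; omega

/-- The part of the extensions of `l` that comes from the first `c` candidates. -/
noncomputable def extensionsTake (n : ℕ) (out : ℕ → List ℕ) (l : List ℕ) (c : ℕ) :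
    List (List ℕ) :=
  open Classical in
  (((out (minVertex out l)).take c).filter fun c => IsOutChain n out (l ++ [c])).map
    fun c => l ++ [c]

theorem length_of_mem_extensionsTake {n : ℕ} {out : ℕ → List ℕ} {l l' : List ℕ} {c : ℕ}
    (h : l' ∈ extensionsTake n out l c) : l'.length = l.length + 1 := by
  obtain ⟨d, _, rfl⟩ := List.mem_map.1 h
  simp

/-- Each candidate takes constant time. For `Q = a :: Q'` the vertex `v` is admissible exactly if
`Q' ++ [v]` is a chain and `v` is an out-neighbour of `a`. The former has `q + 1` vertices, so it is
already a node if it is a chain, and it is reached by the suffix link of `Q` and one child lookup.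
`X` holds the extensions that come from other chains of the level. -/
theorem createExtensions_ok {n k q : ℕ} {out : ℕ → List ℕ} (hout : IsTopoGraph n out)
    {X : List (List ℕ)} {Q : List ℕ} (hQ : Q ∈ level n out q)
    (hX : ∀ l ∈ X, l.length = q + 2 ∧ l.dropLast ≠ Q) (σ : St) (hn : σ .n 0 = n) (hk : σ .k 0 = k)
    (hx : σ .x 0 = q) (hw : σ .w 0 = (minVertex out Q : ℕ))
    (hid : σ .id 0 = ((nodes n out (q + 1) ++ X).idxOf Q : ℕ))
    (hg : IsGraph n (σ .hdeg) (σ .hnb) (σ .hadj) out) (hrow : IsRowTable n (n + 4) (σ .row))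
    (h : IsTrie n k out (nodes n out (q + 1) ++ X) σ) :
    createExtensions.Ok σ
      (fun s => IsTrie n k out (nodes n out (q + 1) ++ (X ++ extensions n out Q)) s)
      (20 * (out (minVertex out Q)).length + 1) := by
  obtain ⟨hQlen, hQc⟩ := mem_level.1 hQ
  obtain ⟨a, Q', rfl⟩ : ∃ a Q', Q = a :: Q' := by
    cases Q with
    | nil => simp at hQlen
    | cons a Q' => exact ⟨a, Q', rfl⟩
  set Q := a :: Q' with hQdef
  set w := minVertex out Q with hwdef
  have hQne : Q ≠ [] := by simp [hQdef]
  have hwn : w < n := hQc.bound _ (minVertex_mem out hQne)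
  have hQmem : Q ∈ nodes n out (q + 1) := mem_nodes.2 ⟨hQlen.le, hQc⟩
  have han : a < n := hQc.bound _ (by simp [hQdef])
  refine Cmd.Ok.loop (N := (out w).length) (fun c s => IsTrie n k out
    (nodes n out (q + 1) ++ (X ++ extensionsTake n out Q c)) s) (fun _ => 19) (by decide) ?_ ?_ ?_ ?_ ?_
  · simp [hw, hg.list.deg_eq w hwn]
  · have : extensionsTake n out Q 0 = [] := by simp [extensionsTake]
    rw [this, List.append_nil]
    refine h.congr ?_
    intro r hr
    simp only [List.mem_cons, List.not_mem_nil, or_false] at hr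
    rcases hr with rfl | rfl | rfl | rfl | rfl | rfl | rfl | rfl | rfl | rfl <;> simp
  · intro c hc s hf hcx hs
    set T := nodes n out (q + 1) ++ (X ++ extensionsTake n out Q c) with hT
    set v := (out w)[c] with hv
    have hvn : v < n := hout.bound _ _ (List.getElem_mem hc)
    have hQT : Q ∈ T := List.mem_append_left _ hQmem
    have hidT : T.idxOf Q = (nodes n out (q + 1) ++ X).idxOf Q := by
      rw [hT, List.idxOf_append_of_mem hQmem, List.idxOf_append_of_mem hQmem]
    have hlong : ∀ l ∈ X ++ extensionsTake n out Q c, l.length = q + 2 := by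
      intro l hl
      rcases List.mem_append.1 hl with hl | hl
      · exact (hX l hl).1
      · rw [length_of_mem_extensionsTake hl, hQlen]
    have htailT : Q' ∈ T := hs.tail_mem _ hQT
    have hshort : ∀ l : List ℕ, l.length = q + 1 → (l ∈ T ↔ IsOutChain n out l) := by
      intro l hl
      rw [hT, List.mem_append, mem_nodes]
      constructor
      · rintro (hl' | hl')
        · exact hl'.2
        · have := hlong l hl'
          omega
      · exact fun hl' => Or.inl ⟨by omega, hl'⟩
    have hQ'len : Q'.length = q := by simpa [hQdef] using hQlen
    have hext := isOutChain_append_singleton_iff (c := v) hQc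
    have hmemtail := hshort (Q' ++ [v]) (by simp [hQ'len])
    have e1 : s .w 0 = w := by rw [hf .w (by decide), hw]
    have e2 : s .row = σ .row := hf .row (by decide)
    have e3 : s .hnb = σ .hnb := hf .hnb (by decide)
    have e4 : s .id 0 = T.idxOf Q := by rw [hf .id (by decide), hid, hidT]
    have e5 : s .hadj = σ .hadj := hf .hadj (by decide)
    have e6 : s .hdeg = σ .hdeg := hf .hdeg (by decide)
    have e7 : s .k 0 = k := by rw [hf .k (by decide), hk]
    have e8 : s .x 0 = q := by rw [hf .x (by decide), hx]
    have e9 : s .n 0 = n := by rw [hf .n (by decide), hn]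
    have hQlt := List.idxOf_lt_length_of_mem hQT
    have htlt := List.idxOf_lt_length_of_mem htailT
    have hsuf := hs.suf_eq _ hQlt
    have hfst := hs.fst_eq _ hQlt
    rw [List.getElem_idxOf] at hsuf hfst
    rw [hQdef, List.tail_cons] at hsuf
    rw [hQdef, List.headD_cons] at hfst
    rw [← hQdef] at hsuf hfst
    have hchd := hs.chd_eq (T.idxOf Q') v hvn
    rw [dif_pos htlt, List.getElem_idxOf] at hchd
    have hrowt := hs.rowt_eq _ htlt
    have hchain : extensionsTake n out Q (c + 1) =
        extensionsTake n out Q c ++ (open Classical in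
          if IsOutChain n out (Q ++ [v]) then [Q ++ [v]] else []) := by
      classical
      rw [extensionsTake, ← List.take_append_getElem hc, List.filter_append, List.map_append]
      congr 1
      by_cases hvc : IsOutChain n out (Q ++ [v])
      · rw [if_pos hvc, List.filter_cons_of_pos (by simpa using hvc)]
        simp [hv]
      · rw [if_neg hvc, List.filter_cons_of_neg (by simpa using hvc)]
        simp
    refine Cmd.Ok.asg_seq v ?_ ?_ (T := 18) le_rfl
    · simp [e1, e2, e3, hrow w (by omega), hcx, hg.list.nb_eq w hwn c hc, hv]
    refine Cmd.Ok.asg_seq (if Q' ++ [v] ∈ T then (T.idxOf (Q' ++ [v]) : ℤ) else 0) ?_ ?_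
      (T := 17) le_rfl
    · simp [e4, hsuf, hrowt, hchd]
    refine Cmd.Ok.asg_seq (a : ℕ) (by simp [e4, hfst]) ?_ (T := 16) le_rfl
    have hframe : ∀ s' : St, (∀ r ∈ [Reg.cnt, .cr, .last, .fst, .par, .suf, .mdv, .tgt, .rowt,
        .chd], s' r = s r) → IsTrie n k out T s' := fun s' hs' => hs.congr hs'
    have hskip : ¬ IsOutChain n out (Q ++ [v]) → ∀ s' : St, (∀ r ∈ [Reg.cnt, .cr, .last, .fst,
        .par, .suf, .mdv, .tgt, .rowt, .chd], s' r = s r) →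
        IsTrie n k out (nodes n out (q + 1) ++ (X ++ extensionsTake n out Q (c + 1))) s' := by
      intro hno s' hs'
      rw [hchain, if_neg hno, List.append_nil]
      exact hs.congr hs'
    refine Cmd.Ok.ite (T := 15) ?_ ?_ le_rfl
    · intro hpos
      have hin : Q' ++ [v] ∈ T := by
        by_contra hin
        simp [hin] at hpos
      simp only [if_pos hin]
      refine Cmd.Ok.ite (T := 14) ?_ ?_ le_rfl
      · intro hpos'
        have hav : v ∈ out a := by
          by_contra hav
          simp [e2, e5, hrow a (by omega), hg.mat a v han hvn, hav] at hpos'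
        have hvc : IsOutChain n out (Q ++ [v]) := hext.2 ⟨hmemtail.1 hin, hav⟩
        -- The node is new: the chains in `nodes` are too short, those in `X` have another prefix,
        -- and earlier candidates for `Q` differ from `v` because `out w` has no repetitions.
        have hnot : Q ++ [v] ∉ T := by
          rw [hT, List.mem_append, List.mem_append]
          rintro (h1 | h1 | h1)
          · have := (mem_nodes.1 h1).1
            rw [List.length_append, hQlen] at this
            simp at this
          · exact (hX _ h1).2 (List.dropLast_concat)
          · obtain ⟨d, hd, hd'⟩ := List.mem_map.1 h1
            have hdv : d = v := by simpa using hd'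
            have hd := List.mem_of_mem_filter hd
            rw [hdv] at hd
            obtain ⟨j, hj, hj'⟩ := List.mem_iff_getElem.1 hd
            rw [List.getElem_take, hv, (hout.nodup w).getElem_inj_iff] at hj'
            simp at hj
            omega
        have hmin := minVertex_append_singleton out hQne v
        rw [← hwdef] at hmin
        refine Cmd.Ok.seq (T := 2) (T' := 12) (Q := fun s' => s' .z 0 = (minVertex out (Q ++ [v]) : ℕ))
          (Cmd.Ok.ite (T := 1) ?_ ?_ le_rfl) ?_ le_rfl
        · intro hlt
          refine Cmd.Ok.asg ?_ le_rfl
          simp [e1, e6, hg.list.deg_eq v hvn, hg.list.deg_eq w hwn] at hlt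
          rw [hmin, if_pos (by omega)]
          simp
        · intro hge
          refine Cmd.Ok.asg ?_ le_rfl
          simp [e1, e6, hg.list.deg_eq v hvn, hg.list.deg_eq w hwn] at hge
          rw [hmin, if_neg (by omega)]
          simp [e1]
        intro s₁ hf₁ hz₁
        -- The new chain has `q + 2` vertices. If this is at most `k` it is its own target, with the
        -- number `cnt`; otherwise the target is its tail, whose number is in `s`.
        refine Cmd.Ok.seq (T := 2) (T' := 10) (Q := fun s' => s' .o 0 =
          ((T ++ [Q ++ [v]]).idxOf (target k (Q ++ [v])) : ℕ))
          (Cmd.Ok.ite (T := 1) ?_ ?_ le_rfl) ?_ le_rfl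
        · intro hlt
          refine Cmd.Ok.asg ?_ le_rfl
          simp [hf₁ .k (by decide), hf₁ .x (by decide), e7, e8] at hlt
          rw [target, if_pos (by simp [hQlen]; omega), List.idxOf_append_of_notMem hnot]
          simp [hf₁ .cnt (by decide), hs.cnt_eq]
        · intro hge
          refine Cmd.Ok.asg ?_ le_rfl
          simp [hf₁ .k (by decide), hf₁ .x (by decide), e7, e8] at hge
          have htl : (Q ++ [v]).tail = Q' ++ [v] := by simp [hQdef]
          rw [target, if_neg (by simp [hQlen]; omega), htl, List.idxOf_append_of_mem hin]
          simp [hf₁ .s (by decide)]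
        intro s₂ hf₂ ho₂
        have e10 : s₂ .n 0 = n := by rw [hf₂ .n (by decide), hf₁ .n (by decide)]; simp [e9]
        have e11 : s₂ .v 0 = v := by rw [hf₂ .v (by decide), hf₁ .v (by decide)]; simp
        have e12 : s₂ .id 0 = T.idxOf Q := by
          rw [hf₂ .id (by decide), hf₁ .id (by decide)]; simp [e4]
        have e13 : s₂ .s 0 = T.idxOf (Q ++ [v]).tail := by
          rw [hf₂ .s (by decide), hf₁ .s (by decide)]; simp [hQdef]
        have e14 : s₂ .y 0 = ((Q ++ [v]).headD 0 : ℕ) := by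
          rw [hf₂ .y (by decide), hf₁ .y (by decide)]; simp [hQdef]
        have e15 : s₂ .z 0 = (minVertex out (Q ++ [v]) : ℕ) := by rw [hf₂ .z (by decide), hz₁]
        refine (createNode_ok (hframe s₂ ?_) hQT hvn hnot (by simpa [hQdef] using hin) e10 e11 e12
          e13 e14 e15 ho₂).mono ?_ le_rfl
        · intro r hr
          simp only [List.mem_cons, List.not_mem_nil, or_false] at hr
          rcases hr with rfl | rfl | rfl | rfl | rfl | rfl | rfl | rfl | rfl | rfl <;>
          · rw [hf₂ _ (by decide), hf₁ _ (by decide)]; simp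
        · intro s' _ h'
          rw [hchain, if_pos hvc, ← List.append_assoc X, ← List.append_assoc, ← hT]
          refine h'.congr ?_
          intro r hr
          simp only [List.mem_cons, List.not_mem_nil, or_false] at hr
          rcases hr with rfl | rfl | rfl | rfl | rfl | rfl | rfl | rfl | rfl | rfl <;> simp
      · intro hneg
        have hav : v ∉ out a := by
          intro hav
          simp [e2, e5, hrow a (by omega), hg.mat a v han hvn, hav] at hneg
        refine Cmd.Ok.skip (hskip (fun hvc => hav (hext.1 hvc).2) _ ?_) (by norm_num)
        intro r hr
        simp only [List.mem_cons, List.not_mem_nil, or_false] at hr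
        rcases hr with rfl | rfl | rfl | rfl | rfl | rfl | rfl | rfl | rfl | rfl <;> simp
    · intro hneg
      have hin : Q' ++ [v] ∉ T := by
        intro hin
        simp only [hin, if_true] at hneg
        -- A lookup that is not positive would be the number of the root, but the root is the empty
        -- chain.
        have h0 : T.idxOf (Q' ++ [v]) = 0 := by
          simpa using hneg
        have hhead := hs.head
        rw [List.head?_eq_getElem?] at hhead
        have h1 := List.idxOf_lt_length_of_mem hin
        have h2 : T[T.idxOf (Q' ++ [v])]? = some (Q' ++ [v]) := by
          rw [List.getElem?_eq_getElem h1, List.getElem_idxOf]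
        rw [h0, hhead] at h2
        simp at h2
      refine Cmd.Ok.skip (hskip (fun hvc => hin (hmemtail.2 (hext.1 hvc).1)) _ ?_) (by norm_num)
      intro r hr
      simp only [List.mem_cons, List.not_mem_nil, or_false] at hr
      rcases hr with rfl | rfl | rfl | rfl | rfl | rfl | rfl | rfl | rfl | rfl <;> simp
  · intro s _ h'
    have : extensionsTake n out Q (out w).length = extensions n out Q := by
      rw [extensionsTake, extensions, ← hwdef, List.take_length]
    rwa [this] at h'
  · simp; omega

/-- The number of candidates that are looked at for the extension of the chains of length
`q + 1`. -/
noncomputable def candidateCount (n : ℕ) (out : ℕ → List ℕ) (q : ℕ) : ℕ :=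
  ((level n out q).map fun Q => (out (minVertex out Q)).length).sum

/-- The chains of one length have consecutive numbers. When level `q` is extended, it occupies the
numbers from `lo`, the number of shorter chains, up to `cnt`. -/
theorem createNodes_ok {n k : ℕ} {out : ℕ → List ℕ} (hout : IsTopoGraph n out) (hk : 1 ≤ k)
    (σ : St) (hn : σ .n 0 = n) (hkσ : σ .k 0 = k)
    (hg : IsGraph n (σ .hdeg) (σ .hnb) (σ .hadj) out) (hrow : IsRowTable n (n + 4) (σ .row))
    (h0 : ∀ r ∈ [Reg.last, .fst, .par, .suf, .mdv, .tgt, .rowt, .chd], ∀ a : ℤ, 0 ≤ a → σ r a = 0) :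
    createNodes.Ok σ (IsTrie n k out (nodes n out (k + 1)))
      (17 * n + 5 + ∑ q ∈ Finset.range k,
        (20 * candidateCount n out q + 4 * (level n out q).length + 5)) := by
  refine Cmd.Ok.seq (createRoot_ok (out := out) hk σ hn h0)
    (T' := 2 + ∑ q ∈ Finset.range k,
        (20 * candidateCount n out q + 4 * (level n out q).length + 5)) ?_ (by omega)
  intro s₁ hf₁ h₁
  refine Cmd.Ok.asg_seq 1 (by simp) ?_ (T := 1 + ∑ q ∈ Finset.range k,
        (20 * candidateCount n out q + 4 * (level n out q).length + 5)) (by omega)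
  refine Cmd.Ok.loop (N := k) (fun q s => IsTrie n k out (nodes n out (q + 1)) s ∧
      s .lo 0 = (nodes n out q).length)
    (fun q => 20 * candidateCount n out q + 4 * (level n out q).length + 4) (by decide) ?_ ?_ ?_ ?_
    ?_
  · simp [hf₁ .k (by decide), hkσ]
  · refine ⟨h₁.congr ?_, by simp [nodes]⟩
    intro r hr
    simp only [List.mem_cons, List.not_mem_nil, or_false] at hr
    rcases hr with rfl | rfl | rfl | rfl | rfl | rfl | rfl | rfl | rfl | rfl <;> simp
  · rintro q hq s hf hx ⟨h, hlo⟩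
    have hlen : ((nodes n out (q + 1)).length : ℤ) =
        (nodes n out q).length + (level n out q).length := by simp [nodes]
    have hcnt := h.cnt_eq
    have e1 : s .n 0 = n := by
      rw [hf .n (by decide), St.set_of_ne _ (by simp), hf₁ .n (by decide), hn]
    have e2 : s .k 0 = k := by
      rw [hf .k (by decide), St.set_of_ne _ (by simp), hf₁ .k (by decide), hkσ]
    have e3 : IsGraph n (s .hdeg) (s .hnb) (s .hadj) out := by
      rw [hf .hdeg (by decide), hf .hnb (by decide), hf .hadj (by decide),
        St.set_of_ne _ (by simp), St.set_of_ne _ (by simp), St.set_of_ne _ (by simp),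
        hf₁ .hdeg (by decide), hf₁ .hnb (by decide), hf₁ .hadj (by decide)]
      exact hg
    have e4 : IsRowTable n (n + 4) (s .row) := by
      rw [hf .row (by decide), St.set_of_ne _ (by simp), hf₁ .row (by decide)]
      exact hrow
    set N := (level n out q).length with hN
    refine Cmd.Ok.asg_seq N (by simp [hcnt, hlo, hlen]) ?_
      (T := 20 * candidateCount n out q + 4 * N + 3) le_rfl
    refine Cmd.Ok.asg_seq (nodes n out q).length (by simp [hlo]) ?_
      (T := 20 * candidateCount n out q + 4 * N + 2) le_rfl
    refine Cmd.Ok.asg_seq (nodes n out (q + 1)).length (by simp [hcnt]) ?_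
      (T := 20 * candidateCount n out q + 4 * N + 1) le_rfl
    refine Cmd.Ok.loop (N := N) (fun t s => IsTrie n k out (nodes n out (q + 1) ++
        ((level n out q).take t).flatMap (extensions n out)) s)
      (fun t => 20 * (out (minVertex out ((level n out q).getD t []))).length + 3) (by decide)
      ?_ ?_ ?_ ?_ ?_
    · simp
    · rw [List.take_zero, List.flatMap_nil, List.append_nil]
      refine h.congr ?_
      intro r hr
      simp only [List.mem_cons, List.not_mem_nil, or_false] at hr
      rcases hr with rfl | rfl | rfl | rfl | rfl | rfl | rfl | rfl | rfl | rfl <;> simp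
    · intro t ht s' hf' ht' h'
      set X := ((level n out q).take t).flatMap (extensions n out) with hXdef
      set Q := (level n out q)[t] with hQ
      have hQmem : Q ∈ level n out q := List.getElem_mem ht
      have hQlen := (mem_level.1 hQmem).1
      have hgetD : (level n out q).getD t [] = Q := List.getD_eq_getElem _ _ ht
      have hidlt : (nodes n out q).length + t < (nodes n out (q + 1) ++ X).length := by
        simp [nodes]; omega
      have hget : (nodes n out (q + 1) ++ X)[(nodes n out q).length + t] = Q := by
        rw [List.getElem_append_left (by simp [nodes]; omega)]
        simp [nodes, hQ]
      have hidx : (nodes n out (q + 1) ++ X).idxOf Q = (nodes n out q).length + t := by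
        rw [← hget, h'.nodup.idxOf_getElem]
      have hmdv := h'.mdv_eq _ hidlt
      rw [hget] at hmdv
      push_cast at hmdv
      rw [hgetD]
      have e5 : s' .bs 0 = (nodes n out q).length := by
        rw [hf' .bs (by decide)]; simp
      refine Cmd.Ok.asg_seq ((nodes n out q).length + t : ℤ) (by simp [e5, ht']) ?_
        (T := 20 * (out (minVertex out Q)).length + 2) le_rfl
      refine Cmd.Ok.asg_seq (minVertex out Q) (by simp [hmdv]) ?_
        (T := 20 * (out (minVertex out Q)).length + 1) le_rfl
      refine (createExtensions_ok (k := k) hout (X := X) hQmem ?_ _ ?_ ?_ ?_ ?_ ?_ ?_ ?_ ?_).mono ?_ le_rfl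
      · intro l hl
        obtain ⟨Q₂, hQ₂, hl⟩ := List.mem_flatMap.1 hl
        have hQ₂' := List.mem_of_mem_take hQ₂
        have hQ₂len := (mem_level.1 hQ₂').1
        obtain ⟨c, rfl, _⟩ := (mem_extensions (by rintro rfl; simp at hQ₂len)).1 hl
        refine ⟨by simp [hQ₂len], ?_⟩
        rw [List.dropLast_concat]
        rintro rfl
        obtain ⟨j, hj, hj'⟩ := List.mem_iff_getElem.1 hQ₂
        rw [List.getElem_take, hQ, (level_nodup hout q).getElem_inj_iff] at hj'
        simp at hj
        omega
      · simp [hf' .n (by decide), e1]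
      · simp [hf' .k (by decide), e2]
      · simp [hf' .x (by decide), hx]
      · simp
      · simp [hidx]
      · simpa [hf' .hdeg (by decide), hf' .hnb (by decide), hf' .hadj (by decide)] using e3
      · simpa [hf' .row (by decide)] using e4
      · refine h'.congr ?_
        intro r hr
        simp only [List.mem_cons, List.not_mem_nil, or_false] at hr
        rcases hr with rfl | rfl | rfl | rfl | rfl | rfl | rfl | rfl | rfl | rfl <;> simp
      · intro s'' _ h''
        have : ((level n out q).take (t + 1)).flatMap (extensions n out) =
            X ++ extensions n out Q := by
          rw [← List.take_append_getElem ht, List.flatMap_append]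
          simp [hQ, hXdef]
        rw [this]
        refine h''.congr ?_
        intro r hr
        simp only [List.mem_cons, List.not_mem_nil, or_false] at hr
        rcases hr with rfl | rfl | rfl | rfl | rfl | rfl | rfl | rfl | rfl | rfl <;> simp
    · intro s' hf' h'
      rw [List.take_length] at h'
      refine ⟨?_, by simp [hf' .lo (by decide)]⟩
      rw [nodes, level]
      refine h'.congr ?_
      intro r hr
      simp only [List.mem_cons, List.not_mem_nil, or_false] at hr
      rcases hr with rfl | rfl | rfl | rfl | rfl | rfl | rfl | rfl | rfl | rfl <;> simp
    · have : ∑ t ∈ Finset.range N, (out (minVertex out ((level n out q).getD t []))).length =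
          candidateCount n out q := by
        rw [candidateCount, ← List.sum_map_range_eq]
        congr 1
        refine List.ext_getElem (by simp [hN]) ?_
        intro i h1 h2
        have : i < (level n out q).length := by simpa using h2
        simp [this]
      simp only [Finset.sum_add_distrib, ← Finset.mul_sum, this]
      simp
      omega
  · rintro s _ ⟨h, _⟩
    exact h
  · rw [add_comm]

/-! ### The longest chain -/

/-- The last `k` elements of a list. -/
def lastPart (k : ℕ) (l : List ℕ) : List ℕ := l.drop (l.length - k)

/-- The automaton remembers the last `k` vertices: a transition appends a vertex to the window and
drops the oldest one only if the window was full. -/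
theorem target_lastPart {k : ℕ} (hk : 1 ≤ k) (w : List ℕ) (c : ℕ) :
    target k (lastPart k w ++ [c]) = lastPart k (w ++ [c]) := by
  rcases Nat.lt_or_ge w.length k with h | h
  · have h1 : lastPart k w = w := by rw [lastPart, Nat.sub_eq_zero_of_le h.le, List.drop_zero]
    rw [h1, target, if_pos (by simpa using h), lastPart, Nat.sub_eq_zero_of_le (by simpa using h),
      List.drop_zero]
  · have h1 : (lastPart k w).length = k := by rw [lastPart, List.length_drop]; omega
    have h2 : lastPart k w ≠ [] := by
      intro h3
      rw [h3] at h1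
      simp at h1
      omega
    rw [target, if_neg (by simp [h1]), List.tail_append_of_ne_nil h2, lastPart, lastPart,
      List.tail_drop, List.length_append, List.length_singleton,
      List.drop_append_of_le_length (by omega)]
    congr 2
    omega

theorem nodes_pairwise {n : ℕ} {out : ℕ → List ℕ} (q : ℕ) :
    (nodes n out q).Pairwise fun a b =>
      a.length < b.length ∨ (a.length = b.length ∧ a.headD 0 ≤ b.headD 0) := by
  induction q with
  | zero => simp [nodes]
  | succ q ih =>
    rw [nodes, List.pairwise_append]
    refine ⟨ih, ?_, ?_⟩
    · refine List.Pairwise.imp_of_mem ?_ (level_pairwise_headD q)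
      intro a b ha hb hab
      exact Or.inr ⟨by rw [(mem_level.1 ha).1, (mem_level.1 hb).1], hab⟩
    · intro a ha b hb
      have h1 := (mem_nodes.1 ha).1
      have h2 := (mem_level.1 hb).1
      exact Or.inl (by omega)

/-- A node whose state after reading is the state before reading of another node comes before
that node. -/
theorem lt_of_target_eq_dropLast {n k : ℕ} {out : ℕ → List ℕ} (hout : IsTopoGraph n out)
    (hk : 1 ≤ k) {i j : ℕ} (hi : i < (nodes n out (k + 1)).length)
    (hj : j < (nodes n out (k + 1)).length) (hj0 : (nodes n out (k + 1))[j] ≠ [])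
    (h : target k (nodes n out (k + 1))[i] = ((nodes n out (k + 1))[j]).dropLast) : i < j := by
  have hpw := nodes_pairwise (n := n) (out := out) (k + 1)
  have hli := mem_nodes.1 (List.getElem_mem hi)
  generalize nodes n out (k + 1) = T at *
  -- If `T[i]` has at most `k` vertices it is the parent of `T[j]`, hence shorter. Otherwise both
  -- have `k + 1` vertices, and the first vertex of `T[j]` is the second one of `T[i]`, which is
  -- larger because edges go upwards.
  have key : T[i].length < T[j].length ∨
      (T[i].length = T[j].length ∧ T[i].headD 0 < T[j].headD 0) := by
    have hpos := List.length_pos_iff.2 hj0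
    by_cases hlen : T[i].length ≤ k
    · rw [target, if_pos hlen] at h
      left
      rw [h, List.length_dropLast]
      omega
    · rw [target, if_neg hlen] at h
      have hleni : T[i].length = k + 1 := le_antisymm hli.1 (by omega)
      have hlen2 := congrArg List.length h
      rw [List.length_tail, List.length_dropLast] at hlen2
      right
      refine ⟨by omega, ?_⟩
      obtain ⟨a, b, l, habl⟩ : ∃ a b l, T[i] = a :: b :: l := by
        match hTi : T[i], hleni with
        | [], h => simp at h
        | [a], h => simp at h; omega
        | a :: b :: l, _ => exact ⟨a, b, l, rfl⟩
      have hab : a < b := by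
        have := hli.2.pairwise
        rw [habl] at this
        exact hout.lt a b ((List.pairwise_cons.1 this).1 b (by simp))
      have hjb : T[j].headD 0 = b := by
        rw [habl, List.tail_cons] at h
        rw [← List.dropLast_append_getLast hj0, ← h]
        rfl
      rw [hjb, habl]
      simpa using hab
  by_contra hij
  rcases Nat.lt_or_ge j i with hlt | hge
  · have := List.pairwise_iff_getElem.1 hpw j i hj hi hlt
    omega
  · have : i = j := by omega
    subst this
    omega

/-- `b` is the table of the lengths of the longest continuations and `f` is the table of the
choices that attain them, as far as the nodes from `lo` on are concerned. -/
structure IsBest (N : ℕ) (π τ : ℕ → ℕ) (lo : ℕ) (b f : ℕ → ℕ) : Prop where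
  le : ∀ i, lo ≤ i → i < N → 0 < i → b (τ i) + 1 ≤ b (π i)
  eq : ∀ p, 0 < b p → lo ≤ f p ∧ f p < N ∧ 0 < f p ∧ π (f p) = p ∧ b p = b (τ (f p)) + 1

section Programs

open Reg Cmd

/-- Find the longest continuations. -/
def findBest : Cmd :=
  loop t lim1 (cnt - 1) (
    asg id (cnt - 1 - t) ;; asg s (tgt # id) ;; asg p (par # id) ;;
    ite (best # s + 1 - best # p) (wr best p (best # s + 1) ;; wr chc p id) skip)

/-- Follow the choices. -/
def followBest : Cmd :=
  asg cur 0 ;; wr out 0 (best # 0) ;;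
  loop t lim1 (best # 0) (
    asg id (chc # cur) ;; wr out (t + 1) (ord # (last # id)) ;; asg cur (tgt # id))

end Programs

/-- Each node `i` is a transition from the state `π i` to the state `τ i`. Nodes are handled in
decreasing order; by `hord` all transitions out of `τ i` have larger numbers than `i`, so the value
at `τ i` is final when it is read. -/
theorem findBest_ok {N : ℕ} (hN : 0 < N) {π τ : ℕ → ℕ}
    (hord : ∀ i j, 0 < i → i < N → 0 < j → j < N → τ i = π j → i < j)
    (σ : St) (hcnt : σ .cnt 0 = N) (hpar : ∀ i : ℕ, i < N → σ .par i = π i)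
    (htgt : ∀ i : ℕ, i < N → σ .tgt i = τ i) (h0 : ∀ a : ℤ, 0 ≤ a → σ .best a = 0) :
    findBest.Ok σ (fun s => ∃ b f : ℕ → ℕ, IsBest N π τ 0 b f ∧
      ∀ p : ℕ, s .best p = b p ∧ (0 < b p → s .chc p = f p)) (7 * N) := by
  refine Cmd.Ok.loop (N := N - 1) (fun t s => ∃ b f : ℕ → ℕ, IsBest N π τ (N - t) b f ∧
      ∀ p : ℕ, s .best p = b p ∧ (0 < b p → s .chc p = f p)) (fun _ => 6) (by decide) ?_ ?_ ?_ ?_ ?_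
  · simp [hcnt]
    omega
  · refine ⟨fun _ => 0, fun _ => 0, ⟨fun i h1 h2 => by omega, by simp⟩, ?_⟩
    intro p
    simp [h0 p (by positivity)]
  · rintro t ht s hf hx ⟨b, f, ⟨h1, h2⟩, h3⟩
    obtain ⟨i, hi⟩ : ∃ i, i + 1 + t = N := ⟨N - 1 - t, by omega⟩
    have hi0 : 0 < i := by omega
    have hiN : i < N := by omega
    have e1 : s .cnt 0 = N := by rw [hf .cnt (by decide), hcnt]
    have e2 : s .tgt i = τ i := by rw [hf .tgt (by decide), htgt i hiN]
    have e3 : s .par i = π i := by rw [hf .par (by decide), hpar i hiN]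
    have hne : τ i ≠ π i := fun h => lt_irrefl i (hord i i hi0 hiN hi0 hiN h)
    refine Cmd.Ok.asg_seq i (by simp [e1, hx]; omega) ?_ (T := 5) le_rfl
    refine Cmd.Ok.asg_seq (τ i) (by simp [e2]) ?_ (T := 4) le_rfl
    refine Cmd.Ok.asg_seq (π i) (by simp [e3]) ?_ (T := 3) le_rfl
    refine Cmd.Ok.ite (T := 2) ?_ ?_ le_rfl
    · intro hpos
      simp [(h3 _).1] at hpos
      refine Cmd.ok_of_exec ⟨Function.update b (π i) (b (τ i) + 1), Function.update f (π i) i,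
        ⟨?_, ?_⟩, ?_⟩ (by simp [Cmd.cost])
      · intro j hj1 hj2 hj3
        by_cases hji : j = i
        · subst hji
          simp [hne]
        · have hij : i < j := by omega
          have hτ : τ j ≠ π i := fun h => by have := hord j i hj3 hj2 hi0 hiN h; omega
          rw [Function.update_of_ne hτ]
          refine (h1 j (by omega) hj2 hj3).trans ?_
          by_cases hπ : π j = π i
          · rw [hπ, Function.update_self]
            omega
          · rw [Function.update_of_ne hπ]
      · intro p hp
        by_cases hpi : p = π i
        · subst hpi
          simp only [Function.update_self, true_and, hiN, hi0]
          rw [Function.update_of_ne hne]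
          exact ⟨by omega, rfl⟩
        · rw [Function.update_of_ne hpi] at hp ⊢
          obtain ⟨h4, h5, h6, h7, h8⟩ := h2 p hp
          rw [Function.update_of_ne hpi]
          have hτ : τ (f p) ≠ π i := fun h => by have := hord (f p) i h6 h5 hi0 hiN h; omega
          rw [Function.update_of_ne hτ]
          exact ⟨by omega, h5, h6, h7, h8⟩
      · intro p
        have hb := h3 (τ i)
        by_cases hpi : p = π i
        · subst hpi
          simp [Cmd.exec, hb.1]
        · have hpi' : (p : ℤ) ≠ (π i : ℕ) := by exact_mod_cast hpi
          simpa [Cmd.exec, hpi', hpi] using h3 p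
    · intro hneg
      simp [(h3 _).1] at hneg
      refine Cmd.ok_of_exec ⟨b, f, ⟨?_, ?_⟩, by simpa [Cmd.exec] using h3⟩ (by simp [Cmd.cost])
      · intro j hj1 hj2 hj3
        by_cases hji : j = i
        · subst hji
          omega
        · exact h1 j (by omega) hj2 hj3
      · intro p hp
        obtain ⟨h4, h5⟩ := h2 p hp
        exact ⟨by omega, h5⟩
  · rintro s _ ⟨b, f, ⟨h1, h2⟩, h3⟩
    refine ⟨b, f, ⟨fun i _ hi hi0 => h1 i (by omega) hi hi0, fun p hp => ?_⟩, h3⟩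
    exact ⟨Nat.zero_le _, (h2 p hp).2⟩
  · simp; omega

/-- The windows of length `k + 1` decide whether a list is a chain. -/
def HasWindows (n k : ℕ) (out : ℕ → List ℕ) : Prop :=
  ∀ (w : List ℕ) (c : ℕ), IsOutChain n out w → IsOutChain n out (lastPart k w ++ [c]) →
    IsOutChain n out (w ++ [c])

theorem length_lastPart_le (k : ℕ) (w : List ℕ) : (lastPart k w).length ≤ k := by
  rw [lastPart, List.length_drop]
  omega

theorem lastPart_suffix (k : ℕ) (w : List ℕ) : lastPart k w <:+ w := List.drop_suffix _ _

/-- Reading `w` is a walk from the empty state. After `j` vertices the state is the window of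
`w.take j`, and by induction on the number `r` of remaining vertices its value is at least `r`. -/
theorem length_le_best {n k : ℕ} {out : ℕ → List ℕ} (hk : 1 ≤ k)
    {T : List (List ℕ)} (hT : T = nodes n out (k + 1)) {b f : ℕ → ℕ}
    (hb : IsBest T.length (fun i => T.idxOf (T.getD i []).dropLast)
      (fun i => T.idxOf (target k (T.getD i []))) 0 b f) {w : List ℕ} (hw : IsOutChain n out w) :
    w.length ≤ b 0 := by
  have key : ∀ (r j : ℕ), j + r = w.length → r ≤ b (T.idxOf (lastPart k (w.take j))) := by
    intro r
    induction r with
    | zero => intro j _; exact Nat.zero_le _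
    | succ r ih =>
      intro j hj
      have hjw : j < w.length := by omega
      have htake : w.take (j + 1) = w.take j ++ [w[j]] := by simp
      set l := lastPart k (w.take j) ++ [w[j]] with hl
      have hlc : IsOutChain n out l := by
        refine hw.sublist ?_
        refine List.Sublist.trans ?_ (List.take_sublist (j + 1) w)
        rw [htake]
        exact (lastPart_suffix k _).sublist.append (List.Sublist.refl _)
      have hlT : l ∈ T := by
        rw [hT, mem_nodes]
        refine ⟨?_, hlc⟩
        have := length_lastPart_le k (w.take j)
        simp [hl, this]
      have hlt := List.idxOf_lt_length_of_mem hlT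
      have hget : T.getD (T.idxOf l) [] = l := by
        rw [List.getD_eq_getElem _ _ hlt, List.getElem_idxOf]
      have h0 : 0 < T.idxOf l := by
        by_contra h0
        have h1 : T.idxOf l = 0 := by omega
        rw [h1] at hget
        have h2 : T.getD 0 [] = [] := by
          rw [hT]
          have : (nodes n out (k + 1)).head? = some [] := by
            generalize k + 1 = q
            induction q with
            | zero => rfl
            | succ q ih => rw [nodes, List.head?_append, ih]; rfl
          rw [List.getD_eq_getElem?_getD, ← List.head?_eq_getElem?, this]
          rfl
        rw [h2] at hget
        simp [hl] at hget
      have h1 := hb.le _ (Nat.zero_le _) hlt h0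
      simp only [hget] at h1
      rw [hl, List.dropLast_concat, target_lastPart hk, ← htake] at h1
      have h2 := ih (j + 1) (by omega)
      omega
  have := key w.length 0 (by omega)
  have h1 : lastPart k (w.take 0) = [] := by simp [lastPart]
  rw [h1] at this
  have h2 : T.idxOf [] = 0 := by
    rw [hT]
    have : ∀ q, ∃ T', nodes n out q = [] :: T' := by
      intro q
      induction q with
      | zero => exact ⟨[], rfl⟩
      | succ q ih =>
        obtain ⟨T', hT'⟩ := ih
        exact ⟨T' ++ level n out q, by rw [nodes, hT']; rfl⟩
    obtain ⟨T', hT'⟩ := this (k + 1)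
    rw [hT', List.idxOf_cons_self]
  rwa [h2] at this

/-- Following the choices gives a longest chain. -/
theorem followBest_ok {n k : ℕ} {out : ℕ → List ℕ} (hk : 1 ≤ k) (hwin : HasWindows n k out)
    {b f : ℕ → ℕ} {qs : List ℕ} (hqs : qs.length = n) (σ : St)
    (hT : IsTrie n k out (nodes n out (k + 1)) σ)
    (hb : IsBest (nodes n out (k + 1)).length
      (fun i => (nodes n out (k + 1)).idxOf ((nodes n out (k + 1)).getD i []).dropLast)
      (fun i => (nodes n out (k + 1)).idxOf (target k ((nodes n out (k + 1)).getD i []))) 0 b f)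
    (hbf : ∀ p : ℕ, σ .best p = b p ∧ (0 < b p → σ .chc p = f p))
    (hord : ∀ (j : ℕ) (h : j < qs.length), σ .ord j = qs[j]) :
    followBest.Ok σ (fun s => ∃ w : List ℕ, IsOutChain n out w ∧
      (∀ w', IsOutChain n out w' → w'.length ≤ w.length) ∧ w.length = b 0 ∧
      s .out 0 = w.length ∧ ∀ (j : ℕ) (h : j < w.length), s .out (j + 1) = qs.getD w[j] 0)
      (4 * b 0 + 3) := by
  obtain ⟨T, hTdef⟩ : ∃ T, T = nodes n out (k + 1) := ⟨_, rfl⟩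
  rw [← hTdef] at hT hb
  have hnil : T.idxOf [] = 0 := by
    obtain ⟨T', hT'⟩ : ∃ T', T = [] :: T' := by
      have := hT.head
      cases T with
      | nil => simp at this
      | cons a T' => exact ⟨T', by simp at this; rw [this]⟩
    rw [hT', List.idxOf_cons_self]
  refine Cmd.Ok.asg_seq 0 (by simp) ?_ (T := 4 * b 0 + 2) le_rfl
  refine Cmd.Ok.wr_seq 0 (b 0) (by simp) (by simpa using (hbf 0).1) ?_ (T := 4 * b 0 + 1) le_rfl
  -- The value of the current state and the number of vertices written add up to `b 0`, so a choice
  -- is recorded in every round. The choice extends the window, and by `hwin` it extends the whole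
  -- chain.
  refine Cmd.Ok.loop (N := b 0) (fun t s => ∃ w : List ℕ, w.length = t ∧ IsOutChain n out w ∧
    s .cur 0 = T.idxOf (lastPart k w) ∧ b (T.idxOf (lastPart k w)) + t = b 0 ∧
    s .out 0 = b 0 ∧ ∀ (j : ℕ) (h : j < w.length), s .out (j + 1) = qs.getD w[j] 0)
    (fun _ => 3) (by decide) ?_ ?_ ?_ ?_ ?_
  · simpa using (hbf 0).1
  · refine ⟨[], rfl, isOutChain_nil, ?_, ?_, by simp, by simp⟩
    · simp [lastPart, hnil]
    · simp [lastPart, hnil]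
  · rintro t ht s hf hx ⟨w, hwt, hw, hcur, hbt, hout0, hout⟩
    set p := T.idxOf (lastPart k w) with hp
    have hbp : 0 < b p := by omega
    obtain ⟨-, h1, h2, h3, h4⟩ := hb.eq p hbp
    have e1 : s .chc p = f p := by
      rw [hf .chc (by decide)]; simpa using (hbf p).2 hbp
    have e2 : s .tgt (f p) = (T.idxOf (target k T[f p]) : ℕ) := by
      rw [hf .tgt (by decide)]; simpa using hT.tgt_eq _ h1
    have e3 : s .last (f p) = (T[f p].getLastD 0 : ℕ) := by
      rw [hf .last (by decide)]; simpa using hT.last_eq _ h1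
    have e4 : s .ord = σ .ord := by rw [hf .ord (by decide)]; simp
    have hlp : lastPart k w ∈ T := by
      rw [hTdef, mem_nodes]
      exact ⟨(length_lastPart_le k w).trans (Nat.le_succ k), hw.sublist (lastPart_suffix k w).sublist⟩
    have hgetD : T.getD (f p) [] = T[f p] := List.getD_eq_getElem _ _ h1
    simp only [hgetD] at h3 h4
    have hdl : T[f p].dropLast = lastPart k w :=
      (List.idxOf_inj (hT.dropLast_mem _ (List.getElem_mem h1))).1 (h3.trans hp)
    have hne : T[f p] ≠ [] := by
      intro hnil'
      have := hT.nodup.idxOf_getElem (f p) h1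
      rw [hnil', hnil] at this
      omega
    set c := T[f p].getLast hne with hc
    have hsplit : T[f p] = lastPart k w ++ [c] := by
      rw [← hdl, hc, List.dropLast_append_getLast]
    have hmem : T[f p] ∈ nodes n out (k + 1) := by
      rw [← hTdef]; exact List.getElem_mem h1
    have hchain : IsOutChain n out (lastPart k w ++ [c]) := by
      rw [← hsplit]; exact (mem_nodes.1 hmem).2
    have hcn : c < qs.length := by
      rw [hqs]; exact hchain.bound c (by simp)
    have e5 : σ .ord c = qs.getD c 0 := by
      rw [List.getD_eq_getElem _ _ hcn]; exact hord c hcn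
    have e6 : T[f p].getLastD 0 = c := by rw [hsplit]; simp
    rw [hsplit, target_lastPart hk] at e2 h4
    rw [e6] at e3
    refine Cmd.ok_of_exec ⟨w ++ [c], by simp [hwt], hwin w c hw hchain, ?_, ?_, ?_, ?_⟩
      (by simp [Cmd.cost, Cmd.asg])
    · simp [Cmd.exec, Cmd.asg, hcur, e1, e2]
    · omega
    · have : (0 : ℤ) ≠ (t : ℤ) + 1 := by omega
      simp [Cmd.exec, Cmd.asg, hx, hout0, this]
    · intro j hj
      simp only [List.length_append, List.length_singleton] at hj
      simp only [Cmd.exec, Cmd.asg, Ex.eval_arr, Ex.eval_lit, Ex.eval_add, Ex.eval_one, ne_eq,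
        reduceCtorEq, not_false_eq_true, St.set_of_ne, St.set_self, hx, hcur, e1, e3, e4, e5,
        Function.update_self, Ex.eval_zero]
      by_cases hjt : j = t
      · subst hjt
        subst hwt
        simp
      · rw [Function.update_of_ne (by omega), List.getElem_append_left (by omega), hout j (by omega)]
  · rintro s _ ⟨w, h1, h2, _, _, h5, h6⟩
    refine ⟨w, h2, fun w' hw' => ?_, h1, by rw [h5, h1], h6⟩
    rw [h1]
    exact length_le_best hk hTdef hb hw'
  · simp; omega

/-! ### Counting chains -/

theorem candidateCount_eq_sum {n : ℕ} {out : ℕ → List ℕ} (h : IsTopoGraph n out) (q : ℕ) :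
    candidateCount n out q =
      ∑ l ∈ (level n out q).toFinset, (out (minVertex out l)).length := by
  rw [candidateCount, List.sum_toFinset _ (level_nodup h q)]

theorem sum_length_range {n : ℕ} (out : ℕ → List ℕ) :
    ((List.range n).map fun p => (out p).length).sum = ∑ p ∈ Finset.range n, (out p).length := by
  rw [← List.toFinset_range, List.sum_toFinset _ List.nodup_range]

theorem length_level_succ_le {n : ℕ} {out : ℕ → List ℕ} (q : ℕ) :
    (level n out (q + 1)).length ≤ candidateCount n out q := by
  rw [level, List.length_flatMap, candidateCount]
  refine List.sum_le_sum fun l _ => ?_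
  rw [extensions, List.length_map]
  exact List.length_filter_le _ _

theorem candidateCount_zero (n : ℕ) (out : ℕ → List ℕ) :
    candidateCount n out 0 = ∑ p ∈ Finset.range n, (out p).length := by
  rw [← sum_length_range, candidateCount, level, List.map_map]
  rfl

/-- The pairs of adjacent vertices. -/
def adjacentPairs (n : ℕ) (out : ℕ → List ℕ) : Finset (ℕ × ℕ) :=
  (Finset.range n ×ˢ Finset.range n).filter fun e => e.2 ∈ out e.1

theorem card_adjacentPairs_le (n : ℕ) (out : ℕ → List ℕ) :
    (adjacentPairs n out).card ≤ ∑ p ∈ Finset.range n, (out p).length := by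
  have h : adjacentPairs n out ⊆
      (Finset.range n).biUnion fun p => (out p).toFinset.image fun q => (p, q) := by
    rintro ⟨p, q⟩ he
    simp only [adjacentPairs, Finset.mem_filter, Finset.mem_product, Finset.mem_range] at he
    simp [he.1.1, he.2]
  refine (Finset.card_le_card h).trans (Finset.card_biUnion_le.trans ?_)
  exact Finset.sum_le_sum fun p _ => Finset.card_image_le.trans (List.toFinset_card_le _)

theorem IsOutChain.mem_adjacentPairs {n : ℕ} {out : ℕ → List ℕ} {a b : ℕ} {l : List ℕ}
    (h : IsOutChain n out (a :: b :: l)) : (a, b) ∈ adjacentPairs n out := by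
  simp only [adjacentPairs, Finset.mem_filter, Finset.mem_product, Finset.mem_range]
  exact ⟨⟨h.bound a (by simp), h.bound b (by simp)⟩,
    (List.pairwise_cons.1 h.pairwise).1 b (by simp)⟩

/-- Split off the first two vertices. They form one of at most `m` edges, and the rest is a chain
whose least out-degree is no smaller than that of the whole, a minimum over more vertices. -/
theorem candidateCount_add_two_le {n : ℕ} {out : ℕ → List ℕ} (h : IsTopoGraph n out) (q : ℕ) :
    candidateCount n out (q + 2) ≤
      (∑ p ∈ Finset.range n, (out p).length) * candidateCount n out q := by
  rw [candidateCount_eq_sum h, candidateCount_eq_sum h]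
  have key : ∀ l ∈ (level n out (q + 2)).toFinset, ∃ a b l', l = a :: b :: l' ∧
      (a, b) ∈ adjacentPairs n out ∧ l' ∈ (level n out q).toFinset ∧
      (out (minVertex out l)).length ≤ (out (minVertex out l')).length := by
    intro l hl
    obtain ⟨h1, h2⟩ := mem_level.1 (List.mem_toFinset.1 hl)
    match l, h1, h2 with
    | a :: b :: l', h1, h2 =>
      have h3 : l'.length = q + 1 := by simpa using h1
      have h4 : l' ≠ [] := by rintro rfl; simp at h3
      refine ⟨a, b, l', rfl, h2.mem_adjacentPairs, ?_, ?_⟩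
      · rw [List.mem_toFinset, mem_level]
        exact ⟨h3, h2.sublist (by simp)⟩
      · refine length_out_minVertex_le out ?_
        simp [minVertex_mem out h4]
  calc ∑ l ∈ (level n out (q + 2)).toFinset, (out (minVertex out l)).length
      ≤ ∑ l ∈ (level n out (q + 2)).toFinset,
          (fun e : (ℕ × ℕ) × List ℕ => (out (minVertex out e.2)).length)
            ((l.getD 0 0, l.getD 1 0), l.drop 2) := by
        refine Finset.sum_le_sum fun l hl => ?_
        obtain ⟨a, b, l', rfl, -, -, h1⟩ := key l hl
        simpa using h1
    _ = ∑ e ∈ (level n out (q + 2)).toFinset.image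
          (fun l => ((l.getD 0 0, l.getD 1 0), l.drop 2)),
          (out (minVertex out e.2)).length := by
        rw [Finset.sum_image]
        intro l hl l' hl' hll
        obtain ⟨a, b, t, rfl, -⟩ := key l hl
        obtain ⟨a', b', t', rfl, -⟩ := key l' hl'
        simpa [and_assoc] using hll
    _ ≤ ∑ e ∈ adjacentPairs n out ×ˢ (level n out q).toFinset,
          (out (minVertex out e.2)).length := by
        refine Finset.sum_le_sum_of_subset fun e he => ?_
        obtain ⟨l, hl, rfl⟩ := Finset.mem_image.1 he
        obtain ⟨a, b, t, rfl, h1, h2, -⟩ := key l hl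
        simpa using And.intro h1 (by simpa using h2)
    _ = (adjacentPairs n out).card *
          ∑ l ∈ (level n out q).toFinset, (out (minVertex out l)).length := by
        rw [Finset.sum_product]
        simp
    _ ≤ _ := Nat.mul_le_mul_right _ (card_adjacentPairs_le n out)

/-- Cauchy–Schwarz over the edges `(a, b)`: there are at most `m` of them, the squared minimum of
the two degrees is at most their product, and the products over all pairs sum to `m ^ 2`. -/
theorem candidateCount_one_sq_le {n : ℕ} {out : ℕ → List ℕ} (h : IsTopoGraph n out) :
    candidateCount n out 1 ^ 2 ≤ (∑ p ∈ Finset.range n, (out p).length) ^ 3 := by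
  rw [candidateCount_eq_sum h]
  have key : ∀ l ∈ (level n out 1).toFinset, ∃ a b, l = [a, b] ∧ a < n ∧ b < n ∧
      (out (minVertex out l)).length ^ 2 ≤ (out a).length * (out b).length := by
    intro l hl
    obtain ⟨h1, h2⟩ := mem_level.1 (List.mem_toFinset.1 hl)
    match l, h1, h2 with
    | [a, b], h1, h2 =>
      refine ⟨a, b, rfl, h2.bound a (by simp), h2.bound b (by simp), ?_⟩
      rw [sq]
      exact Nat.mul_le_mul (length_out_minVertex_le out (by simp))
        (length_out_minVertex_le out (by simp))
  have hcard : (level n out 1).toFinset.card ≤ ∑ p ∈ Finset.range n, (out p).length := by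
    rw [← candidateCount_zero]
    exact (List.toFinset_card_le _).trans (length_level_succ_le 0)
  have hsum : ∑ l ∈ (level n out 1).toFinset, (out (minVertex out l)).length ^ 2 ≤
      (∑ p ∈ Finset.range n, (out p).length) * ∑ p ∈ Finset.range n, (out p).length := by
    rw [Finset.sum_mul_sum, ← Finset.sum_product']
    calc ∑ l ∈ (level n out 1).toFinset, (out (minVertex out l)).length ^ 2
        ≤ ∑ l ∈ (level n out 1).toFinset,
          (fun e : ℕ × ℕ => (out e.1).length * (out e.2).length) (l.getD 0 0, l.getD 1 0) := by
          refine Finset.sum_le_sum fun l hl => ?_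
          obtain ⟨a, b, rfl, -, -, h1⟩ := key l hl
          simpa using h1
      _ = ∑ e ∈ (level n out 1).toFinset.image (fun l => (l.getD 0 0, l.getD 1 0)),
          (out e.1).length * (out e.2).length := by
          rw [Finset.sum_image]
          intro l hl l' hl' hll
          obtain ⟨a, b, rfl, -⟩ := key l hl
          obtain ⟨a', b', rfl, -⟩ := key l' hl'
          simpa using hll
      _ ≤ _ := by
          refine Finset.sum_le_sum_of_subset fun e he => ?_
          obtain ⟨l, hl, rfl⟩ := Finset.mem_image.1 he
          obtain ⟨a, b, rfl, h1, h2, -⟩ := key l hl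
          simp [h1, h2]
  calc _ ≤ (level n out 1).toFinset.card *
        ∑ l ∈ (level n out 1).toFinset, (out (minVertex out l)).length ^ 2 :=
        sq_sum_le_card_mul_sum_sq
    _ ≤ _ := Nat.mul_le_mul hcard hsum
    _ = _ := by ring

/-- The number of steps at which a chain with `q + 1` vertices is extended is at most
`m ^ ((q + 2) / 2)`. -/
theorem candidateCount_sq_le {n : ℕ} {out : ℕ → List ℕ} (h : IsTopoGraph n out) (q : ℕ) :
    candidateCount n out q ^ 2 ≤ (∑ p ∈ Finset.range n, (out p).length) ^ (q + 2) := by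
  induction q using Nat.twoStepInduction with
  | zero => rw [candidateCount_zero]
  | one => exact candidateCount_one_sq_le h
  | more q ih _ =>
    calc _ ≤ ((∑ p ∈ Finset.range n, (out p).length) * candidateCount n out q) ^ 2 :=
          Nat.pow_le_pow_left (candidateCount_add_two_le h q) 2
      _ = (∑ p ∈ Finset.range n, (out p).length) ^ 2 * candidateCount n out q ^ 2 := by ring
      _ ≤ _ := Nat.mul_le_mul_left _ ih
      _ = _ := by ring

/-- Here and below `B` is an integer that stands for `m ^ ((k + 1) / 2)`. Only chains of `q + 1 ≤ k`
vertices are extended, so the exponent `q + 2` does not exceed `k + 1`. -/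
theorem candidateCount_le {n m k B q : ℕ} {out : ℕ → List ℕ} (h : IsTopoGraph n out) (hm : 1 ≤ m)
    (hout : ∑ p ∈ Finset.range n, (out p).length ≤ m) (hB : m ^ (k + 1) ≤ B ^ 2) (hq : q < k) :
    candidateCount n out q ≤ B := by
  refine (Nat.pow_le_pow_iff_left two_ne_zero).1 ?_
  calc _ ≤ _ := candidateCount_sq_le h q
    _ ≤ m ^ (q + 2) := Nat.pow_le_pow_left hout _
    _ ≤ m ^ (k + 1) := Nat.pow_le_pow_right hm (by omega)
    _ ≤ _ := hB

theorem length_nodes (n : ℕ) (out : ℕ → List ℕ) (q : ℕ) :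
    (nodes n out q).length = 1 + ∑ x ∈ Finset.range q, (level n out x).length := by
  induction q with
  | zero => simp [nodes]
  | succ q ih => rw [nodes, List.length_append, ih, Finset.sum_range_succ, add_assoc]

/-- A level is no larger than the number of candidates for it, which is at most `B`. The factor `2`
is for the single vertices, of which there are `n ≤ 2 m ≤ 2 B`. -/
theorem length_level_le {n m k B q : ℕ} {out : ℕ → List ℕ} (h : IsTopoGraph n out) (hm : 1 ≤ m)
    (hn : n ≤ 2 * m) (hk : 1 ≤ k)
    (hout : ∑ p ∈ Finset.range n, (out p).length ≤ m) (hB : m ^ (k + 1) ≤ B ^ 2) (hq : q ≤ k) :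
    (level n out q).length ≤ 2 * B := by
  cases q with
  | zero =>
    have : m ≤ B := (Nat.pow_le_pow_iff_left two_ne_zero).1
      ((Nat.pow_le_pow_right hm (by omega)).trans hB)
    simp only [level, List.length_map, List.length_range]
    omega
  | succ q =>
    have h1 := length_level_succ_le (n := n) (out := out) q
    have h2 := candidateCount_le h hm hout hB (q := q) (by omega)
    omega

theorem length_nodes_le {n m k B : ℕ} {out : ℕ → List ℕ} (h : IsTopoGraph n out) (hm : 1 ≤ m)
    (hn : n ≤ 2 * m) (hk : 1 ≤ k)
    (hout : ∑ p ∈ Finset.range n, (out p).length ≤ m) (hB : m ^ (k + 1) ≤ B ^ 2) :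
    (nodes n out (k + 1)).length ≤ 1 + (k + 1) * (2 * B) := by
  rw [length_nodes]
  have := Finset.sum_le_card_nsmul (Finset.range (k + 1)) (fun x => (level n out x).length)
    (2 * B) fun x hx => length_level_le h hm hn hk hout hB (by simpa [Nat.lt_succ_iff] using hx)
  simpa using this

theorem sum_candidateCount_le {n m k B : ℕ} {out : ℕ → List ℕ} (h : IsTopoGraph n out)
    (hm : 1 ≤ m) (hn : n ≤ 2 * m) (hk : 1 ≤ k)
    (hout : ∑ p ∈ Finset.range n, (out p).length ≤ m) (hB : m ^ (k + 1) ≤ B ^ 2) :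
    ∑ q ∈ Finset.range k,
      (20 * candidateCount n out q + 4 * (level n out q).length + 5) ≤ k * (28 * B + 5) := by
  have := Finset.sum_le_card_nsmul (Finset.range k)
    (fun q => 20 * candidateCount n out q + 4 * (level n out q).length + 5) (28 * B + 5)
    fun q hq => by
      have hq := Finset.mem_range.1 hq
      have h1 := candidateCount_le h hm hout hB hq
      have h2 := length_level_le h hm hn hk hout hB hq.le
      omega
  simpa using this

/-! ### The clique stage -/

section Programs

open Reg Cmd

/-- Find a maximum clique of the graph of the edges with utility difference at least `d`. -/
def findClique : Cmd := filterEdges ;; createNodes ;; findBest ;; followBest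

end Programs

theorem IsOutChain.pairwise_lt {n : ℕ} {out : ℕ → List ℕ} (hout : IsTopoGraph n out) {w : List ℕ}
    (h : IsOutChain n out w) : w.Pairwise (· < ·) :=
  h.pairwise.imp fun {p q} hq => hout.lt p q hq

theorem IsOutChain.nodup {n : ℕ} {out : ℕ → List ℕ} (hout : IsTopoGraph n out) {w : List ℕ}
    (h : IsOutChain n out w) : w.Nodup := (h.pairwise_lt hout).imp fun h => h.ne

theorem IsOutChain.length_le {n : ℕ} {out : ℕ → List ℕ} (hout : IsTopoGraph n out) {w : List ℕ}
    (h : IsOutChain n out w) : w.length ≤ n := (h.nodup hout).length_le_of_lt h.bound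

theorem le_of_pairwise_append_singleton {a : ℕ → ℤ} {D : ℤ} {x c : ℕ} {l : List ℕ}
    (h : (x :: l ++ [c]).Pairwise fun p q => D ≤ a q - a p) :
    ((l.length + 1 : ℕ) : ℤ) * D ≤ a c - a x := by
  induction l generalizing x with
  | nil => simpa using h
  | cons y l ih =>
    have h1 := ih (List.pairwise_cons.1 h).2
    have h2 := (List.pairwise_cons.1 h).1 y (by simp)
    push_cast [List.length_cons] at h1 ⊢
    linarith

theorem mem_longList {a : ℕ → ℤ} {D : ℤ} {out : ℕ → List ℕ} {p q : ℕ} :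
    q ∈ longList a D out p ↔ q ∈ out p ∧ D ≤ a q - a p := by
  simp [longList]

/-- If `(k + 1) D` exceeds the utility differences of nonadjacent pairs, then windows of length
`k + 1` decide whether a list is a chain of the graph of the long edges. -/
theorem hasWindows_longList {n k : ℕ} {out : ℕ → List ℕ} {a : ℕ → ℤ} {D : ℤ} (hD : 0 < D)
    (hk1 : 1 ≤ k)
    (hk : ∀ p q, p < n → q < n → (k + 1 : ℕ) * D ≤ a q - a p → q ∈ out p) :
    HasWindows n k (longList a D out) := by
  intro w c hw hc
  -- Let `x` be the first vertex of the window. The difference from `p` to `x` is at least `D` and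
  -- that from `x` to `c` is at least `k D`, by adding up consecutive differences. So `(p, c)` has
  -- difference at least `(k + 1) D`, and is a long edge by `hk`.
  have hlong : ∀ p ∈ w.take (w.length - k), c ∈ longList a D out p := by
    intro p hp
    have hlen : k < w.length := by
      by_contra h
      rw [Nat.sub_eq_zero_of_le (by omega)] at hp
      simp at hp
    have hlp : (lastPart k w).length = k := by
      rw [lastPart, List.length_drop]
      omega
    obtain ⟨x, l, hxl⟩ := List.exists_cons_of_length_pos (hlp.symm ▸ hk1 : 0 < (lastPart k w).length)
    rw [hxl] at hc hlp
    have h1 : ((l.length + 1 : ℕ) : ℤ) * D ≤ a c - a x :=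
      le_of_pairwise_append_singleton (hc.pairwise.imp fun h => (mem_longList.1 h).2)
    have h2 : IsOutChain n (longList a D out) (w.take (w.length - k) ++ (x :: l)) := by
      rw [← hxl, lastPart, List.take_append_drop]
      exact hw
    have h3 : D ≤ a x - a p :=
      (mem_longList.1 ((isOutChain_append.1 h2).2.2 p hp x (by simp))).2
    have h4 : l.length + 1 = k := by simpa using hlp
    rw [h4] at h1
    have h5 : (k + 1 : ℕ) * D ≤ a c - a p := by
      push_cast
      linarith
    refine mem_longList.2 ⟨hk p c ((isOutChain_append.1 h2).1.bound p hp) (hc.bound c (by simp)) h5,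
      h5.trans' ?_⟩
    push_cast
    nlinarith [Int.natCast_nonneg k]
  refine isOutChain_append.2 ⟨hw, ⟨by simp, fun p hp => hc.bound p (by simp_all)⟩, ?_⟩
  intro p hp q hq
  obtain rfl := List.mem_singleton.1 hq
  rw [← List.take_append_drop (w.length - k) w] at hp
  rcases List.mem_append.1 hp with hp | hp
  · exact hlong p hp
  · exact (isOutChain_append.1 hc).2.2 p hp _ (by simp)

/-- The tree is paid by the candidates and the dynamic program by the nodes; both are `O(k B)`. The
linear terms are covered by `n ≤ 2 m` and `m ≤ B`. -/
theorem findClique_ok {n m k B : ℕ} {out : ℕ → List ℕ} (hout : IsTopoGraph n out)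
    (hm : 1 ≤ m) (hn : n ≤ 2 * m) (hk : 1 ≤ k)
    (houtm : ∑ p ∈ Finset.range n, (out p).length ≤ m) (hB : m ^ (k + 1) ≤ B ^ 2)
    {a : ℕ → ℤ} {D : ℤ} (hwin : HasWindows n k (longList a D out)) {qs : List ℕ} (hqs : qs.length = n)
    (σ : St) (hnσ : σ .n 0 = n) (hd : σ .d 0 = D) (hkσ : σ .k 0 = k)
    (hal : ∀ p : ℕ, p < n → σ .al p = a p)
    (hg : IsGraph n (σ .pdeg) (σ .pnb) (σ .padj) out) (hrow : IsRowTable n (n + 4) (σ .row))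
    (hnil : ∀ p, n ≤ p → out p = [])
    (hord : ∀ (j : ℕ) (h : j < qs.length), σ .ord j = qs[j])
    (h0 : ∀ r ∈ [Reg.hdeg, .hadj, .last, .fst, .par, .suf, .mdv, .tgt, .rowt, .chd, .best],
      ∀ a : ℤ, 0 ≤ a → σ r a = 0) :
    findClique.Ok σ (fun s => ∃ w : List ℕ, IsOutChain n (longList a D out) w ∧
      (∀ w', IsOutChain n (longList a D out) w' → w'.length ≤ w.length) ∧ s .out 0 = w.length ∧
      ∀ (j : ℕ) (h : j < w.length), s .out (j + 1) = qs.getD w[j] 0)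
      (140 * k * B) := by
  have hout' : IsTopoGraph n (longList a D out) := hout.longList a D
  have houtm' : ∑ p ∈ Finset.range n, (longList a D out p).length ≤ m :=
    (Finset.sum_le_sum fun p _ => List.length_filter_le _ _).trans houtm
  have hmB : m ≤ B := (Nat.pow_le_pow_iff_left two_ne_zero).1
    ((Nat.pow_le_pow_right hm (by omega)).trans hB)
  have hkB : B ≤ k * B := Nat.le_mul_of_pos_left _ hk
  have hkk : k ≤ k * B := Nat.le_mul_of_pos_right _ (by omega)
  have hcount := sum_candidateCount_le hout' hm hn hk houtm' hB
  have hnodes := length_nodes_le hout' hm hn hk houtm' hB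
  have hcost : k * (28 * B + 5) = 28 * (k * B) + 5 * k := by ring
  have hcost' : (k + 1) * (2 * B) = 2 * (k * B) + 2 * B := by ring
  refine Cmd.Ok.seq (filterEdges_ok n out hout a D σ hnσ hd hal hg hrow hnil fun x hx =>
    ⟨h0 .hdeg (by simp) x hx, h0 .hadj (by simp) x hx⟩) (T' := 17 * n + 5 + k * (28 * B + 5) +
      (7 * (1 + (k + 1) * (2 * B)) + (4 * n + 3))) ?_ (by nlinarith)
  intro s₁ hf₁ hg₁
  refine Cmd.Ok.seq (createNodes_ok (k := k) hout' hk s₁ ?_ ?_ hg₁ ?_ ?_)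
    (T' := 7 * (1 + (k + 1) * (2 * B)) + (4 * n + 3)) ?_ (by omega)
  · rw [hf₁ .n (by decide), hnσ]
  · rw [hf₁ .k (by decide), hkσ]
  · rwa [hf₁ .row (by decide)]
  · intro r hr x hx
    rw [hf₁ r (by fin_cases hr <;> decide)]
    exact h0 r (by fin_cases hr <;> simp) x hx
  intro s₂ hf₂ hT
  have hlt := fun i j h1 h2 h3 h4 =>
    lt_of_target_eq_dropLast (n := n) (k := k) (out := longList a D out) hout' hk (i := i) (j := j) h1 h2 h3 h4
  obtain ⟨T, hTdef⟩ : ∃ T, T = nodes n (longList a D out) (k + 1) := ⟨_, rfl⟩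
  have hT' := hT
  rw [← hTdef] at hT hlt hnodes
  have hTpos : 0 < T.length := by
    rcases T with _ | ⟨x, T⟩
    · simpa using hT.head
    · simp
  refine Cmd.Ok.seq (findBest_ok (N := T.length) hTpos
    (π := fun i => T.idxOf (T.getD i []).dropLast)
    (τ := fun i => T.idxOf (target k (T.getD i []))) ?_ s₂ hT.cnt_eq ?_ ?_ ?_)
    (T' := 4 * n + 3) ?_ (by omega)
  · intro i j hi hiN hj hjN hij
    simp only [List.getD_eq_getElem _ _ hiN, List.getD_eq_getElem _ _ hjN] at hij
    refine hlt i j hiN hjN ?_ ((List.idxOf_inj (target_mem hT.tail_mem k (List.getElem_mem hiN))).1 hij)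
    intro hnil'
    have h1 := hT.nodup.idxOf_getElem j hjN
    rcases T with _ | ⟨x, T⟩
    · simp at hTpos
    · have h2 : x = [] := by simpa using hT.head
      rw [hnil', h2, List.idxOf_cons_self] at h1
      omega
  · intro i hi
    rw [hT.par_eq i hi, List.getD_eq_getElem _ _ hi]
  · intro i hi
    rw [hT.tgt_eq i hi, List.getD_eq_getElem _ _ hi]
  · intro x hx
    rw [hf₂ .best (by decide), hf₁ .best (by decide)]
    exact h0 .best (by simp) x hx
  rintro s₃ hf₃ ⟨b, f, hb, hbf⟩
  subst hTdef
  have h := followBest_ok hk hwin hqs s₃ (hT'.congr ?_) hb hbf ?_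
  · obtain ⟨w, h1, h2, h3, h4⟩ := h.1
    have h5 := h1.length_le hout'
    exact ⟨⟨w, h1, h2, h4⟩, h.2.trans (by omega)⟩
  · intro r hr
    exact hf₃ r (by fin_cases hr <;> decide)
  · intro j hj
    rw [hf₃ .ord (by decide), hf₂ .ord (by decide), hf₁ .ord (by decide)]
    exact hord j hj

/-! ### The preparation of the graph and of the parameters -/

section Programs

open Reg Cmd

/-- Read the graph and relabel it by the positions in a topological order. -/
def prepare : Cmd := rowTable ;; readEdges ;; sortInit ;; sortMain ;; relabel

/-- Read the header of the input of the first part. -/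
def readUtilityHeader : Cmd :=
  asg n (inp # 0) ;; asg m (inp # 1) ;; asg i (inp # 2) ;; asg t1 (inp # 3) ;; asg t2 (inp # 4) ;;
  asg eb (n + 5)

/-- Compute the minimum utility difference `d = i t₁`, the number `k = ⌊t₂ / d⌋`, and the utilities
of the positions. -/
def setUtility : Cmd :=
  asg d 0 ;; loop t lim1 i (asg d (d + t1)) ;;
  loop p lim1 n (wr al p (inp # (ord # p + 5))) ;;
  asg k 0 ;; asg acc d ;;
  loop t lim1 n (ite (t2 - acc + 1) (asg k (k + 1) ;; asg acc (acc + d)) skip)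

/-- Find a clique with the help of the utilities that are given. -/
def utilityClique : Cmd := readUtilityHeader ;; prepare ;; setUtility ;; findClique

end Programs

theorem countP_eq_indegree {L : List (ℕ × ℕ)} (hL : L.Nodup) (v : ℕ) :
    L.countP (fun p => p.2 = v) = indegree L.toFinset ∅ v := by
  rw [indegree, Finset.sdiff_empty, List.countP_eq_length_filter,
    ← List.toFinset_card_of_nodup (hL.filter _), List.toFinset_filter]
  simp

/-- The graph with the edges `L` has been read and relabelled according to the order `qs`. -/
structure IsPrepared (n : ℕ) (L : List (ℕ × ℕ)) (qs : List ℕ) (s : St) : Prop where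
  n_eq : s .n 0 = n
  row : IsRowTable n (n + 4) (s .row)
  big_eq : s .big 0 = n + 4
  graph : IsGraph n (s .pdeg) (s .pnb) (s .padj) (posList L qs)
  ord_eq : ∀ (j : ℕ) (h : j < qs.length), s .ord j = qs[j]

theorem IsPrepared.congr {n : ℕ} {L : List (ℕ × ℕ)} {qs : List ℕ} {s s' : St}
    (h : IsPrepared n L qs s)
    (hs : ∀ r ∈ [Reg.n, .row, .big, .pdeg, .pnb, .padj, .ord], s' r = s r) :
    IsPrepared n L qs s' := by
  obtain ⟨h1, h2, h3, h4, h5⟩ := h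
  constructor
  · rwa [hs .n (by decide)]
  · rwa [hs .row (by decide)]
  · rwa [hs .big (by decide)]
  · rwa [hs .pdeg (by decide), hs .pnb (by decide), hs .padj (by decide)]
  · rwa [hs .ord (by decide)]

theorem prepare_ok (n b : ℕ) (L : List (ℕ × ℕ)) (hL : IsEdges n L)
    (hwf : WellFounded fun x v => (x, v) ∈ L) (σ : St) (hn : σ .n 0 = n)
    (hm : σ .m 0 = L.length) (heb : σ .eb 0 = b)
    (hinp : ∀ (e : ℕ) (he : e < L.length),
      σ .inp ((b + e + e : ℕ) : ℤ) = L[e].1 ∧ σ .inp ((b + e + e + 1 : ℕ) : ℤ) = L[e].2)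
    (h0 : ∀ r ∈ [Reg.deg, .ind, .pdeg, .padj], ∀ a : ℤ, 0 ≤ a → σ r a = 0) :
    prepare.Ok σ (fun s => ∃ qs, IsTopoOrder n L qs ∧ IsPrepared n L qs s)
      (17 * L.length + 14 * n + 25) := by
  refine Cmd.Ok.seq (rowTable_ok n σ hn) (T' := 17 * L.length + 11 * n + 5) ?_ (by omega)
  rintro s₁ hf₁ ⟨hrow, hbig⟩
  refine Cmd.Ok.seq (readEdges_ok n b L hL s₁ ?_ ?_ hrow ?_ ?_ ?_)
    (T' := 11 * L.length + 11 * n + 4) ?_ (by omega)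
  · rwa [hf₁ .m (by decide)]
  · rwa [hf₁ .eb (by decide)]
  · rwa [hf₁ .inp (by decide)]
  · intro a
    rw [hf₁ .deg (by decide), h0 .deg (by simp) a (by positivity)]
  · intro a
    rw [hf₁ .ind (by decide), h0 .ind (by simp) a (by positivity)]
  rintro s₂ hf₂ ⟨hadj, hind⟩
  refine Cmd.Ok.seq (sortInit_ok n L.toFinset s₂ ?_ ?_) (T' := 11 * L.length + 7 * n + 2) ?_
    (by omega)
  · rw [hf₂ .n (by decide), hf₁ .n (by decide), hn]
  · intro v hv
    rw [hind v hv, countP_eq_indegree hL.nodup]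
  intro s₃ hf₃ hs₃
  refine Cmd.Ok.seq (sortMain_ok n L hL hwf s₃ ?_ hs₃ ?_ ?_) (T' := 5 * L.length + 3 * n + 1) ?_
    (by omega)
  · rw [hf₃ .n (by decide), hf₂ .n (by decide), hf₁ .n (by decide), hn]
  · rwa [hf₃ .deg (by decide), hf₃ .nb (by decide)]
  · rwa [hf₃ .row (by decide), hf₂ .row (by decide)]
  rintro s₄ hf₄ ⟨qs, hqs, hord⟩
  have hn₄ : s₄ .n 0 = n := by
    rw [hf₄ .n (by decide), hf₃ .n (by decide), hf₂ .n (by decide), hf₁ .n (by decide), hn]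
  have hrow₄ : IsRowTable n (n + 4) (s₄ .row) := by
    rwa [hf₄ .row (by decide), hf₃ .row (by decide), hf₂ .row (by decide)]
  refine (relabel_ok n L hL qs hqs s₄ hn₄ hord ?_ hrow₄ ?_).mono ?_ le_rfl
  · rwa [hf₄ .deg (by decide), hf₄ .nb (by decide), hf₃ .deg (by decide), hf₃ .nb (by decide)]
  · intro a ha
    rw [hf₄ .pdeg (by decide), hf₃ .pdeg (by decide), hf₂ .pdeg (by decide), hf₁ .pdeg (by decide),
      hf₄ .padj (by decide), hf₃ .padj (by decide), hf₂ .padj (by decide), hf₁ .padj (by decide)]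
    exact ⟨h0 .pdeg (by simp) a ha, h0 .padj (by simp) a ha⟩
  · intro s₅ hf₅ hg
    refine ⟨qs, hqs, by rw [hf₅ .n (by decide), hn₄], by rwa [hf₅ .row (by decide)], ?_, hg, ?_⟩
    · rw [hf₅ .big (by decide), hf₄ .big (by decide), hf₃ .big (by decide), hf₂ .big (by decide),
        hbig]
    · rw [hf₅ .ord (by decide)]
      exact fun j h => (hord j h).1

/-- Both the product `i t₁` and the quotient `⌊t₂ / d⌋` are computed by repeated addition; `n`
rounds suffice because `i ≤ n` and `K ≤ n`. -/
theorem setUtility_ok (n i K : ℕ) (L : List (ℕ × ℕ)) (qs : List ℕ) (hqs : IsTopoOrder n L qs)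
    (T₁ T₂ : ℤ) (α : ℕ → ℤ) (hT : 0 < T₁) (hi1 : 1 ≤ i) (hi : i ≤ n) (hK : K ≤ n)
    (hK1 : K * (i * T₁) ≤ T₂)
    (hK2 : T₂ < (K + 1) * (i * T₁)) (σ : St) (hn : σ .n 0 = n) (hiσ : σ .i 0 = i)
    (ht1 : σ .t1 0 = T₁) (ht2 : σ .t2 0 = T₂)
    (hord : ∀ (j : ℕ) (h : j < qs.length), σ .ord j = qs[j])
    (hinp : ∀ v : ℕ, v < n → σ .inp (v + 5) = α v) :
    setUtility.Ok σ (fun s => s .d 0 = i * T₁ ∧ s .k 0 = K ∧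
      ∀ p : ℕ, p < n → s .al p = α (qs.getD p 0)) (8 * n + 10) := by
  refine Cmd.Ok.asg_seq 0 (by simp) ?_ (T := 8 * n + 9) le_rfl
  have hlen := hqs.length_eq
  refine Cmd.Ok.seq (Q := fun s => s .d 0 = i * T₁) (T := 2 * n + 1) (T' := 6 * n + 8)
    (Cmd.Ok.loop (N := i) (fun t s => s .d 0 = t * T₁) (fun _ => 1) (by decide) ?_ ?_ ?_ ?_ ?_) ?_
    (by omega)
  · simp [hiσ]
  · simp
  · intro t ht s hf hx h
    refine Cmd.ok_of_exec ?_ (by simp [Cmd.cost, Cmd.asg])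
    have : s .t1 0 = T₁ := by rw [hf .t1 (by decide)]; simpa
    simp [Cmd.exec, Cmd.asg, h, this]
    ring
  · exact fun s _ h => h
  · simp; omega
  intro s₁ hf₁ hd
  refine Cmd.Ok.seq (Q := fun s => ∀ p : ℕ, p < n → s .al p = α (qs.getD p 0)) (T := 2 * n + 1)
    (T' := 4 * n + 4)
    (Cmd.Ok.loop (N := n) (fun t s => ∀ p : ℕ, p < t → s .al p = α (qs.getD p 0)) (fun _ => 1)
      (by decide) ?_ ?_ ?_ ?_ ?_) ?_ (by omega)
  · simp [hf₁ .n (by decide), hn]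
  · simp
  · intro t ht s hf hx h
    refine Cmd.ok_of_exec ?_ (by simp [Cmd.cost])
    have e1 : s .ord t = qs[t]'(by omega) := by
      rw [hf .ord (by decide), hf₁ .ord (by decide)]
      simpa using hord t (by omega)
    have e2 : s .inp ((qs[t]'(by omega) : ℕ) + 5) = α (qs[t]'(by omega)) := by
      rw [hf .inp (by decide), hf₁ .inp (by decide)]
      simpa using hinp _ (hqs.lt_of_mem (List.getElem_mem _))
    intro p hp
    by_cases hpt : p = t
    · subst hpt
      rw [List.getD_eq_getElem _ _ (show p < qs.length by omega)]
      simp [Cmd.exec, hx, e1, e2]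
    · have : (p : ℤ) ≠ t := by omega
      simp [Cmd.exec, hx, this, h p (by omega)]
  · exact fun s _ h => h
  · simp; omega
  intro s₂ hf₂ hal
  have hd₂ : s₂ .d 0 = i * T₁ := by rw [hf₂ .d (by decide), hd]
  refine Cmd.Ok.asg_seq 0 (by simp) ?_ (T := 4 * n + 3) le_rfl
  refine Cmd.Ok.asg_seq (i * T₁) (by simp [hd₂]) ?_ (T := 4 * n + 2) le_rfl
  -- The accumulator is one multiple ahead, at `(k + 1) d`, so that comparing it with `t₂` tells
  -- whether `k` may be raised.
  refine Cmd.Ok.loop (N := n) (fun t s => s .k 0 = (min t K : ℕ) ∧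
    s .acc 0 = ((min t K : ℕ) + 1) * (i * T₁)) (fun _ => 3) (by decide) ?_ ?_ ?_ ?_ ?_
  · simp [hf₂ .n (by decide), hf₁ .n (by decide), hn]
  · simp
  · rintro t ht s hf hx ⟨h1, h2⟩
    have e1 : s .d 0 = i * T₁ := by rw [hf .d (by decide)]; simpa using hd₂
    have e2 : s .t2 0 = T₂ := by
      rw [hf .t2 (by decide)]
      simp [hf₂ .t2 (by decide), hf₁ .t2 (by decide), ht2]
    have hpos : 0 < i * T₁ := by positivity
    rcases lt_or_ge t K with htK | htK
    · have e3 : min t K = t := by omega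
      have e4 : min (t + 1) K = t + 1 := by omega
      rw [e3] at h1 h2
      have h3 : (t + 1 : ℤ) * (i * T₁) ≤ K * (i * T₁) :=
        mul_le_mul_of_nonneg_right (by exact_mod_cast htK) hpos.le
      refine Cmd.Ok.ite (T := 2) (fun _ => ?_) (fun h => ?_) (by norm_num)
      · refine Cmd.ok_of_exec ?_ (by simp [Cmd.cost, Cmd.asg])
        simp [Cmd.exec, Cmd.asg, e1, e4, h1, h2]
        ring
      · simp only [Ex.eval_add, Ex.eval_sub, Ex.eval_arr, Ex.eval_lit, Ex.eval_one, e2, h2] at h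
        omega
    · have e3 : min t K = K := by omega
      have e4 : min (t + 1) K = K := by omega
      rw [e3] at h1 h2
      refine Cmd.Ok.ite (T := 2) (fun h => ?_) (fun _ => ?_) (by norm_num)
      · simp only [Ex.eval_add, Ex.eval_sub, Ex.eval_arr, Ex.eval_lit, Ex.eval_one, e2, h2] at h
        omega
      · exact Cmd.Ok.skip (by simp [e4, h1, h2]) (by norm_num)
  · rintro s hf ⟨h1, -⟩
    refine ⟨by rw [hf .d (by decide)]; simpa using hd₂, ?_, ?_⟩
    · rw [h1]; congr 1; omega
    · rw [hf .al (by decide)]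
      simpa using hal
  · simp; omega

/-- The input of the first part for the edges `L` and the utilities `α`. -/
structure IsUtilityInput (n i : ℕ) (L : List (ℕ × ℕ)) (T₁ T₂ : ℤ) (α : ℕ → ℤ) (inp : ℤ → ℤ) :
    Prop where
  n_eq : inp 0 = n
  m_eq : inp 1 = L.length
  i_eq : inp 2 = i
  t1_eq : inp 3 = T₁
  t2_eq : inp 4 = T₂
  util_eq : ∀ v : ℕ, v < n → inp (v + 5) = α v
  edge_eq : ∀ (e : ℕ) (he : e < L.length),
    inp ((n + 5 + e + e : ℕ) : ℤ) = L[e].1 ∧ inp ((n + 5 + e + e + 1 : ℕ) : ℤ) = L[e].2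

theorem utilityClique_ok (n i K B : ℕ) (L : List (ℕ × ℕ)) (hL : IsEdges n L)
    (hwf : WellFounded fun x v => (x, v) ∈ L) (T₁ T₂ : ℤ) (α : ℕ → ℤ) (hT : 0 < T₁)
    (hi1 : 1 ≤ i) (hi : i ≤ n) (hK0 : 1 ≤ K) (hK : K ≤ n) (hK1 : K * (i * T₁) ≤ T₂)
    (hK2 : T₂ < (K + 1) * (i * T₁)) (hm : 1 ≤ L.length) (hn : n ≤ 2 * L.length)
    (hα : ∀ u v, u < n → v < n → (u, v) ∉ L → α v - α u ≤ T₂)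
    (hB : L.length ^ (K + 1) ≤ B ^ 2) (σ : St) (hσ : IsUtilityInput n i L T₁ T₂ α (σ .inp))
    (h0 : ∀ r, r ≠ .inp → ∀ a : ℤ, 0 ≤ a → σ r a = 0) :
    utilityClique.Ok σ (fun s => ∃ w qs : List ℕ, IsTopoOrder n L qs ∧
      IsOutChain n (longList (fun p => α (qs.getD p 0)) (i * T₁) (posList L qs)) w ∧
      (∀ w', IsOutChain n (longList (fun p => α (qs.getD p 0)) (i * T₁) (posList L qs)) w' →
        w'.length ≤ w.length) ∧ s .out 0 = w.length ∧
      ∀ (j : ℕ) (h : j < w.length), s .out (j + 1) = qs.getD w[j] 0) (250 * K * B) := by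
  have hmB : L.length ≤ B := (Nat.pow_le_pow_iff_left two_ne_zero).1
    ((Nat.pow_le_pow_right hm (by omega)).trans hB)
  have hkB : B ≤ K * B := Nat.le_mul_of_pos_left _ hK0
  refine Cmd.Ok.seq (Q := fun s => s .n 0 = n ∧ s .m 0 = L.length ∧ s .i 0 = i ∧ s .t1 0 = T₁ ∧
    s .t2 0 = T₂ ∧ s .eb 0 = (n + 5 : ℕ)) (T := 6) (Cmd.ok_of_exec ?_ ?_)
    (T' := 17 * L.length + 14 * n + 25 + (8 * n + 10 + 140 * K * B)) ?_ (by nlinarith)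
  · simp [readUtilityHeader, Cmd.exec, Cmd.asg, hσ.n_eq, hσ.m_eq, hσ.i_eq, hσ.t1_eq, hσ.t2_eq]
  · simp [readUtilityHeader, Cmd.cost, Cmd.asg]
  rintro s₁ hf₁ ⟨hn₁, hm₁, hi₁, ht1, ht2, heb⟩
  refine Cmd.Ok.seq (prepare_ok n (n + 5) L hL hwf s₁ hn₁ hm₁ heb ?_ ?_)
    (T' := 8 * n + 10 + 140 * K * B) ?_ le_rfl
  · rw [hf₁ .inp (by decide)]
    exact hσ.edge_eq
  · intro r hr a ha
    rw [hf₁ r (by fin_cases hr <;> decide)]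
    exact h0 r (by fin_cases hr <;> decide) a ha
  rintro s₂ hf₂ ⟨qs, hqs, hp⟩
  refine Cmd.Ok.seq (setUtility_ok n i K L qs hqs T₁ T₂ α hT hi1 hi hK hK1 hK2 s₂ hp.n_eq ?_ ?_ ?_
    hp.ord_eq ?_) (T' := 140 * K * B) ?_ le_rfl
  · rw [hf₂ .i (by decide), hi₁]
  · rw [hf₂ .t1 (by decide), ht1]
  · rw [hf₂ .t2 (by decide), ht2]
  · rw [hf₂ .inp (by decide), hf₁ .inp (by decide)]
    exact hσ.util_eq
  rintro s₃ hf₃ ⟨hd, hk, hal⟩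
  have hp₃ : IsPrepared n L qs s₃ := hp.congr fun r hr => hf₃ r (by fin_cases hr <;> decide)
  refine (findClique_ok (out := posList L qs) (hqs.isTopoGraph hL) hm hn hK0
    (sum_length_posList hL hqs).le hB (a := fun p => α (qs.getD p 0)) (D := i * T₁)
    (hasWindows_longList (by positivity) hK0 ?_) hqs.length_eq s₃ hp₃.n_eq hd hk hal hp₃.graph
    hp₃.row ?_ hp₃.ord_eq ?_).mono ?_ le_rfl
  -- A nonadjacent pair has difference at most `T₂`, which is less than `(K + 1) i T₁`.
  · intro p q hpn hqn h
    rw [← hqs.length_eq] at hpn hqn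
    rw [mem_posList hL hqs]
    refine ⟨hpn, hqn, ?_⟩
    by_contra hnot
    have := hα _ _ (hqs.lt_of_mem (List.getElem_mem hpn)) (hqs.lt_of_mem (List.getElem_mem hqn)) hnot
    simp only [List.getD_eq_getElem _ _ hpn, List.getD_eq_getElem _ _ hqn] at h
    push_cast at h
    omega
  · intro p hpn
    rw [posList, dif_neg (by rw [hqs.length_eq]; omega)]
  · intro r hr a ha
    rw [hf₃ r (by fin_cases hr <;> decide), hf₂ r (by fin_cases hr <;> decide),
      hf₁ r (by fin_cases hr <;> decide)]
    exact h0 r (by fin_cases hr <;> decide) a ha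
  · rintro s₄ - ⟨w, h⟩
    exact ⟨w, qs, hqs, h⟩

/-! ### Bucket sort -/

/-- One pass of bucket sort: the elements are listed by increasing keys, and the order of
elements with the same key is kept. -/
def bucketList (n : ℕ) (key : ℕ → ℕ) (xs : List ℕ) : List ℕ :=
  (List.range n).flatMap fun a => xs.filter (fun v => key v = a)

theorem bucketList_perm {n : ℕ} {key : ℕ → ℕ} {xs : List ℕ} (hx : xs.Nodup)
    (h : ∀ v ∈ xs, key v < n) : (bucketList n key xs).Perm xs := by
  rw [List.perm_ext_iff_of_nodup ?_ hx]
  · intro v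
    simp only [bucketList, List.mem_flatMap, List.mem_range, List.mem_filter, decide_eq_true_eq]
    constructor
    · rintro ⟨a, -, hv, -⟩
      exact hv
    · exact fun hv => ⟨key v, h v hv, hv, rfl⟩
  · rw [bucketList, List.nodup_flatMap]
    refine ⟨fun a _ => hx.filter _, List.nodup_range.imp ?_⟩
    intro a b hab v hva hvb
    simp only [List.mem_filter, decide_eq_true_eq] at hva hvb
    exact hab (hva.2.symm.trans hvb.2)

/-- Bucket sort is stable. So two passes, the less significant key first, sort lexicographically. -/
theorem bucketList_pairwise {n : ℕ} {key : ℕ → ℕ} {xs : List ℕ} {S : ℕ → ℕ → Prop}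
    (h : xs.Pairwise S) :
    (bucketList n key xs).Pairwise fun v w => key v < key w ∨ key v = key w ∧ S v w := by
  rw [bucketList, List.pairwise_flatMap]
  refine ⟨fun a _ => ?_, List.pairwise_lt_range.imp ?_⟩
  · refine (h.filter _).imp_of_mem ?_
    intro v w hv hw hvw
    simp only [List.mem_filter, decide_eq_true_eq] at hv hw
    exact Or.inr ⟨hv.2.trans hw.2.symm, hvw⟩
  · intro a b hab v hv w hw
    simp only [List.mem_filter, decide_eq_true_eq] at hv hw
    exact Or.inl (by omega)

section Programs

open Reg Cmd

/-- One pass of bucket sort, from `srt1` to `srt2` with the keys `cand`. -/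
def bucketPass : Cmd :=
  loop x lim3 n (wr ct x 0) ;;
  loop x lim3 n (
    asg v (srt1 # x) ;; asg z (cand # v) ;;
    wr bk (row # z + ct # z) v ;; wr ct z (ct # z + 1)) ;;
  asg o 0 ;;
  loop x lim3 n (
    loop c lim4 (ct # x) (wr srt2 o (bk # (row # x + c)) ;; asg o (o + 1)))

/-- Sort the vertices by `keyA`, and by `keyB` if `keyA` is the same. -/
def sortByKeys : Cmd :=
  loop x lim3 n (wr srt1 x x ;; wr cand x (keyB # x)) ;;
  bucketPass ;;
  loop x lim3 n (wr srt1 x (srt2 # x) ;; wr cand x (keyA # x)) ;;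
  bucketPass

end Programs

theorem bucketPass_ok (n : ℕ) (key : ℕ → ℕ) (xs : List ℕ) (hxs : xs.Perm (List.range n))
    (hkey : ∀ v, v < n → key v < n) (σ : St) (hn : σ .n 0 = n)
    (hrow : IsRowTable n (n + 4) (σ .row)) (hsrc : ∀ (j : ℕ) (h : j < xs.length), σ .srt1 j = xs[j])
    (hk : ∀ v : ℕ, v < n → σ .cand v = key v) :
    bucketPass.Ok σ (fun s => ∀ (j : ℕ) (h : j < (bucketList n key xs).length),
      s .srt2 j = (bucketList n key xs)[j]) (12 * n + 4) := by
  have hlen : xs.length = n := by simpa using hxs.length_eq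
  have hlt : ∀ v ∈ xs, v < n := fun v hv => List.mem_range.1 (hxs.mem_iff.1 hv)
  refine Cmd.Ok.seq (Q := fun s => ∀ a : ℕ, a < n → s .ct a = 0) (T := 2 * n + 1)
    (T' := 10 * n + 3)
    (Cmd.Ok.loop (N := n) (fun t s => ∀ a : ℕ, a < t → s .ct a = 0) (fun _ => 1)
      (by decide) ?_ ?_ ?_ ?_ ?_) ?_ (by omega)
  · simp [hn]
  · simp
  · intro t ht s hf hx h
    refine Cmd.ok_of_exec ?_ (by simp [Cmd.cost])
    intro a ha
    by_cases hat : a = t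
    · subst hat
      simp [Cmd.exec, hx]
    · have : (a : ℤ) ≠ t := by omega
      simp [Cmd.exec, hx, this, h a (by omega)]
  · exact fun s _ h => h
  · simp; omega
  intro s₁ hf₁ hct
  refine Cmd.Ok.seq (Q := fun s => IsAdjList n (s .ct) (s .bk)
      (fun a => xs.filter fun v => key v = a)) (T := 5 * n + 1) (T' := 5 * n + 2)
    (Cmd.Ok.loop (N := n) (fun t s => IsAdjList n (s .ct) (s .bk)
      (fun a => (xs.take t).filter fun v => key v = a)) (fun _ => 4)
      (by decide) ?_ ?_ ?_ ?_ ?_) ?_ (by omega)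
  · simp [hf₁ .n (by decide), hn]
  · refine ⟨?_, ?_, ?_⟩
    · intro a ha
      simp [hct a ha]
    · simp
    · simp
  · intro t ht s hf hx h
    refine Cmd.ok_of_exec ?_ (by simp [Cmd.cost, Cmd.asg])
    have htx : t < xs.length := by omega
    have hv := hlt _ (List.getElem_mem htx)
    have hz := hkey _ hv
    have e1 : s .srt1 t = xs[t] := by
      rw [hf .srt1 (by decide), hf₁ .srt1 (by decide)]; exact hsrc t htx
    have e2 : s .cand xs[t] = key xs[t] := by
      rw [hf .cand (by decide), hf₁ .cand (by decide)]; exact hk _ hv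
    have e3 : s .row (key xs[t]) = key xs[t] * n := by
      rw [hf .row (by decide), hf₁ .row (by decide)]; exact hrow _ (by omega)
    have hlt' : ((xs.take t).filter fun v => key v = key xs[t]).length < n := by
      refine (List.length_filter_le _ _).trans_lt ?_
      rw [List.length_take]
      omega
    have := h.push hz xs[t] hlt'
    have hupd : Function.update (fun a => (xs.take t).filter fun v => key v = a) (key xs[t])
        (((xs.take t).filter fun v => key v = key xs[t]) ++ [xs[t]]) =
        fun a => (xs.take (t + 1)).filter fun v => key v = a := by
      funext a
      have htk : xs.take (t + 1) = xs.take t ++ [xs[t]] := by simp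
      rw [htk, List.filter_append]
      by_cases ha : a = key xs[t]
      · subst ha
        rw [Function.update_self, List.filter_singleton, decide_eq_true rfl, cond_true]
      · rw [Function.update_of_ne ha, List.filter_singleton, decide_eq_false (Ne.symm ha),
          cond_false, List.append_nil]
    rw [hupd] at this
    simpa [Cmd.exec, Cmd.asg, hx, e1, e2, e3] using this
  · intro s _ h
    rwa [List.take_of_length_le hlen.le] at h
  · simp; omega
  intro s₂ hf₂ hadj
  have hrow₂ : IsRowTable n (n + 4) (s₂ .row) := by
    rwa [hf₂ .row (by decide), hf₁ .row (by decide)]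
  refine Cmd.Ok.asg_seq 0 (by simp) ?_ (T := 5 * n + 1) le_rfl
  -- The buckets partition the list, so reading out all of them takes linear time.
  have hcost : ∑ a ∈ Finset.range n, (xs.filter fun v => key v = a).length = n := by
    have h1 := (bucketList_perm (hxs.nodup_iff.2 List.nodup_range)
      (fun v hv => hkey v (hlt v hv))).length_eq
    rw [bucketList, List.length_flatMap, List.sum_map_range_eq] at h1
    rw [h1, hlen]
  refine Cmd.Ok.loop (N := n) (fun t s => s .o 0 = (bucketList t key xs).length ∧
    ∀ (j : ℕ) (h : j < (bucketList t key xs).length), s .srt2 j = (bucketList t key xs)[j])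
    (fun t => 3 * (xs.filter fun v => key v = t).length + 1) (by decide) ?_ ?_ ?_ ?_ ?_
  · simp [hf₂ .n (by decide), hf₁ .n (by decide), hn]
  · simp [bucketList]
  · rintro t ht s hf hx ⟨h1, h2⟩
    set ys := xs.filter fun v => key v = t with hys
    refine Cmd.Ok.loop (N := ys.length)
      (fun c s => s .o 0 = (bucketList t key xs ++ ys.take c).length ∧
      ∀ (j : ℕ) (h : j < (bucketList t key xs ++ ys.take c).length),
        s .srt2 j = (bucketList t key xs ++ ys.take c)[j]) (fun _ => 2) (by decide) ?_ ?_ ?_ ?_ ?_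
    · have : s .ct t = ys.length := by
        rw [hf .ct (by decide)]; simpa using hadj.deg_eq t ht
      simp [hx, this]
    · simpa [h1] using h2
    · rintro c hc s' hf' hx' ⟨h3, h4⟩
      have hlen' : (bucketList t key xs ++ ys.take c).length = (bucketList t key xs).length + c := by
        rw [List.length_append, List.length_take]
        omega
      have htake : ys.take (c + 1) = ys.take c ++ [ys[c]] := by simp
      have e1 : s' .x 0 = t := by rw [hf' .x (by decide), hx]
      have e2 : s' .row t = t * n := by
        rw [hf' .row (by decide), hf .row (by decide)]; simpa using hrow₂ t (by omega)
      have e3 : s' .bk (t * n + c) = ys[c] := by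
        rw [hf' .bk (by decide), hf .bk (by decide)]
        simpa using hadj.nb_eq t ht c hc
      refine Cmd.ok_of_exec ⟨?_, ?_⟩ (by simp [Cmd.cost, Cmd.asg])
      · rw [htake, ← List.append_assoc, List.length_append, List.length_singleton]
        simp [Cmd.exec, Cmd.asg, h3, add_assoc]
      · intro j hj
        simp only [htake, ← List.append_assoc] at hj ⊢
        rw [List.length_append, List.length_singleton] at hj
        by_cases hjl : j = (bucketList t key xs ++ ys.take c).length
        · rw [List.getElem_append_right hjl.ge]
          simp [Cmd.exec, Cmd.asg, h3, e1, e2, hx', e3, hjl]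
        · have hne : (j : ℤ) ≠ ((bucketList t key xs ++ ys.take c).length : ℕ) := by omega
          rw [List.getElem_append_left (by omega), ← h4 j (by omega)]
          simp only [Cmd.exec, Cmd.asg, Ex.eval_arr, Ex.eval_lit, Ex.eval_add, Ex.eval_one, ne_eq,
            reduceCtorEq, not_false_eq_true, St.set_of_ne, St.set_self, h3]
          rw [Function.update_of_ne hne]
    · rintro s' - ⟨h3, h4⟩
      have : bucketList (t + 1) key xs = bucketList t key xs ++ ys.take ys.length := by
        simp [bucketList, List.range_succ, hys]
      simp only [this]
      refine ⟨by simpa using h3, fun j hj => ?_⟩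
      simpa using h4 j hj
    · simp; omega
  · rintro s - ⟨-, h⟩
    exact h
  · rw [Finset.sum_add_distrib, Finset.sum_add_distrib, ← Finset.mul_sum, hcost]
    simp; omega

theorem sortByKeys_ok (n : ℕ) (A B : ℕ → ℕ) (hA : ∀ v, v < n → A v < n) (hB : ∀ v, v < n → B v < n)
    (σ : St) (hn : σ .n 0 = n) (hrow : IsRowTable n (n + 4) (σ .row))
    (hkA : ∀ v : ℕ, v < n → σ .keyA v = A v) (hkB : ∀ v : ℕ, v < n → σ .keyB v = B v) :
    sortByKeys.Ok σ (fun s => ∃ ys : List ℕ, ys.Perm (List.range n) ∧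
      ys.Pairwise (fun v w => A v < A w ∨ A v = A w ∧ B v ≤ B w) ∧
      ∀ (j : ℕ) (h : j < ys.length), s .srt2 j = ys[j]) (30 * n + 10) := by
  have hp1 : (bucketList n B (List.range n)).Perm (List.range n) :=
    bucketList_perm List.nodup_range fun v hv => hB v (List.mem_range.1 hv)
  have hl1 : (bucketList n B (List.range n)).length = n := by simpa using hp1.length_eq
  refine Cmd.Ok.seq (Q := fun s => (∀ j : ℕ, j < n → s .srt1 j = j) ∧
      ∀ j : ℕ, j < n → s .cand j = B j) (T := 3 * n + 1) (T' := 27 * n + 9)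
    (Cmd.Ok.loop (N := n) (fun t s => (∀ j : ℕ, j < t → s .srt1 j = j) ∧
      ∀ j : ℕ, j < t → s .cand j = B j) (fun _ => 2) (by decide) ?_ ?_ ?_ ?_ ?_) ?_ (by omega)
  · simp [hn]
  · simp
  · rintro t ht s hf hx ⟨h1, h2⟩
    have e1 : s .keyB t = B t := by rw [hf .keyB (by decide), hkB t ht]
    refine Cmd.ok_of_exec ⟨fun j hj => ?_, fun j hj => ?_⟩ (by simp [Cmd.cost])
    all_goals
      by_cases hjt : j = t
      · subst hjt
        simp [Cmd.exec, hx, e1]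
      · have : (j : ℤ) ≠ t := by omega
        have := h1 j (by omega)
        have := h2 j (by omega)
        simp [Cmd.exec, *]
  · exact fun s _ h => h
  · simp; omega
  rintro s₁ hf₁ ⟨h1, h2⟩
  refine Cmd.Ok.seq (bucketPass_ok n B (List.range n) (List.Perm.refl _) hB s₁ ?_ ?_ ?_ h2)
    (T' := 15 * n + 5) ?_ (by omega)
  · rw [hf₁ .n (by decide), hn]
  · rwa [hf₁ .row (by decide)]
  · intro j hj
    rw [h1 j (by simpa using hj)]
    simp
  intro s₂ hf₂ h3
  refine Cmd.Ok.seq (Q := fun s => (∀ (j : ℕ) (h : j < (bucketList n B (List.range n)).length),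
      s .srt1 j = (bucketList n B (List.range n))[j]) ∧
      ∀ j : ℕ, j < n → s .cand j = A j) (T := 3 * n + 1) (T' := 12 * n + 4)
    (Cmd.Ok.loop (N := n) (fun t s => (∀ j (h : j < (bucketList n B (List.range n)).length), j < t →
      s .srt1 j = (bucketList n B (List.range n))[j]) ∧
      ∀ j : ℕ, j < t → s .cand j = A j) (fun _ => 2) (by decide) ?_ ?_ ?_ ?_ ?_) ?_ (by omega)
  · simp [hf₂ .n (by decide), hf₁ .n (by decide), hn]
  · simp
  · rintro t ht s hf hx ⟨h4, h5⟩
    have e1 : s .keyA t = A t := by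
      rw [hf .keyA (by decide), hf₂ .keyA (by decide), hf₁ .keyA (by decide), hkA t ht]
    have e2 : s .srt2 t = (bucketList n B (List.range n))[t]'(by omega) := by
      rw [hf .srt2 (by decide), h3 t (by omega)]
    refine Cmd.ok_of_exec ⟨fun j hj hjt' => ?_, fun j hj => ?_⟩ (by simp [Cmd.cost])
    · by_cases hjt : j = t
      · subst hjt
        simp [Cmd.exec, hx, e2]
      · have hne : (j : ℤ) ≠ t := by omega
        have := h4 j hj (by omega)
        simp [Cmd.exec, hx, hne, this]
    · by_cases hjt : j = t
      · subst hjt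
        simp [Cmd.exec, hx, e1]
      · have hne : (j : ℤ) ≠ t := by omega
        have := h5 j (by omega)
        simp [Cmd.exec, hx, hne, this]
  · rintro s - ⟨h4, h5⟩
    exact ⟨fun j hj => h4 j hj (by omega), h5⟩
  · simp; omega
  rintro s₃ hf₃ ⟨h4, h5⟩
  refine (bucketPass_ok n A (bucketList n B (List.range n)) hp1 hA s₃ ?_ ?_ h4 h5).mono ?_ le_rfl
  · rw [hf₃ .n (by decide), hf₂ .n (by decide), hf₁ .n (by decide), hn]
  · rwa [hf₃ .row (by decide), hf₂ .row (by decide), hf₁ .row (by decide)]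
  · rintro s - h
    refine ⟨_, (bucketList_perm (hp1.nodup_iff.2 List.nodup_range) fun v hv =>
      hA v (List.mem_range.1 (hp1.mem_iff.1 hv))).trans hp1, ?_, h⟩
    refine (bucketList_pairwise (bucketList_pairwise (S := fun _ _ => True)
      (List.pairwise_of_forall fun _ _ => trivial))).imp ?_
    rintro v w (h | ⟨h, h' | ⟨h', -⟩⟩)
    exacts [Or.inl h, Or.inr ⟨h, h'.le⟩, Or.inr ⟨h, h'.le⟩]

/-! ### Raising utilities until the thresholds are met

A pair `(a, b)` stands for the utility `a N + b`. Edges have to increase the utility by `N`, and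
other pairs may increase it by at most `R N - 1`. -/

/-- The utility that a pair stands for. -/
def pairValue (N : ℤ) (w : ℤ × ℤ) : ℤ := w.1 * N + w.2

/-- With second components in `[0, N)`, comparing the numbers `a N + b` is comparing the pairs
lexicographically. -/
theorem toLex_le_of_pairValue_le {N : ℤ} {w w' : ℤ × ℤ} (hw : 0 ≤ w.2 ∧ w.2 < N)
    (hw' : 0 ≤ w'.2 ∧ w'.2 < N) (h : pairValue N w ≤ pairValue N w') :
    w.1 < w'.1 ∨ w.1 = w'.1 ∧ w.2 ≤ w'.2 := by
  simp only [pairValue] at h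
  rcases lt_trichotomy w.1 w'.1 with h1 | h1 | h1
  · exact Or.inl h1
  · rw [h1] at h
    exact Or.inr ⟨h1, by linarith⟩
  · exfalso
    nlinarith

/-- `β` is a utility function for the thresholds `1` and `r < R`. -/
structure IsPotential (n : ℕ) (out : ℕ → List ℕ) (R : ℤ) (β : ℕ → ℝ) : Prop where
  edge : ∀ p < n, ∀ q ∈ out p, β p + 1 ≤ β q
  nonedge : ∀ u < n, ∀ w < n, w ∉ out u → β w - β u < R

/-- Compared with the potential `β`, the value `c` at `v` is at most the value `W s` at `s`. -/
def IsBelow (β : ℕ → ℝ) (W : ℕ → ℤ × ℤ) (c : ℤ × ℤ) (v s : ℕ) : Prop :=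
  (c.1 : ℝ) - β v < ((W s).1 : ℝ) - β s ∨
    (c.1 : ℝ) - β v = ((W s).1 : ℝ) - β s ∧ c.2 ≤ (W s).2

/-- The value `c` at `v` is accounted for by distinct vertices: it is the result of
`c.1 + c.2 R` edges and `c.2` nonadjacent pairs. -/
def IsTraced (n : ℕ) (R : ℤ) (β : ℕ → ℝ) (W : ℕ → ℤ × ℤ) (c : ℤ × ℤ) (v : ℕ) : Prop :=
  ∃ l : List ℕ, l.Nodup ∧ (∀ s ∈ l, s < n ∧ IsBelow β W c v s) ∧
    (l.length : ℤ) = c.1 + c.2 * R + c.2 + 1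

/-- The witnesses are distinct vertices. This one inequality bounds both the number of phases,
through `c.2`, and the keys of the bucket sort, through `c.1`. -/
theorem IsTraced.le {n : ℕ} {R : ℤ} {β : ℕ → ℝ} {W : ℕ → ℤ × ℤ} {c : ℤ × ℤ} {v : ℕ}
    (h : IsTraced n R β W c v) : c.1 + c.2 * (R + 1) + 1 ≤ n := by
  obtain ⟨l, h1, h2, h3⟩ := h
  have := h1.length_le_of_lt fun s hs => (h2 s hs).1
  have : (l.length : ℤ) ≤ n := by exact_mod_cast this
  linarith

theorem isTraced_zero {n : ℕ} {R : ℤ} {β : ℕ → ℝ} {v : ℕ} (hv : v < n) :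
    IsTraced n R β (fun _ => (0, 0)) (0, 0) v :=
  ⟨[v], by simp, by simp [hv, IsBelow], by simp⟩

/-- Raising the value of a vertex does not affect the account of other values. -/
theorem IsTraced.mono {n : ℕ} {N R : ℤ} {β : ℕ → ℝ} {W W' : ℕ → ℤ × ℤ} {c : ℤ × ℤ} {v : ℕ}
    (h : IsTraced n R β W c v) (hW : ∀ s < n, 0 ≤ (W s).2 ∧ (W s).2 < N)
    (hW' : ∀ s < n, 0 ≤ (W' s).2 ∧ (W' s).2 < N)
    (hle : ∀ s < n, pairValue N (W s) ≤ pairValue N (W' s)) : IsTraced n R β W' c v := by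
  obtain ⟨l, h1, h2, h3⟩ := h
  refine ⟨l, h1, fun s hs => ⟨(h2 s hs).1, ?_⟩, h3⟩
  obtain ⟨hsn, h4⟩ := h2 s hs
  rcases toLex_le_of_pairValue_le (hW s hsn) (hW' s hsn) (hle s hsn) with h5 | ⟨h5, h6⟩
  · have h5' : ((W s).1 : ℝ) < (W' s).1 := by exact_mod_cast h5
    left
    rcases h4 with h4 | ⟨h4, -⟩ <;> linarith
  · rcases h4 with h4 | ⟨h4, h7⟩
    · left
      rwa [← h5]
    · right
      rw [← h5]
      exact ⟨h4, h7.trans h6⟩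

/-- A value that is derived from another value by one step is accounted for. -/
theorem IsTraced.step {n : ℕ} {N R : ℤ} {β : ℕ → ℝ} {W : ℕ → ℤ × ℤ} {c c' : ℤ × ℤ} {v v' : ℕ}
    (h : IsTraced n R β W c v) (hv' : v' < n)
    (hW : ∀ s < n, 0 ≤ (W s).2 ∧ (W s).2 < N) (hc' : 0 ≤ c'.2 ∧ c'.2 < N)
    (hlt : pairValue N (W v') < pairValue N c')
    (hsum : c'.1 + c'.2 * R + c'.2 = c.1 + c.2 * R + c.2 + 1)
    (hbelow : (c'.1 : ℝ) - β v' < c.1 - β v ∨ (c'.1 : ℝ) - β v' ≤ c.1 - β v ∧ c'.2 ≤ c.2) :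
    IsTraced n R β (Function.update W v' c') c' v' := by
  obtain ⟨l, h1, h2, h3⟩ := h
  -- A step does not raise the reduced pair `(c.1 - β v, c.2)` in lexicographic order, so the old
  -- witnesses remain above the new value.
  have hb : ∀ s, IsBelow β W c v s → IsBelow β W c' v' s := by
    intro s hs
    rcases hs with hs | ⟨hs, hs'⟩ <;> rcases hbelow with h4 | ⟨h4, h5⟩
    · exact Or.inl (by linarith)
    · exact Or.inl (by linarith)
    · exact Or.inl (by linarith)
    · rcases h4.lt_or_eq with h4 | h4
      · exact Or.inl (by linarith)
      · exact Or.inr ⟨by linarith, h5.trans hs'⟩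
  -- If `v'` were a witness, its present value would be at least the new value `c'`; but it is
  -- strictly smaller. So `v'` is a further witness.
  have hnot : v' ∉ l := by
    intro hmem
    have h4 := hb v' (h2 v' hmem).2
    have h5 := toLex_le_of_pairValue_le (hW v' hv') hc' hlt.le
    rcases h4 with h4 | ⟨h4, h6⟩
    · have h7 : c'.1 < (W v').1 := by
        have : (c'.1 : ℝ) < (W v').1 := by linarith
        exact_mod_cast this
      omega
    · have h7 : c'.1 = (W v').1 := by
        have : (c'.1 : ℝ) = (W v').1 := by linarith
        exact_mod_cast this
      have h8 : c'.2 = (W v').2 := by omega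
      rw [pairValue, pairValue, h7, h8] at hlt
      exact lt_irrefl _ hlt
  refine ⟨v' :: l, List.nodup_cons.2 ⟨hnot, h1⟩, ?_, ?_⟩
  · intro s hs
    rcases List.mem_cons.1 hs with rfl | hs
    · exact ⟨hv', by simp [IsBelow]⟩
    · have hne : s ≠ v' := fun h => hnot (h ▸ hs)
      refine ⟨(h2 s hs).1, ?_⟩
      have := hb s (h2 s hs).2
      rwa [IsBelow, Function.update_of_ne hne]
  · push_cast [List.length_cons]
    rw [h3, hsum]

/-- The state after `x` phases: an edge or a nonadjacent pair whose threshold is not met starts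
at a value of the last phase. -/
structure IsPhase (n : ℕ) (out : ℕ → List ℕ) (N R : ℤ) (x : ℕ) (W : ℕ → ℤ × ℤ) : Prop where
  nonneg : ∀ v < n, 0 ≤ pairValue N (W v)
  snd_nonneg : ∀ v < n, 0 ≤ (W v).2
  snd_le : ∀ v < n, (W v).2 ≤ x
  edge : ∀ p < n, ∀ q ∈ out p, pairValue N (W p) + N ≤ pairValue N (W q) ∨ (W p).2 = x
  nonedge : ∀ u < n, ∀ w < n, w ∉ out u →
    pairValue N (W w) - (R * N - 1) ≤ pairValue N (W u) ∨ (W w).2 + 1 = x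
  traced : ∀ β, IsPotential n out R β → ∀ v < n, IsTraced n R β W (W v) v

/-- The state `W` within the phase after the state `W₀`. -/
structure IsWithinPhase (n : ℕ) (out : ℕ → List ℕ) (N R : ℤ) (x : ℕ) (W₀ W : ℕ → ℤ × ℤ) :
    Prop where
  snd_nonneg : ∀ v < n, 0 ≤ (W v).2
  snd_le : ∀ v < n, (W v).2 ≤ x
  le : ∀ v < n, pairValue N (W₀ v) ≤ pairValue N (W v)
  changed : ∀ v < n, pairValue N (W₀ v) < pairValue N (W v) → (W v).2 = x
  edge : ∀ p < n, ∀ q ∈ out p, pairValue N (W p) + N ≤ pairValue N (W q) ∨ (W p).2 = x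
  traced : ∀ β, IsPotential n out R β → ∀ v < n, IsTraced n R β W (W v) v

theorem IsPhase.isWithinPhase {n : ℕ} {out : ℕ → List ℕ} {N R : ℤ} {x : ℕ} {W : ℕ → ℤ × ℤ}
    (h : IsPhase n out N R x W) : IsWithinPhase n out N R x W W :=
  ⟨h.snd_nonneg, h.snd_le, fun _ _ => le_rfl, fun _ _ h => absurd h (lt_irrefl _), h.edge, h.traced⟩

/-- Utilities that are all `0` meet the conditions on nonadjacent pairs because `R N - 1 ≥ 0`. Edges
are violated, but they start at second component `0`, the phase number. -/
theorem isPhase_zero {n : ℕ} {out : ℕ → List ℕ} {N R : ℤ} (h : 1 ≤ R * N) :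
    IsPhase n out N R 0 fun _ => (0, 0) :=
  ⟨by simp [pairValue], by simp, by simp, by simp, by simp [pairValue]; omega,
    fun _ _ _ hv => isTraced_zero hv⟩

/-- First components may be lowered by `R`, but the value stays nonnegative and the second component
is less than `N`. The bucket sort needs this. -/
theorem IsPhase.fst_nonneg {n : ℕ} {out : ℕ → List ℕ} {N R : ℤ} {x : ℕ} {W : ℕ → ℤ × ℤ}
    (h : IsPhase n out N R x W) (hx : x < N) {v : ℕ} (hv : v < n) : 0 ≤ (W v).1 := by
  have h1 := h.nonneg v hv
  have h2 := h.snd_le v hv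
  rw [pairValue] at h1
  by_contra h3
  nlinarith

/-- Raise one value. -/
theorem IsWithinPhase.update {n : ℕ} {out : ℕ → List ℕ} {N R : ℤ} {x : ℕ} {W₀ W : ℕ → ℤ × ℤ}
    (h : IsWithinPhase n out N R x W₀ W) (hx : x < N) {u : ℕ} {c : ℤ × ℤ} (hc : c.2 = x)
    (hlt : pairValue N (W u) < pairValue N c)
    (ht : ∀ β, IsPotential n out R β → IsTraced n R β (Function.update W u c) c u) :
    IsWithinPhase n out N R x W₀ (Function.update W u c) := by
  have hupd : ∀ v, pairValue N (W v) ≤ pairValue N (Function.update W u c v) := by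
    intro v
    by_cases hvu : v = u
    · subst hvu
      simpa using hlt.le
    · simp [hvu]
  have h1 : ∀ v < n, 0 ≤ (Function.update W u c v).2 := by
    intro v hv
    by_cases hvu : v = u
    · subst hvu
      simp [hc]
    · simpa [hvu] using h.snd_nonneg v hv
  have h2 : ∀ v < n, (Function.update W u c v).2 ≤ x := by
    intro v hv
    by_cases hvu : v = u
    · subst hvu
      simp [hc]
    · simpa [hvu] using h.snd_le v hv
  refine ⟨h1, h2, fun v hv => (h.le v hv).trans (hupd v), ?_, ?_, ?_⟩
  · intro v hv hv'
    by_cases hvu : v = u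
    · subst hvu
      simp [hc]
    · simp only [ne_eq, hvu, not_false_eq_true, Function.update_of_ne] at hv' ⊢
      exact h.changed v hv hv'
  · intro p hp q hq
    by_cases hpu : p = u
    · subst hpu
      right
      simp [hc]
    · rw [Function.update_of_ne hpu]
      exact (h.edge p hp q hq).imp_left fun h => h.trans (hupd q)
  · intro β hβ v hv
    by_cases hvu : v = u
    · subst hvu
      simpa using ht β hβ
    · rw [Function.update_of_ne hvu]
      refine (h.traced β hβ v hv).mono (N := N) ?_ ?_ fun s _ => hupd s
      · exact fun s hs => ⟨h.snd_nonneg s hs, (h.snd_le s hs).trans_lt hx⟩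
      · exact fun s hs => ⟨h1 s hs, (h2 s hs).trans_lt hx⟩

/-- Raise the value of `u` because of the nonadjacent pair `(u, w)`. -/
theorem IsWithinPhase.update_nonedge {n : ℕ} {out : ℕ → List ℕ} {N R : ℤ} {x : ℕ}
    {W₀ W : ℕ → ℤ × ℤ} (h : IsWithinPhase n out N R x W₀ W) (h₀ : IsPhase n out N R x W₀)
    (hx : x < N) {u w : ℕ} (hu : u < n) (hw : w < n) (huw : w ∉ out u)
    (hlt : pairValue N (W u) < pairValue N ((W₀ w).1 - R, (W₀ w).2 + 1)) :
    IsWithinPhase n out N R x W₀ (Function.update W u ((W₀ w).1 - R, (W₀ w).2 + 1)) := by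
  -- Values only rise within a phase, so the pair was violated at its start too; then `w` got its
  -- value in the preceding phase.
  have hc : (W₀ w).2 + 1 = x := by
    rcases h₀.nonedge u hu w hw huw with h1 | h1
    · exfalso
      have := h.le u hu
      simp only [pairValue] at *
      linarith
    · exact h1
  have hb₀ : ∀ s < n, 0 ≤ (W₀ s).2 ∧ (W₀ s).2 < N := fun s hs =>
    ⟨h₀.snd_nonneg s hs, (h₀.snd_le s hs).trans_lt hx⟩
  have hb : ∀ s < n, 0 ≤ (W s).2 ∧ (W s).2 < N := fun s hs =>
    ⟨h.snd_nonneg s hs, (h.snd_le s hs).trans_lt hx⟩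
  refine h.update hx hc hlt fun β hβ => ?_
  refine ((h₀.traced β hβ w hw).mono hb₀ hb h.le).step (N := N) hu hb ?_ hlt ?_ (Or.inl ?_)
  · rw [show ((W₀ w).1 - R, (W₀ w).2 + 1).2 = x from hc]
    exact ⟨by positivity, hx⟩
  · ring
  · have := hβ.nonedge u hu w hw huw
    push_cast
    linarith

/-- Raise the value of `q` because of the edge `(p, q)`. -/
theorem IsWithinPhase.update_edge {n : ℕ} {out : ℕ → List ℕ} {N R : ℤ} {x : ℕ}
    {W₀ W : ℕ → ℤ × ℤ} (h : IsWithinPhase n out N R x W₀ W)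
    (hx : x < N) {p q : ℕ} (hp : p < n) (hq : q < n) (hpq : q ∈ out p)
    (hlt : pairValue N (W q) < pairValue N ((W p).1 + 1, (W p).2)) :
    IsWithinPhase n out N R x W₀ (Function.update W q ((W p).1 + 1, (W p).2)) := by
  have hc : (W p).2 = x := by
    rcases h.edge p hp q hpq with h1 | h1
    · exfalso
      simp only [pairValue] at *
      linarith
    · exact h1
  have hb : ∀ s < n, 0 ≤ (W s).2 ∧ (W s).2 < N := fun s hs =>
    ⟨h.snd_nonneg s hs, (h.snd_le s hs).trans_lt hx⟩
  refine h.update hx hc hlt fun β hβ => ?_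
  refine (h.traced β hβ p hp).step (N := N) hq hb (hb p hp) hlt ?_ (Or.inr ⟨?_, le_rfl⟩)
  · ring
  · have := hβ.edge p hp q hpq
    push_cast
    linarith

/-- The end of a phase. -/
theorem IsWithinPhase.isPhase {n : ℕ} {out : ℕ → List ℕ} {N R : ℤ} {x : ℕ}
    {W₀ W : ℕ → ℤ × ℤ} (h : IsWithinPhase n out N R x W₀ W) (h₀ : ∀ v < n, 0 ≤ pairValue N (W₀ v))
    (hedge : ∀ p < n, ∀ q ∈ out p, pairValue N (W p) + N ≤ pairValue N (W q))
    (hnon : ∀ u < n, ∀ w < n, w ∉ out u →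
      pairValue N (W₀ w) - (R * N - 1) ≤ pairValue N (W u)) :
    IsPhase n out N R (x + 1) W := by
  refine ⟨fun v hv => (h₀ v hv).trans (h.le v hv), h.snd_nonneg, fun v hv => ?_,
    fun p hp q hq => Or.inl (hedge p hp q hq), fun u hu w hw huw => ?_, h.traced⟩
  · have := h.snd_le v hv
    push_cast
    omega
  -- If `w` has not risen, the bound by its starting value is the condition itself. If it has, its
  -- second component is `x`, as the exception allows.
  · rcases (h.le w hw).eq_or_lt with h1 | h1
    · left
      rw [← h1]
      exact hnon u hu w hw huw
    · right
      rw [h.changed w hw h1]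
      push_cast
      rfl

/-! ### One phase -/

section Programs

open Reg Cmd

/-- Raise the utilities because of nonadjacent pairs. The best candidate for a vertex is the first
vertex in decreasing order that is not an out-neighbour. -/
def relaxNonedges : Cmd :=
  loop u lim3 n (
    wr val' u (val # u) ;; wr keyA' u (keyA # u) ;; wr keyB' u (keyB # u) ;; asg fl 0 ;;
    loop c lim4 (pdeg # u + 1) (
      ite fl skip (
        asg v (srt2 # (n - 1 - c)) ;;
        ite (padj # (row # u + v)) skip (
          asg fl 1 ;;
          ite (val # v - ratBig + 1 - val # u)
            (wr val' u (val # v - ratBig + 1) ;; wr keyA' u (keyA # v - rat) ;;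
              wr keyB' u (keyB # v + 1))
            skip))))

/-- Raise the utilities because of edges, in topological order. -/
def relaxEdges : Cmd :=
  loop p lim3 n (
    loop c lim4 (pdeg # p) (
      asg q (pnb # (row # p + c)) ;;
      ite (val' # p + big - val' # q)
        (wr val' q (val' # p + big) ;; wr keyA' q (keyA' # p + 1) ;; wr keyB' q (keyB' # p))
        skip))

/-- Store the new utilities. -/
def copyBack : Cmd :=
  asg chg 0 ;;
  loop u lim3 n (
    ite (val' # u - val # u) (asg chg 1) skip ;;
    wr val u (val' # u) ;; wr keyA u (keyA' # u) ;; wr keyB u (keyB' # u) ;;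
    ite (keyA # u - n + 1) (asg bad 1) skip)

/-- One phase. -/
def phase : Cmd := ite bad skip (sortByKeys ;; relaxNonedges ;; relaxEdges ;; copyBack)

end Programs

/-- The arrays `val`, `A`, `B` hold the first `t` values of `W`. -/
def HoldsPairs (t : ℕ) (N : ℤ) (W : ℕ → ℤ × ℤ) (val A B : ℤ → ℤ) : Prop :=
  ∀ v : ℕ, v < t → val v = pairValue N (W v) ∧ A v = (W v).1 ∧ B v = (W v).2

theorem HoldsPairs.update {t : ℕ} {N : ℤ} {W : ℕ → ℤ × ℤ} {val A B : ℤ → ℤ}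
    (h : HoldsPairs t N W val A B) (u : ℕ) (c : ℤ × ℤ) :
    HoldsPairs t N (Function.update W u c) (Function.update val u (pairValue N c))
      (Function.update A u c.1) (Function.update B u c.2) := by
  intro v hv
  by_cases hvu : v = u
  · subst hvu
    simp
  · have : (v : ℤ) ≠ u := by omega
    simpa [hvu, this] using h v hv

theorem HoldsPairs.push {t : ℕ} {N : ℤ} {W : ℕ → ℤ × ℤ} {val A B : ℤ → ℤ}
    (h : HoldsPairs t N W val A B) :
    HoldsPairs (t + 1) N W (Function.update val t (pairValue N (W t)))
      (Function.update A t (W t).1) (Function.update B t (W t).2) := by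
  intro v hv
  by_cases hvu : v = t
  · subst hvu
    simp
  · have : (v : ℤ) ≠ t := by omega
    simpa [this] using h v (by omega)

/-- A vertex is not its own out-neighbour. So among any `(out p).length + 1` different vertices
there is one outside `out p`, and that many vertices exist. -/
theorem IsTopoGraph.length_lt {n : ℕ} {out : ℕ → List ℕ} (h : IsTopoGraph n out) {p : ℕ}
    (hp : p < n) : (out p).length < n := by
  have h1 : (p :: out p).Nodup :=
    List.nodup_cons.2 ⟨fun h' => lt_irrefl _ (h.lt p p h'), h.nodup p⟩
  have h2 := h1.length_le_of_lt (n := n) (by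
    intro q hq
    rcases List.mem_cons.1 hq with rfl | hq
    exacts [hp, h.bound p q hq])
  simpa using h2

/-- Of all pairs `(t, w)` without an edge, only the one with the largest value at `w` matters. In
decreasing order of values it is preceded by out-neighbours of `t` only, so the scan ends after at
most `(out t).length + 1` steps; this avoids the quadratic number of nonadjacent pairs. Candidates
are taken from the fixed values `W₀`, so one sorted list serves all vertices. -/
theorem relaxNonedges_ok {n : ℕ} {out : ℕ → List ℕ} (hout : IsTopoGraph n out) {N R : ℤ} {x : ℕ}
    (hx : x < N) {W₀ : ℕ → ℤ × ℤ} (hW₀ : IsPhase n out N R x W₀) {ys : List ℕ}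
    (hys : ys.Perm (List.range n))
    (hsort : ys.Pairwise fun v w => pairValue N (W₀ v) ≤ pairValue N (W₀ w)) (σ : St)
    (hn : σ .n 0 = n) (hg : IsGraph n (σ .pdeg) (σ .pnb) (σ .padj) out)
    (hrow : IsRowTable n (n + 4) (σ .row)) (hrat : σ .rat 0 = R) (hratN : σ .ratBig 0 = R * N)
    (hsrt : ∀ (j : ℕ) (h : j < ys.length), σ .srt2 j = ys[j])
    (hval : HoldsPairs n N W₀ (σ .val) (σ .keyA) (σ .keyB)) :
    relaxNonedges.Ok σ (fun s => ∃ W, HoldsPairs n N W (s .val') (s .keyA') (s .keyB') ∧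
      IsWithinPhase n out N R x W₀ W ∧ ∀ u < n, ∀ w < n, w ∉ out u →
        pairValue N (W₀ w) - (R * N - 1) ≤ pairValue N (W u))
      (9 * ∑ p ∈ Finset.range n, (out p).length + 20 * n + 1) := by
  have hlen : ys.length = n := by simpa using hys.length_eq
  refine Cmd.Ok.loop (N := n) (fun t s => ∃ W, HoldsPairs t N W (s .val') (s .keyA') (s .keyB') ∧
      IsWithinPhase n out N R x W₀ W ∧ (∀ v, t ≤ v → W v = W₀ v) ∧
      ∀ u < t, ∀ w < n, w ∉ out u → pairValue N (W₀ w) - (R * N - 1) ≤ pairValue N (W u))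
    (fun t => 9 * (out t).length + 19) (by decide) ?_ ?_ ?_ ?_ ?_
  · simp [hn]
  · exact ⟨W₀, fun v hv => absurd hv (Nat.not_lt_zero v), hW₀.isWithinPhase, fun _ _ => rfl,
      fun u hu => absurd hu (Nat.not_lt_zero u)⟩
  rintro t ht s hf hxt ⟨W, h1, h2, h3, h4⟩
  obtain ⟨v1, v2, v3⟩ := hval t ht
  have e1 : s .val t = pairValue N (W₀ t) := by rw [hf .val (by decide), v1]
  have e2 : s .keyA t = (W₀ t).1 := by rw [hf .keyA (by decide), v2]
  have e3 : s .keyB t = (W₀ t).2 := by rw [hf .keyB (by decide), v3]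
  refine Cmd.Ok.wr_seq t (pairValue N (W t)) (by simp [hxt]) (by simp [hxt, e1, h3]) ?_
    (T := 9 * (out t).length + 18) le_rfl
  refine Cmd.Ok.wr_seq t (W t).1 (by simp [hxt]) (by simp [hxt, e2, h3]) ?_
    (T := 9 * (out t).length + 17) le_rfl
  refine Cmd.Ok.wr_seq t (W t).2 (by simp [hxt]) (by simp [hxt, e3, h3]) ?_
    (T := 9 * (out t).length + 16) le_rfl
  refine Cmd.Ok.asg_seq 0 (by simp) ?_ (T := 9 * (out t).length + 15) le_rfl
  have hd := hg.list.deg_eq t ht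
  have hlt := hout.length_lt ht
  refine Cmd.Ok.loop (N := (out t).length + 1) (fun c s =>
    (s .fl 0 = 0 ∧ (∀ i < c, ys.getD (n - 1 - i) 0 ∈ out t) ∧
      HoldsPairs (t + 1) N W (s .val') (s .keyA') (s .keyB')) ∨
    (s .fl 0 = 1 ∧ ∃ W', HoldsPairs (t + 1) N W' (s .val') (s .keyA') (s .keyB') ∧
      IsWithinPhase n out N R x W₀ W' ∧ (∀ v, t + 1 ≤ v → W' v = W₀ v) ∧
      ∀ u < t + 1, ∀ w < n, w ∉ out u → pairValue N (W₀ w) - (R * N - 1) ≤ pairValue N (W' u)))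
    (fun _ => 8) (by decide) ?_ ?_ ?_ ?_ ?_
  · simp [hxt, hf .pdeg (by decide), hd]
  · left
    refine ⟨by simp, fun i hi => absurd hi (Nat.not_lt_zero i), ?_⟩
    simpa using h1.push
  · rintro c hc s' hf' hxc hI
    rcases hI with ⟨hfl, htop, h5⟩ | ⟨hfl, h5⟩
    · have hcn : n - 1 - c < ys.length := by omega
      have hgetD : ys.getD (n - 1 - c) 0 = ys[n - 1 - c] := List.getD_eq_getElem _ _ hcn
      set w := ys[n - 1 - c] with hw
      have hwn : w < n := List.mem_range.1 (hys.mem_iff.1 (List.getElem_mem hcn))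
      obtain ⟨w1, w2, w3⟩ := hval w hwn
      have i1 : s' .n 0 = n := by
        rw [hf' .n (by decide)]; simp [hf .n (by decide), hn]
      have i2 : s' .u 0 = t := by
        rw [hf' .u (by decide)]; simp [hxt]
      have i3 : s' .srt2 (n - 1 - c) = w := by
        rw [hf' .srt2 (by decide)]
        have := hsrt _ hcn
        rw [show (((n - 1 - c : ℕ)) : ℤ) = n - 1 - c by omega] at this
        simp [hf .srt2 (by decide), this, hw]
      have i4 : s' .row t = t * n := by
        rw [hf' .row (by decide)]
        simpa [hf .row (by decide)] using hrow t (by omega)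
      have i5 : s' .padj (t * n + w) = if w ∈ out t then 1 else 0 := by
        rw [hf' .padj (by decide)]
        simpa [hf .padj (by decide)] using hg.mat t w ht hwn
      have i6 : s' .val w = pairValue N (W₀ w) := by
        rw [hf' .val (by decide)]
        simpa [hf .val (by decide)] using w1
      have i7 : s' .keyA w = (W₀ w).1 := by
        rw [hf' .keyA (by decide)]
        simpa [hf .keyA (by decide)] using w2
      have i8 : s' .keyB w = (W₀ w).2 := by
        rw [hf' .keyB (by decide)]
        simpa [hf .keyB (by decide)] using w3
      have i9 : s' .val t = pairValue N (W₀ t) := by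
        rw [hf' .val (by decide)]; simpa using e1
      have i10 : s' .ratBig 0 = R * N := by
        rw [hf' .ratBig (by decide)]; simpa [hf .ratBig (by decide)] using hratN
      have i11 : s' .rat 0 = R := by
        rw [hf' .rat (by decide)]; simpa [hf .rat (by decide)] using hrat
      by_cases hmem : w ∈ out t
      · rw [if_pos hmem] at i5
        refine Cmd.ok_of_exec (Or.inl ⟨?_, ?_, ?_⟩) ?_
        · simp [Cmd.exec, Cmd.asg, hfl, i1, i2, i3, i4, i5, hxc]
        · intro i hi
          rcases Nat.lt_succ_iff_lt_or_eq.1 hi with hi | rfl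
          · exact htop i hi
          · rwa [hgetD]
        · simpa [Cmd.exec, Cmd.asg, hfl, i1, i2, i3, i4, i5, hxc] using h5
        · simp [Cmd.cost, Cmd.exec, Cmd.asg, hfl, i1, i2, i3, i4, i5, hxc]
      · rw [if_neg hmem] at i5
        -- The vertices scanned before `w` are out-neighbours of `t`, so every other vertex that is
        -- none comes earlier in increasing order.
        have hbest : ∀ w' < n, w' ∉ out t → pairValue N (W₀ w') ≤ pairValue N (W₀ w) := by
          intro w' hw' hw'out
          obtain ⟨i, hi, rfl⟩ := List.getElem_of_mem (hys.mem_iff.2 (List.mem_range.2 hw'))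
          have hic : i ≤ n - 1 - c := by
            by_contra hlt'
            refine hw'out ?_
            have := htop (n - 1 - i) (by omega)
            rwa [show n - 1 - (n - 1 - i) = i by omega, List.getD_eq_getElem _ _ hi] at this
          rcases hic.eq_or_lt with rfl | hic
          · exact le_rfl
          · exact List.pairwise_iff_getElem.1 hsort i _ hi hcn hic
        have hpv : pairValue N ((W₀ w).1 - R, (W₀ w).2 + 1) =
            pairValue N (W₀ w) - R * N + 1 := by
          simp only [pairValue]; ring
        by_cases hgt : pairValue N (W₀ t) < pairValue N (W₀ w) - R * N + 1
        · refine Cmd.ok_of_exec (Or.inr ⟨?_, Function.update W t ((W₀ w).1 - R, (W₀ w).2 + 1),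
            ?_, ?_, ?_, ?_⟩) ?_
          · simp [Cmd.exec, Cmd.asg, hfl, i1, i2, i3, i4, i5, hxc, i6, i9, i10, hgt]
          · have := h5.update t ((W₀ w).1 - R, (W₀ w).2 + 1)
            rw [hpv] at this
            simpa [Cmd.exec, Cmd.asg, hfl, i1, i2, i3, i4, i5, hxc, i6, i7, i8, i9, i10, i11, hgt]
              using this
          · refine h2.update_nonedge hW₀ hx ht hwn hmem ?_
            rw [hpv, h3 t le_rfl]
            exact hgt
          · intro v hv
            rw [Function.update_of_ne (by omega), h3 v (by omega)]
          · intro u hu w' hw' hw'out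
            rcases Nat.lt_succ_iff_lt_or_eq.1 hu with hu | rfl
            · rw [Function.update_of_ne hu.ne]
              exact h4 u hu w' hw' hw'out
            · rw [Function.update_self, hpv]
              linarith [hbest w' hw' hw'out]
          · simp [Cmd.cost, Cmd.exec, Cmd.asg, hfl, i1, i2, i3, i4, i5, hxc, i6, i9, i10, hgt]
        · refine Cmd.ok_of_exec (Or.inr ⟨?_, W, ?_, h2, fun v hv => h3 v (by omega), ?_⟩) ?_
          · simp [Cmd.exec, Cmd.asg, hfl, i1, i2, i3, i4, i5, hxc, i6, i9, i10, hgt]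
          · simpa [Cmd.exec, Cmd.asg, hfl, i1, i2, i3, i4, i5, hxc, i6, i9, i10, hgt] using h5
          · intro u hu w' hw' hw'out
            rcases Nat.lt_succ_iff_lt_or_eq.1 hu with hu | rfl
            · exact h4 u hu w' hw' hw'out
            · rw [h3 u le_rfl]
              linarith [hbest w' hw' hw'out]
          · simp [Cmd.cost, Cmd.exec, Cmd.asg, hfl, i1, i2, i3, i4, i5, hxc, i6, i9, i10, hgt]
    · refine Cmd.ok_of_exec (Or.inr ⟨?_, ?_⟩) ?_
      · simp [Cmd.exec, hfl]
      · simpa [Cmd.exec, hfl] using h5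
      · simp [Cmd.cost, hfl]
  · rintro s' - (⟨-, htop, -⟩ | ⟨-, h5⟩)
    -- The scan cannot fail: `(out t).length + 1` different vertices would all be out-neighbours of
    -- `t`.
    · exfalso
      have h6 : (ys.drop (n - 1 - (out t).length)) ⊆ out t := by
        intro w hw
        obtain ⟨i, hi, rfl⟩ := List.getElem_of_mem hw
        rw [List.length_drop] at hi
        rw [List.getElem_drop]
        have := htop ((out t).length - i) (by omega)
        rwa [show n - 1 - ((out t).length - i) = n - 1 - (out t).length + i by omega,
          List.getD_eq_getElem _ _ (by omega)] at this
      have h7 : (ys.drop (n - 1 - (out t).length)).Nodup :=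
        (hys.nodup_iff.2 List.nodup_range).sublist (List.drop_sublist _ _)
      have h8 := (h7.subperm h6).length_le
      rw [List.length_drop] at h8
      omega
    · exact h5
  · simp; omega
  · rintro s - ⟨W, h1, h2, -, h4⟩
    exact ⟨W, h1, h2, h4⟩
  · rw [Finset.sum_add_distrib, Finset.sum_add_distrib, ← Finset.mul_sum]
    simp; omega

theorem pairValue_le_update {N : ℤ} {W : ℕ → ℤ × ℤ} {u : ℕ} {c : ℤ × ℤ}
    (h : pairValue N (W u) ≤ pairValue N c) (v : ℕ) :
    pairValue N (W v) ≤ pairValue N (Function.update W u c v) := by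
  by_cases hvu : v = u
  · subst hvu
    simpa using h
  · simp [hvu]

/-- Edges go to larger positions, so the value at `p` is final when the edges out of `p` are
relaxed, and a single pass settles all edges. The lower bounds `f` for nonadjacent pairs survive
because values only rise. -/
theorem relaxEdges_ok {n : ℕ} {out : ℕ → List ℕ} (hout : IsTopoGraph n out) {N R : ℤ} {x : ℕ}
    (hx : x < N) {W₀ W₁ : ℕ → ℤ × ℤ} (hW₁ : IsWithinPhase n out N R x W₀ W₁) {f : ℕ → ℕ → ℤ}
    (hnon : ∀ u < n, ∀ w < n, w ∉ out u → f u w ≤ pairValue N (W₁ u)) (σ : St)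
    (hn : σ .n 0 = n) (hg : IsGraph n (σ .pdeg) (σ .pnb) (σ .padj) out)
    (hrow : IsRowTable n (n + 4) (σ .row)) (hbig : σ .big 0 = N)
    (hval : HoldsPairs n N W₁ (σ .val') (σ .keyA') (σ .keyB')) :
    relaxEdges.Ok σ (fun s => ∃ W, HoldsPairs n N W (s .val') (s .keyA') (s .keyB') ∧
      IsWithinPhase n out N R x W₀ W ∧
      (∀ p < n, ∀ q ∈ out p, pairValue N (W p) + N ≤ pairValue N (W q)) ∧
      ∀ u < n, ∀ w < n, w ∉ out u → f u w ≤ pairValue N (W u))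
      (6 * ∑ p ∈ Finset.range n, (out p).length + 2 * n + 1) := by
  refine Cmd.Ok.loop (N := n) (fun t s => ∃ W, HoldsPairs n N W (s .val') (s .keyA') (s .keyB') ∧
      IsWithinPhase n out N R x W₀ W ∧
      (∀ p < t, ∀ q ∈ out p, pairValue N (W p) + N ≤ pairValue N (W q)) ∧
      ∀ u < n, ∀ w < n, w ∉ out u → f u w ≤ pairValue N (W u))
    (fun t => 6 * (out t).length + 1) (by decide) ?_ ?_ ?_ ?_ ?_
  · simp [hn]
  · exact ⟨W₁, by simpa using hval, hW₁, fun u hu => absurd hu (Nat.not_lt_zero u), hnon⟩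
  · rintro t ht s hf hxt ⟨W, h1, h2, h3, h4⟩
    refine Cmd.Ok.loop (N := (out t).length) (fun c s =>
      ∃ W, HoldsPairs n N W (s .val') (s .keyA') (s .keyB') ∧ IsWithinPhase n out N R x W₀ W ∧
      (∀ p < t, ∀ q ∈ out p, pairValue N (W p) + N ≤ pairValue N (W q)) ∧
      (∀ q ∈ (out t).take c, pairValue N (W t) + N ≤ pairValue N (W q)) ∧
      ∀ u < n, ∀ w < n, w ∉ out u → f u w ≤ pairValue N (W u)) (fun _ => 5) (by decide) ?_ ?_ ?_
      ?_ ?_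
    · simp [hxt, hf .pdeg (by decide), hg.list.deg_eq t ht]
    · exact ⟨W, by simpa using h1, h2, h3, by simp, h4⟩
    · rintro c hc s' hf' hxc ⟨W, h1, h2, h3, h5, h4⟩
      have hmem : (out t)[c] ∈ out t := List.getElem_mem hc
      have hq := hout.bound t _ hmem
      have htq := hout.lt t _ hmem
      have htk : (out t).take (c + 1) = (out t).take c ++ [(out t)[c]] := by simp
      obtain ⟨v1, v2, v3⟩ := h1 t ht
      obtain ⟨w1, w2, w3⟩ := h1 _ hq
      have i1 : s' .p 0 = t := by rw [hf' .p (by decide), hxt]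
      have i2 : s' .row t = t * n := by
        rw [hf' .row (by decide), hf .row (by decide)]
        simpa using hrow t (by omega)
      have i3 : s' .pnb (t * n + c) = (out t)[c] := by
        rw [hf' .pnb (by decide), hf .pnb (by decide)]
        simpa using hg.list.nb_eq t ht c hc
      have i4 : s' .big 0 = N := by
        rw [hf' .big (by decide), hf .big (by decide), hbig]
      have hpv : pairValue N ((W t).1 + 1, (W t).2) = pairValue N (W t) + N := by
        simp only [pairValue]; ring
      by_cases hgt : pairValue N (W (out t)[c]) < pairValue N (W t) + N
      · have hup := pairValue_le_update (N := N) (W := W) (u := (out t)[c])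
          (c := ((W t).1 + 1, (W t).2)) (by rw [hpv]; exact hgt.le)
        refine Cmd.ok_of_exec ⟨Function.update W (out t)[c] ((W t).1 + 1, (W t).2), ?_, ?_, ?_, ?_,
          ?_⟩ ?_
        · have := h1.update (out t)[c] ((W t).1 + 1, (W t).2)
          rw [hpv] at this
          simpa [Cmd.exec, Cmd.asg, i1, i2, i3, i4, hxc, v1, v2, v3, w1, hgt] using this
        · refine h2.update_edge hx ht hq hmem ?_
          rw [hpv]
          exact hgt
        · intro p hp q hq'
          rw [Function.update_of_ne (by omega)]
          exact (h3 p hp q hq').trans (hup q)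
        · intro q hq'
          rw [Function.update_of_ne htq.ne]
          rw [htk, List.mem_append, List.mem_singleton] at hq'
          rcases hq' with hq' | rfl
          · exact (h5 q hq').trans (hup q)
          · rw [Function.update_self, hpv]
        · intro u hu w hw huw
          exact (h4 u hu w hw huw).trans (hup u)
        · simp [Cmd.exec, Cmd.cost, Cmd.asg, i1, i2, i3, i4, hxc, v1, w1, hgt]
      · refine Cmd.ok_of_exec ⟨W, ?_, h2, h3, ?_, h4⟩ ?_
        · simpa [Cmd.exec, Cmd.asg, i1, i2, i3, i4, hxc, v1, w1, hgt] using h1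
        · intro q hq'
          rw [htk, List.mem_append, List.mem_singleton] at hq'
          rcases hq' with hq' | rfl
          · exact h5 q hq'
          · exact not_lt.1 hgt
        · simp [Cmd.exec, Cmd.cost, Cmd.asg, i1, i2, i3, i4, hxc, v1, w1, hgt]
    · rintro s' - ⟨W, h1, h2, h3, h5, h4⟩
      refine ⟨W, by simpa using h1, h2, fun p hp q hq => ?_, h4⟩
      rcases Nat.lt_succ_iff_lt_or_eq.1 hp with hp | rfl
      · exact h3 p hp q hq
      · exact h5 q (by simpa using hq)
    · simp; omega
  · exact fun s _ h => h
  · rw [Finset.sum_add_distrib, Finset.sum_add_distrib, ← Finset.mul_sum]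
    simp; omega

/-- `chg` tells whether the phase had any effect. `bad` is set when a first component reaches `n`:
this rules out a solution, and before that the components are valid keys for the bucket sort. -/
theorem copyBack_ok {n : ℕ} {N : ℤ} {W₀ W : ℕ → ℤ × ℤ} (σ : St)
    (hle : ∀ v < n, pairValue N (W₀ v) ≤ pairValue N (W v))
    (hn : σ .n 0 = n) (hbad : σ .bad 0 = 0)
    (hval : HoldsPairs n N W₀ (σ .val) (σ .keyA) (σ .keyB))
    (hval' : HoldsPairs n N W (σ .val') (σ .keyA') (σ .keyB')) :
    copyBack.Ok σ (fun s => HoldsPairs n N W (s .val) (s .keyA) (s .keyB) ∧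
      (s .chg 0 = 0 ∧ (∀ v < n, pairValue N (W v) = pairValue N (W₀ v)) ∨
        s .chg 0 = 1 ∧ ∃ v < n, pairValue N (W₀ v) < pairValue N (W v)) ∧
      (s .bad 0 = 0 ∧ (∀ v < n, (W v).1 < n) ∨ s .bad 0 = 1 ∧ ∃ v < n, n ≤ (W v).1))
      (8 * n + 2) := by
  refine Cmd.Ok.asg_seq 0 (by simp) ?_ (T := 8 * n + 1) le_rfl
  refine Cmd.Ok.loop (N := n) (fun t s => HoldsPairs t N W (s .val) (s .keyA) (s .keyB) ∧
      (∀ v : ℕ, t ≤ v → v < n → s .val v = pairValue N (W₀ v)) ∧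
      (s .chg 0 = 0 ∧ (∀ v < t, pairValue N (W v) = pairValue N (W₀ v)) ∨
        s .chg 0 = 1 ∧ ∃ v < n, pairValue N (W₀ v) < pairValue N (W v)) ∧
      (s .bad 0 = 0 ∧ (∀ v < t, (W v).1 < n) ∨ s .bad 0 = 1 ∧ ∃ v < n, n ≤ (W v).1))
    (fun _ => 7) (by decide) ?_ ?_ ?_ ?_ ?_
  · simp [hn]
  · refine ⟨fun v hv => absurd hv (Nat.not_lt_zero v), fun v _ hv => ?_, Or.inl ?_, Or.inl ?_⟩
    · simpa using (hval v hv).1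
    · simp
    · simp [hbad]
  · rintro t ht s hf hxt ⟨h1, h2, h3, h4⟩
    have e1 : s .val' t = pairValue N (W t) := by
      rw [hf .val' (by decide)]; simpa using (hval' t ht).1
    have e2 : s .keyA' t = (W t).1 := by
      rw [hf .keyA' (by decide)]; simpa using (hval' t ht).2.1
    have e3 : s .keyB' t = (W t).2 := by
      rw [hf .keyB' (by decide)]; simpa using (hval' t ht).2.2
    have e4 : s .n 0 = n := by rw [hf .n (by decide)]; simpa using hn
    refine Cmd.Ok.seq (c := .ite _ (.asg .chg 1) .skip) (T := 2) (T' := 5)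
      (Q := fun s => (s .chg 0 = 0 ∧ (∀ v < t + 1, pairValue N (W v) = pairValue N (W₀ v)) ∨
        s .chg 0 = 1 ∧ ∃ v < n, pairValue N (W₀ v) < pairValue N (W v))) ?_ ?_ (by norm_num)
    · refine Cmd.Ok.ite (T := 1) (fun h => ?_) (fun h => ?_) le_rfl
      · simp only [Ex.eval_sub, Ex.eval_arr, Ex.eval_lit, hxt, e1, h2 t le_rfl ht] at h
        exact Cmd.Ok.asg (Or.inr ⟨by simp, t, ht, by omega⟩) le_rfl
      · simp only [Ex.eval_sub, Ex.eval_arr, Ex.eval_lit, hxt, e1, h2 t le_rfl ht] at h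
        refine Cmd.Ok.skip ?_ le_rfl
        rcases h3 with ⟨h3, h5⟩ | h3
        · refine Or.inl ⟨h3, fun v hv => ?_⟩
          rcases Nat.lt_succ_iff_lt_or_eq.1 hv with hv | rfl
          · exact h5 v hv
          · have := hle v ht
            omega
        · exact Or.inr h3
    intro s₁ hf₁ h3'
    have hb : ∀ r, r ≠ .chg → s₁ r = s r := fun r hr => hf₁ r (by simpa [Cmd.writes, Cmd.asg] using hr)
    refine Cmd.Ok.wr_seq t (pairValue N (W t)) (by simp [hb, hxt]) (by simp [hb, hxt, e1]) ?_
      (T := 4) le_rfl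
    refine Cmd.Ok.wr_seq t (W t).1 (by simp [hb, hxt]) (by simp [hb, hxt, e2]) ?_ (T := 3) le_rfl
    refine Cmd.Ok.wr_seq t (W t).2 (by simp [hb, hxt]) (by simp [hb, hxt, e3]) ?_ (T := 2) le_rfl
    have hp := h1.push
    have hrest : ∀ v : ℕ, t + 1 ≤ v → v < n →
        Function.update (s .val) (t : ℤ) (pairValue N (W t)) v = pairValue N (W₀ v) := by
      intro v hv hvn
      rw [Function.update_of_ne (by omega), h2 v (by omega) hvn]
    refine Cmd.Ok.ite (T := 1) (fun h => ?_) (fun h => ?_) le_rfl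
    · simp [hb, hxt, e4] at h
      refine Cmd.Ok.asg ⟨by simpa [hb] using hp, by simpa [hb] using hrest, by simpa using h3',
        Or.inr ⟨by simp, t, ht, by omega⟩⟩ le_rfl
    · simp [hb, hxt, e4] at h
      refine Cmd.Ok.skip ⟨by simpa [hb] using hp, by simpa [hb] using hrest, by simpa using h3',
        ?_⟩ le_rfl
      rcases h4 with ⟨h4, h5⟩ | ⟨h4, h5⟩
      · refine Or.inl ⟨by simpa [hb] using h4, fun v hv => ?_⟩
        rcases Nat.lt_succ_iff_lt_or_eq.1 hv with hv | rfl
        · exact h5 v hv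
        · omega
      · exact Or.inr ⟨by simpa [hb] using h4, h5⟩
  · rintro s - ⟨h1, -, h3, h4⟩
    exact ⟨h1, h3, h4⟩
  · simp; omega

/-- The thresholds `N` and `R N - 1` are met. -/
structure IsSolved (n : ℕ) (out : ℕ → List ℕ) (N R : ℤ) (W : ℕ → ℤ × ℤ) : Prop where
  edge : ∀ p < n, ∀ q ∈ out p, pairValue N (W p) + N ≤ pairValue N (W q)
  nonedge : ∀ u < n, ∀ w < n, w ∉ out u → pairValue N (W w) - (R * N - 1) ≤ pairValue N (W u)

/-- The memory after `x` phases. -/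
def IsTestState (n : ℕ) (out : ℕ → List ℕ) (N R : ℤ) (x : ℕ) (s : St) : Prop :=
  (s .bad 0 = 1 ∧ 0 ≤ s .chg 0 ∧ ∀ β, ¬ IsPotential n out R β) ∨
  (s .bad 0 = 0 ∧ ∃ W, HoldsPairs n N W (s .val) (s .keyA) (s .keyB) ∧ IsPhase n out N R x W ∧
    (∀ v < n, (W v).1 < n) ∧
    (s .chg 0 = 0 ∧ IsSolved n out N R W ∨ s .chg 0 = 1 ∧ (x = 0 ∨ ∃ v < n, (W v).2 + 1 = x)))

theorem phase_ok {n : ℕ} {out : ℕ → List ℕ} (hout : IsTopoGraph n out) {N R : ℤ} {x : ℕ}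
    (hN : n ≤ N) (hR : 1 ≤ R) (hxn : x < n) (σ : St) (hn : σ .n 0 = n)
    (hg : IsGraph n (σ .pdeg) (σ .pnb) (σ .padj) out)
    (hrow : IsRowTable n (n + 4) (σ .row)) (hbig : σ .big 0 = N) (hrat : σ .rat 0 = R)
    (hratN : σ .ratBig 0 = R * N) (hσ : IsTestState n out N R x σ) :
    phase.Ok σ (IsTestState n out N R (x + 1))
      (15 * ∑ p ∈ Finset.range n, (out p).length + 60 * n + 15) := by
  have hx : x < N := by omega
  rcases hσ with ⟨hbad, hσ⟩ | ⟨hbad, W₀, hval, hW₀, hA, -⟩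
  · exact Cmd.Ok.ite (T := 1) (fun _ => Cmd.Ok.skip (Or.inl ⟨hbad, hσ⟩) le_rfl)
      (fun h => absurd h (by simp [hbad])) (by omega)
  refine Cmd.Ok.ite (T := 15 * ∑ p ∈ Finset.range n, (out p).length + 60 * n + 14)
    (fun h => absurd h (by simp [hbad])) (fun _ => ?_) (by omega)
  have hA0 : ∀ v < n, 0 ≤ (W₀ v).1 := fun v hv => hW₀.fst_nonneg hx hv
  refine Cmd.Ok.seq (sortByKeys_ok n (fun v => (W₀ v).1.toNat) (fun v => (W₀ v).2.toNat)
    ?_ ?_ σ hn hrow ?_ ?_) (T' := 15 * ∑ p ∈ Finset.range n, (out p).length + 30 * n + 4) ?_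
    (by omega)
  · intro v hv
    have := hA v hv
    have := hA0 v hv
    omega
  · intro v hv
    have := hW₀.snd_nonneg v hv
    have := hW₀.snd_le v hv
    omega
  · intro v hv
    rw [(hval v hv).2.1, Int.toNat_of_nonneg (hA0 v hv)]
  · intro v hv
    rw [(hval v hv).2.2, Int.toNat_of_nonneg (hW₀.snd_nonneg v hv)]
  rintro s₁ hf₁ ⟨ys, hys, hsort, hsrt⟩
  have hval₁ : HoldsPairs n N W₀ (s₁ .val) (s₁ .keyA) (s₁ .keyB) := by
    rwa [hf₁ .val (by decide), hf₁ .keyA (by decide), hf₁ .keyB (by decide)]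
  have hg₁ : IsGraph n (s₁ .pdeg) (s₁ .pnb) (s₁ .padj) out := by
    rwa [hf₁ .pdeg (by decide), hf₁ .pnb (by decide), hf₁ .padj (by decide)]
  refine Cmd.Ok.seq (relaxNonedges_ok hout hx hW₀ hys ?_ s₁ (by rwa [hf₁ .n (by decide)]) hg₁
    (by rwa [hf₁ .row (by decide)]) (by rwa [hf₁ .rat (by decide)])
    (by rwa [hf₁ .ratBig (by decide)]) hsrt hval₁)
    (T' := 6 * ∑ p ∈ Finset.range n, (out p).length + 10 * n + 3) ?_ (by omega)
  · refine hsort.imp_of_mem ?_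
    intro v w hv hw hvw
    have hv := List.mem_range.1 (hys.mem_iff.1 hv)
    have hw := List.mem_range.1 (hys.mem_iff.1 hw)
    have a1 := hA0 v hv
    have a2 := hA0 w hw
    have b1 := hW₀.snd_nonneg v hv
    have b2 := hW₀.snd_nonneg w hw
    have b3 := hW₀.snd_le v hv
    rw [pairValue, pairValue]
    rcases hvw with h | ⟨h, h'⟩
    · have : (W₀ v).1 + 1 ≤ (W₀ w).1 := by omega
      nlinarith
    · have h1 : (W₀ v).1 = (W₀ w).1 := by omega
      have h2 : (W₀ v).2 ≤ (W₀ w).2 := by omega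
      rw [h1]
      omega
  rintro s₂ hf₂ ⟨W₁, h1, h2, h3⟩
  refine Cmd.Ok.seq (relaxEdges_ok hout hx h2 h3 s₂
    (by rwa [hf₂ .n (by decide), hf₁ .n (by decide)])
    (by rwa [hf₂ .pdeg (by decide), hf₂ .pnb (by decide), hf₂ .padj (by decide)])
    (by rwa [hf₂ .row (by decide), hf₁ .row (by decide)])
    (by rwa [hf₂ .big (by decide), hf₁ .big (by decide)]) h1) (T' := 8 * n + 2) ?_ (by omega)
  rintro s₃ hf₃ ⟨W, h4, h5, h6, h7⟩
  have hval₃ : HoldsPairs n N W₀ (s₃ .val) (s₃ .keyA) (s₃ .keyB) := by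
    rwa [hf₃ .val (by decide), hf₃ .keyA (by decide), hf₃ .keyB (by decide), hf₂ .val (by decide),
      hf₂ .keyA (by decide), hf₂ .keyB (by decide)]
  refine (copyBack_ok s₃ h5.le (by rwa [hf₃ .n (by decide), hf₂ .n (by decide),
    hf₁ .n (by decide)]) (by rwa [hf₃ .bad (by decide), hf₂ .bad (by decide),
    hf₁ .bad (by decide)]) hval₃ h4).mono ?_ le_rfl
  rintro s₄ - ⟨h8, h9, h10⟩
  have hph := h5.isPhase hW₀.nonneg h6 h7
  rcases h10 with ⟨hb, h10⟩ | ⟨hb, v, hv, hvn⟩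
  · refine Or.inr ⟨hb, W, h8, hph, h10, ?_⟩
    rcases h9 with ⟨hc, h9⟩ | ⟨hc, v, hv, h9⟩
    -- Nothing has risen, so the bounds that refer to the old values `W₀` are the required
    -- conditions on `W`.
    · refine Or.inl ⟨hc, h6, fun u hu w hw huw => ?_⟩
      rw [h9 w hw]
      exact h7 u hu w hw huw
    · refine Or.inr ⟨hc, Or.inr ⟨v, hv, ?_⟩⟩
      rw [h5.changed v hv h9]
      push_cast
      rfl
  -- For a potential `β`, a first component of at least `n` would have more than `n` distinct
  -- witnesses.
  · refine Or.inl ⟨hb, by rcases h9 with h9 | h9 <;> omega, fun β hβ => ?_⟩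
    have := (hph.traced β hβ v hv).le
    have := hph.snd_nonneg v hv
    nlinarith

/-! ### The search for the ratio -/

section Programs

open Reg Cmd

/-- Compute the number of phases. -/
def setPhases : Cmd :=
  asg phases 1 ;; asg acc 0 ;;
  loop x lim3 n (ite (n - acc) (asg acc (acc + rat + 1) ;; asg phases (phases + 1)) skip)

/-- Start with the utility `0` everywhere. -/
def resetUtility : Cmd :=
  asg bad 0 ;; asg chg 1 ;; loop x lim3 n (wr val x 0 ;; wr keyA x 0 ;; wr keyB x 0)

/-- Test whether there is a utility function for a ratio less than `rat`. -/
def testRatio : Cmd := setPhases ;; resetUtility ;; loop t lim2 phases phase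

/-- Find the smallest multiple of `i` that passes the test. -/
def searchRatio : Cmd :=
  asg rat i ;; asg iBig 0 ;; loop x lim3 i (asg iBig (iBig + big)) ;; asg ratBig iBig ;;
  asg fnd 0 ;;
  loop j lim1 n (ite fnd skip (
    asg rat (rat + i) ;; asg ratBig (ratBig + iBig) ;; testRatio ;;
    ite (bad + chg) skip (asg fnd 1 ;; asg k (j + 1))))

/-- Find the ratio, and store the utilities and the minimum utility difference. -/
def computeUtility : Cmd := searchRatio ;; asg d iBig ;; loop p lim3 n (wr al p (val # p))

/-- Read the header of the input of the second part. -/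
def readGraphHeader : Cmd := asg n (inp # 0) ;; asg m (inp # 1) ;; asg i (inp # 2) ;; asg eb 3

/-- Find a clique without utilities that are given. -/
def graphClique : Cmd := readGraphHeader ;; prepare ;; computeUtility ;; findClique

end Programs

/-- The number `a` is `n / (R + 1)` rounded up, found by repeated addition. One more phase is run
because the first one, which has second component `0`, relaxes only edges in effect. -/
theorem setPhases_ok {n R : ℕ} (hn2 : 2 ≤ n) (hR : 2 ≤ R) (σ : St) (hn : σ .n 0 = n)
    (hrat : σ .rat 0 = R) :
    setPhases.Ok σ (fun s => ∃ a : ℕ, s .phases 0 = (a + 1 : ℕ) ∧ n ≤ a * (R + 1) ∧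
      (a - 1) * (R + 1) < n ∧ a + 1 ≤ n) (4 * n + 3) := by
  refine Cmd.Ok.asg_seq 1 (by simp) ?_ (T := 4 * n + 2) le_rfl
  refine Cmd.Ok.asg_seq 0 (by simp) ?_ (T := 4 * n + 1) le_rfl
  refine Cmd.Ok.loop (N := n) (fun t s => ∃ a : ℕ, s .phases 0 = (a + 1 : ℕ) ∧
    s .acc 0 = (a * (R + 1) : ℕ) ∧ (a = t ∨ n ≤ a * (R + 1)) ∧ (a - 1) * (R + 1) < n)
    (fun _ => 3) (by decide) ?_ ?_ ?_ ?_ ?_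
  · simp [hn]
  · exact ⟨0, by simp, by simp, Or.inl rfl, by simp; omega⟩
  · rintro t ht s hf hx ⟨a, h1, h2, h3, h4⟩
    have e1 : s .n 0 = n := by rw [hf .n (by decide)]; simpa using hn
    have e2 : s .rat 0 = R := by rw [hf .rat (by decide)]; simpa using hrat
    refine Cmd.Ok.ite (T := 2) (fun h => ?_) (fun h => ?_) le_rfl
    · simp only [Ex.eval_sub, Ex.eval_arr, Ex.eval_lit, e1, h2] at h
      refine Cmd.ok_of_exec ⟨a + 1, ?_, ?_, Or.inl ?_, ?_⟩ (by simp [Cmd.cost, Cmd.asg])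
      · simp [Cmd.exec, Cmd.asg, h1]
      · simp [Cmd.exec, Cmd.asg, h2, e2]
        ring
      · omega
      · rw [Nat.add_sub_cancel]
        omega
    · simp only [Ex.eval_sub, Ex.eval_arr, Ex.eval_lit, e1, h2] at h
      exact Cmd.Ok.skip ⟨a, by simp [h1], by simp [h2], Or.inr (by omega), h4⟩ (by norm_num)
  · rintro s - ⟨a, h1, -, h3, h4⟩
    refine ⟨a, h1, ?_, h4, ?_⟩
    · rcases h3 with rfl | h3
      · exact Nat.le_mul_of_pos_right _ (Nat.succ_pos R)
      · exact h3
    -- From `R + 1 ≥ 3` and `n ≥ 2` it follows that there are at most `n` phases, so second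
    -- components stay below `n` and are valid sorting keys.
    · have : (a - 1) * 3 ≤ (a - 1) * (R + 1) := Nat.mul_le_mul_left _ (by omega)
      omega
  · simp; omega

theorem resetUtility_ok {n : ℕ} {out : ℕ → List ℕ} {N R : ℤ} (hn1 : 1 ≤ n) (hRN : 1 ≤ R * N) (σ : St)
    (hn : σ .n 0 = n) : resetUtility.Ok σ (IsTestState n out N R 0) (4 * n + 3) := by
  refine Cmd.Ok.asg_seq 0 (by simp) ?_ (T := 4 * n + 2) le_rfl
  refine Cmd.Ok.asg_seq 1 (by simp) ?_ (T := 4 * n + 1) le_rfl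
  refine Cmd.Ok.loop (N := n) (fun t s => HoldsPairs t N (fun _ => (0, 0))
    (s .val) (s .keyA) (s .keyB)) (fun _ => 3) (by decide) ?_ ?_ ?_ ?_ ?_
  · simp [hn]
  · exact fun v hv => absurd hv (Nat.not_lt_zero v)
  · intro t ht s hf hx h
    refine Cmd.ok_of_exec ?_ (by simp [Cmd.cost])
    simpa [Cmd.exec, hx, pairValue] using h.push
  · intro s hf h
    refine Or.inr ⟨by simp [hf .bad (by decide)], _, h, isPhase_zero hRN, ?_, Or.inr
      ⟨by simp [hf .chg (by decide)], Or.inl rfl⟩⟩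
    intro v hv
    simp only
    omega
  · simp; omega

/-- Divide by `N`. The integral slack of `1` in `R N - 1` becomes the strict inequality. -/
theorem IsSolved.isPotential {n : ℕ} {out : ℕ → List ℕ} {N R : ℤ} {W : ℕ → ℤ × ℤ}
    (h : IsSolved n out N R W) (hN : 0 < N) :
    IsPotential n out R fun v => (pairValue N (W v) : ℝ) / N := by
  have hN' : (0 : ℝ) < N := by exact_mod_cast hN
  refine ⟨fun p hp q hq => ?_, fun u hu w hw huw => ?_⟩
  · have : (pairValue N (W p) : ℝ) + N ≤ pairValue N (W q) := by exact_mod_cast h.edge p hp q hq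
    rw [← div_self hN'.ne', ← add_div]
    exact div_le_div_of_nonneg_right this hN'.le
  · have : (pairValue N (W w) : ℝ) - (R * N - 1) ≤ pairValue N (W u) := by
      exact_mod_cast h.nonedge u hu w hw huw
    rw [← sub_div, div_lt_iff₀ hN']
    linarith

theorem testRatio_ok {n i R : ℕ} {out : ℕ → List ℕ} (hout : IsTopoGraph n out) {N : ℤ} (hn2 : 2 ≤ n)
    (hN : n < N) (hi : 1 ≤ i) (hR : 2 * i ≤ R) (σ : St) (hn : σ .n 0 = n)
    (hg : IsGraph n (σ .pdeg) (σ .pnb) (σ .padj) out)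
    (hrow : IsRowTable n (n + 4) (σ .row)) (hbig : σ .big 0 = N) (hrat : σ .rat 0 = R)
    (hratN : σ .ratBig 0 = R * N) :
    testRatio.Ok σ (fun s => (s .bad 0 + s .chg 0 ≤ 0 ∧ ∃ W,
        HoldsPairs n N W (s .val) (s .keyA) (s .keyB) ∧ IsSolved n out N R W) ∨
      (0 < s .bad 0 + s .chg 0 ∧ ∀ β, ¬ IsPotential n out R β))
      ((n / (2 * i + 1) + 2) * (15 * ∑ p ∈ Finset.range n, (out p).length + 75 * n + 16)) := by
  set P := n / (2 * i + 1) + 2 with hP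
  set S := ∑ p ∈ Finset.range n, (out p).length with hS
  have hP2 : 2 ≤ P := Nat.le_add_left _ _
  refine Cmd.Ok.seq (setPhases_ok hn2 (by omega) σ hn hrat)
    (T' := P * (15 * S + 60 * n + 16) + 4 * n + 4) ?_ (by nlinarith)
  rintro s₁ hf₁ ⟨a, ha, ha1, ha2, ha3⟩
  have haP : a + 1 ≤ P := by
    have h1 : (a - 1) * (2 * i + 1) ≤ (a - 1) * (R + 1) := Nat.mul_le_mul_left _ (by omega)
    have h2 : a - 1 ≤ n / (2 * i + 1) := (Nat.le_div_iff_mul_le (by omega)).2 (by omega)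
    omega
  have hRN : (1 : ℤ) ≤ (R : ℤ) * N := by
    have : (1 : ℤ) ≤ R := by omega
    nlinarith
  refine Cmd.Ok.seq (resetUtility_ok (n := n) (out := out) (by omega) hRN s₁
    (by rwa [hf₁ .n (by decide)])) (T' := P * (15 * S + 60 * n + 16) + 1) ?_ (by omega)
  intro s₂ hf₂ h₂
  have hfr : ∀ s : St, (∀ r ∉ (Cmd.loop .t .lim2 (Reg.phases : Ex) phase).writes, s r = s₂ r) →
      s .n 0 = n ∧ IsGraph n (s .pdeg) (s .pnb) (s .padj) out ∧ IsRowTable n (n + 4) (s .row) ∧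
      s .big 0 = N ∧ s .rat 0 = R ∧ s .ratBig 0 = R * N := by
    intro s hf
    refine ⟨?_, ?_, ?_, ?_, ?_, ?_⟩
    · rwa [hf .n (by decide), hf₂ .n (by decide), hf₁ .n (by decide)]
    · rwa [hf .pdeg (by decide), hf₂ .pdeg (by decide), hf₁ .pdeg (by decide),
        hf .pnb (by decide), hf₂ .pnb (by decide), hf₁ .pnb (by decide),
        hf .padj (by decide), hf₂ .padj (by decide), hf₁ .padj (by decide)]
    · rwa [hf .row (by decide), hf₂ .row (by decide), hf₁ .row (by decide)]
    · rwa [hf .big (by decide), hf₂ .big (by decide), hf₁ .big (by decide)]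
    · rwa [hf .rat (by decide), hf₂ .rat (by decide), hf₁ .rat (by decide)]
    · rwa [hf .ratBig (by decide), hf₂ .ratBig (by decide), hf₁ .ratBig (by decide)]
  refine Cmd.Ok.loop (N := a + 1) (fun t s => IsTestState n out N R t s)
    (fun _ => 15 * S + 60 * n + 15) (by decide) ?_ ?_ ?_ ?_ ?_
  · simp [hf₂ .phases (by decide), ha]
  · simpa [IsTestState] using h₂
  · intro t ht s hf hx h
    obtain ⟨f1, f2, f3, f4, f5, f6⟩ := hfr s hf
    refine (phase_ok hout hN.le (by omega) (by omega) s f1 f2 f3 f4 f5 f6 h).mono ?_ le_rfl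
    intro s' _ h'
    simpa [IsTestState] using h'
  · rintro s - (⟨hb, hc, h⟩ | ⟨hb, W, h1, h2, -, ⟨hc, h3⟩ | ⟨hc, h3⟩⟩)
    · exact Or.inr ⟨by omega, h⟩
    · exact Or.inl ⟨by omega, W, h1, h3⟩
    -- A value that has risen in the last phase has second component `a`. For a potential it would
    -- have at least `a (R + 1) + 1 > n` distinct witnesses.
    · refine Or.inr ⟨by omega, fun β hβ => ?_⟩
      rcases h3 with h3 | ⟨v, hv, h3⟩
      · omega
      · have h4 := (h2.traced β hβ v hv).le
        have h5 := h2.fst_nonneg (by omega) hv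
        have h6 : (W v).2 = a := by
          push_cast at h3
          omega
        rw [h6] at h4
        have : (n : ℤ) ≤ a * (R + 1) := by exact_mod_cast ha1
        omega
  · simp only [Finset.sum_const, Finset.card_range, smul_eq_mul]
    exact Nat.add_le_add_right (Nat.mul_le_mul_right (15 * S + 60 * n + 16) haP) 1

/-- Round `j` tests the ratio `(j + 2) i`; the ratio `i` is skipped, being excluded by `hlow`. By
`hlow` and `hhigh` the first success is in round `K - 1`. The remaining rounds of the bounded loop
are idle, so only `K` tests are paid. -/
theorem searchRatio_ok {n i K : ℕ} {out : ℕ → List ℕ} (hout : IsTopoGraph n out) {N : ℤ}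
    (hn2 : 2 ≤ n) (hN : N = n + 4) (hi : 1 ≤ i) (hin : i ≤ n) (hK1 : 1 ≤ K) (hKn : K ≤ n)
    (hlow : ∀ R : ℕ, R ≤ K * i → ∀ β, ¬ IsPotential n out R β)
    (hhigh : ∃ β, IsPotential n out ((K + 1) * i : ℕ) β) (σ : St) (hn : σ .n 0 = n)
    (hiσ : σ .i 0 = i) (hg : IsGraph n (σ .pdeg) (σ .pnb) (σ .padj) out)
    (hrow : IsRowTable n (n + 4) (σ .row)) (hbig : σ .big 0 = N) :
    searchRatio.Ok σ (fun s => s .k 0 = K ∧ s .iBig 0 = i * N ∧ ∃ W,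
        HoldsPairs n N W (s .val) (s .keyA) (s .keyB) ∧ IsSolved n out N ((K + 1) * i : ℕ) W)
      (K * ((n / (2 * i + 1) + 2) * (15 * ∑ p ∈ Finset.range n, (out p).length + 75 * n + 16) + 6) +
        6 * n + 8) := by
  set X := (n / (2 * i + 1) + 2) * (15 * ∑ p ∈ Finset.range n, (out p).length + 75 * n + 16) with hX
  refine Cmd.Ok.asg_seq i (by simp [hiσ]) ?_ (T := K * (X + 6) + 6 * n + 7) le_rfl
  refine Cmd.Ok.asg_seq 0 (by simp) ?_ (T := K * (X + 6) + 6 * n + 6) le_rfl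
  refine Cmd.Ok.seq (Q := fun s => s .iBig 0 = i * N) (T := 2 * n + 1)
    (T' := K * (X + 6) + 3 * n + 4)
    (Cmd.Ok.loop (N := i) (fun t s => s .iBig 0 = t * N) (fun _ => 1) (by decide) ?_ ?_ ?_ ?_ ?_) ?_
    (by omega)
  · simp [hiσ]
  · simp
  · intro t ht s hf hx h
    refine Cmd.ok_of_exec ?_ (by simp [Cmd.cost, Cmd.asg])
    have : s .big 0 = N := by rw [hf .big (by decide)]; simpa
    simp [Cmd.exec, Cmd.asg, h, this]
    ring
  · exact fun s _ h => h
  · simp; omega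
  intro s₁ hf₁ hib
  refine Cmd.Ok.asg_seq (i * N) (by simp [hib]) ?_ (T := K * (X + 6) + 3 * n + 3) le_rfl
  refine Cmd.Ok.asg_seq 0 (by simp) ?_ (T := K * (X + 6) + 3 * n + 2) le_rfl
  refine Cmd.Ok.loop (N := n) (fun j s =>
    (s .fnd 0 = 0 ∧ j < K ∧ s .rat 0 = ((j + 1) * i : ℕ) ∧ s .ratBig 0 = ((j + 1) * i : ℕ) * N) ∨
    (s .fnd 0 = 1 ∧ K ≤ j ∧ s .k 0 = K ∧ ∃ W,
        HoldsPairs n N W (s .val) (s .keyA) (s .keyB) ∧ IsSolved n out N ((K + 1) * i : ℕ) W))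
    (fun j => if j < K then X + 6 else 2) (by decide) ?_ ?_ ?_ ?_ ?_
  · simp [hf₁ .n (by decide), hn]
  · exact Or.inl ⟨by simp, by omega, by simp [hf₁ .rat (by decide)], by simp⟩
  · rintro j hj s hf hx (⟨h1, h2, h3, h4⟩ | ⟨h1, h2, h3, h4⟩)
    · rw [if_pos h2]
      have e1 : s .i 0 = i := by
        rw [hf .i (by decide)]; simp [hf₁ .i (by decide), hiσ]
      have e2 : s .iBig 0 = i * N := by
        rw [hf .iBig (by decide)]; simpa using hib
      have e3 : s .n 0 = n := by
        rw [hf .n (by decide)]; simp [hf₁ .n (by decide), hn]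
      have e4 : s .big 0 = N := by
        rw [hf .big (by decide)]; simp [hf₁ .big (by decide), hbig]
      have e5 : s .row = σ .row := by
        rw [hf .row (by decide)]; simp [hf₁ .row (by decide)]
      have e6 : s .pdeg = σ .pdeg := by
        rw [hf .pdeg (by decide)]; simp [hf₁ .pdeg (by decide)]
      have e7 : s .pnb = σ .pnb := by
        rw [hf .pnb (by decide)]; simp [hf₁ .pnb (by decide)]
      have e8 : s .padj = σ .padj := by
        rw [hf .padj (by decide)]; simp [hf₁ .padj (by decide)]
      refine Cmd.Ok.ite (T := X + 5) (fun h => absurd h (by simp [h1])) (fun _ => ?_) le_rfl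
      refine Cmd.Ok.asg_seq (((j + 2) * i : ℕ) : ℤ) (by simp [h3, e1]; ring) ?_ (T := X + 4) le_rfl
      refine Cmd.Ok.asg_seq (((j + 2) * i : ℕ) * N) (by simp [h4, e2]; ring) ?_ (T := X + 3) le_rfl
      refine Cmd.Ok.seq (testRatio_ok (n := n) (i := i) (R := (j + 2) * i) hout (N := N) hn2
        (by omega) hi (Nat.mul_le_mul_right i (by omega)) _ (by simp [e3]) ?_ ?_ (by simp [e4])
        (by simp) (by simp)) (T' := 3) ?_ le_rfl
      · simpa [e6, e7, e8] using hg
      · simpa [e5] using hrow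
      intro s₂ hf₂ h5
      have f1 : s₂ .j 0 = j := by rw [hf₂ .j (by decide)]; simp [hx]
      have f2 : s₂ .rat 0 = ((j + 2) * i : ℕ) := by rw [hf₂ .rat (by decide)]; simp
      have f3 : s₂ .ratBig 0 = ((j + 2) * i : ℕ) * N := by rw [hf₂ .ratBig (by decide)]; simp
      have f4 : s₂ .fnd 0 = 0 := by rw [hf₂ .fnd (by decide)]; simp [h1]
      rcases h5 with ⟨h5, W, h6, h7⟩ | ⟨h5, h6⟩
      · have hjK : j + 1 = K := by
          by_contra hne
          refine hlow ((j + 2) * i) (Nat.mul_le_mul_right i (by omega)) _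
            (h7.isPotential (by omega))
        refine Cmd.Ok.ite (T := 2) (fun h => ?_) (fun _ => ?_) le_rfl
        · simp only [Ex.eval_add, Ex.eval_arr, Ex.eval_lit] at h
          omega
        · refine Cmd.ok_of_exec (Or.inr ⟨?_, hjK.ge, ?_, W, ?_, ?_⟩) (by simp [Cmd.cost, Cmd.asg])
          · simp [Cmd.exec, Cmd.asg]
          · simp [Cmd.exec, Cmd.asg, f1, ← hjK]
          · simpa [Cmd.exec, Cmd.asg] using h6
          · rw [← hjK]
            exact h7
      · have hjK : j + 1 < K := by
          rcases Nat.lt_or_ge (j + 1) K with h | h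
          · exact h
          · obtain ⟨β, hβ⟩ := hhigh
            have : j + 1 = K := by omega
            exact absurd (by rw [← this] at hβ; exact hβ) (h6 β)
        refine Cmd.Ok.ite (T := 2) (fun _ => ?_) (fun h => ?_) le_rfl
        · exact Cmd.Ok.skip (Or.inl ⟨by simpa using f4, hjK, by simpa [add_assoc] using f2, by simpa [add_assoc] using f3⟩)
            (by norm_num)
        · simp only [Ex.eval_add, Ex.eval_arr, Ex.eval_lit] at h
          omega
    · rw [if_neg (by omega)]
      refine Cmd.Ok.ite (T := 1) (fun _ => ?_) (fun h => absurd h (by simp [h1])) le_rfl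
      exact Cmd.Ok.skip (Or.inr ⟨by simpa using h1, by omega, by simpa using h3, by simpa using h4⟩)
        le_rfl
  · rintro s hf (⟨-, h2, -⟩ | ⟨-, -, h3, h4⟩)
    · omega
    · exact ⟨h3, by rw [hf .iBig (by decide)]; simpa using hib, h4⟩
  · obtain ⟨r, rfl⟩ := Nat.exists_eq_add_of_le hKn
    rw [Finset.sum_range_add]
    have h1 : ∀ j ∈ Finset.range K, (if j < K then X + 6 else 2) + 1 = X + 7 := by
      intro j hj
      rw [if_pos (Finset.mem_range.1 hj)]
    rw [Finset.sum_congr rfl h1]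
    simp
    ring_nf
    omega

/-- The ratio need not be optimal: the window property and the factor `i` only use differences of at
least `N` on edges and of less than `(K + 1) i N` on nonadjacent pairs. -/
theorem computeUtility_ok {n i K : ℕ} {out : ℕ → List ℕ} (hout : IsTopoGraph n out) {N : ℤ}
    (hn2 : 2 ≤ n) (hN : N = n + 4) (hi : 1 ≤ i) (hin : i ≤ n) (hK1 : 1 ≤ K) (hKn : K ≤ n)
    (hlow : ∀ R : ℕ, R ≤ K * i → ∀ β, ¬ IsPotential n out R β)
    (hhigh : ∃ β, IsPotential n out ((K + 1) * i : ℕ) β) (σ : St) (hn : σ .n 0 = n)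
    (hiσ : σ .i 0 = i) (hg : IsGraph n (σ .pdeg) (σ .pnb) (σ .padj) out)
    (hrow : IsRowTable n (n + 4) (σ .row)) (hbig : σ .big 0 = N) :
    computeUtility.Ok σ (fun s => s .k 0 = K ∧ s .d 0 = i * N ∧ ∃ a : ℕ → ℤ,
        (∀ p : ℕ, p < n → s .al p = a p) ∧ (∀ p < n, ∀ q ∈ out p, a p + N ≤ a q) ∧
        ∀ u < n, ∀ w < n, w ∉ out u → a w - a u < (K + 1 : ℕ) * (i * N))
      (K * ((n / (2 * i + 1) + 2) * (15 * ∑ p ∈ Finset.range n, (out p).length + 75 * n + 16) + 6) +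
        8 * n + 10) := by
  refine Cmd.Ok.seq (searchRatio_ok hout hn2 hN hi hin hK1 hKn hlow hhigh σ hn hiσ hg hrow hbig)
    (T' := 2 * n + 2) ?_ (by omega)
  rintro s₁ hf₁ ⟨h1, h2, W, h3, h4⟩
  refine Cmd.Ok.asg_seq (i * N) (by simp [h2]) ?_ (T := 2 * n + 1) le_rfl
  refine Cmd.Ok.loop (N := n) (fun t s => ∀ p : ℕ, p < t → s .al p = pairValue N (W p)) (fun _ => 1)
      (by decide) ?_ ?_ ?_ ?_ ?_
  · simp [hf₁ .n (by decide), hn]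
  · simp
  · intro t ht s hf hx h
    refine Cmd.ok_of_exec ?_ (by simp [Cmd.cost])
    have e1 : s .val t = pairValue N (W t) := by
      rw [hf .val (by decide)]
      simpa using (h3 t ht).1
    intro p hp
    by_cases hpt : p = t
    · subst hpt
      simp [Cmd.exec, hx, e1]
    · have : (p : ℤ) ≠ t := by omega
      simp [Cmd.exec, hx, this, h p (by omega)]
  · intro s hf h
    refine ⟨by rw [hf .k (by decide)]; simpa using h1, by rw [hf .d (by decide)]; simp, _, h,
      h4.edge, fun u hu w hw huw => ?_⟩
    have := h4.nonedge u hu w hw huw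
    push_cast at this ⊢
    linarith
  · simp; omega

/-! ### Potentials of positions, thinning of chains, and the second algorithm -/

theorem IsTopoOrder.exists_getElem {n : ℕ} {L : List (ℕ × ℕ)} {qs : List ℕ}
    (h : IsTopoOrder n L qs) {v : ℕ} (hv : v < n) : ∃ (p : ℕ) (hp : p < qs.length), qs[p] = v := by
  obtain ⟨p, hp, h1⟩ := List.getElem_of_mem (h.mem_of_lt hv)
  exact ⟨p, hp, h1⟩

/-- Potentials of the vertices correspond to potentials of the positions. -/
theorem IsPotential.posList {n : ℕ} {L : List (ℕ × ℕ)} {qs : List ℕ} (hL : IsEdges n L)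
    (hqs : IsTopoOrder n L qs) {R : ℤ} {β : ℕ → ℝ} (h : IsPotential n (outList L) R β) :
    IsPotential n (posList L qs) R fun p => β (qs.getD p 0) := by
  have hlen := hqs.length_eq
  refine ⟨fun p hp q hq => ?_, fun u hu w hw huw => ?_⟩
  · obtain ⟨hp', hq', h1⟩ := (mem_posList hL hqs).1 hq
    simp only [List.getD_eq_getElem _ _ hp', List.getD_eq_getElem _ _ hq']
    exact h.edge _ (hL.lt _ h1).1 _ (mem_outList.2 h1)
  · rw [← hlen] at hu hw
    simp only [List.getD_eq_getElem _ _ hu, List.getD_eq_getElem _ _ hw]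
    refine h.nonedge _ (hqs.lt_of_mem (List.getElem_mem hu)) _ (hqs.lt_of_mem (List.getElem_mem hw))
      fun h1 => huw ((mem_posList hL hqs).2 ⟨hu, hw, mem_outList.1 h1⟩)

theorem IsPotential.of_posList {n : ℕ} {L : List (ℕ × ℕ)} {qs : List ℕ} (hL : IsEdges n L)
    (hqs : IsTopoOrder n L qs) {R : ℤ} {β : ℕ → ℝ} (h : IsPotential n (_root_.posList L qs) R β) :
    IsPotential n (outList L) R fun v => β (qs.idxOf v) := by
  have hlen := hqs.length_eq
  refine ⟨fun p hp q hq => ?_, fun u hu w hw huw => ?_⟩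
  · have hqn := (hL.lt _ (mem_outList.1 hq)).2
    obtain ⟨a, ha, rfl⟩ := hqs.exists_getElem hp
    obtain ⟨b, hb, rfl⟩ := hqs.exists_getElem hqn
    simp only [hqs.nodup.idxOf_getElem]
    exact h.edge a (by omega) b ((mem_posList hL hqs).2 ⟨ha, hb, mem_outList.1 hq⟩)
  · obtain ⟨a, ha, rfl⟩ := hqs.exists_getElem hu
    obtain ⟨b, hb, rfl⟩ := hqs.exists_getElem hw
    simp only [hqs.nodup.idxOf_getElem]
    refine h.nonedge a (by omega) b (by omega) fun h1 => huw ?_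
    obtain ⟨_, _, h2⟩ := (mem_posList hL hqs).1 h1
    exact mem_outList.2 h2

theorem add_mul_le_getElem {a : ℕ → ℤ} {T : ℤ} {l : List ℕ} {x : ℕ}
    (h : (x :: l).Pairwise fun p q => a p + T ≤ a q) (j : ℕ) (hj : j < (x :: l).length) :
    a x + j * T ≤ a (x :: l)[j] := by
  induction l generalizing x j with
  | nil =>
    have : j = 0 := by simpa using hj
    subst this
    simp
  | cons y l ih =>
    cases j with
    | zero => simp
    | succ j =>
      have h1 := ih (List.pairwise_cons.1 h).2 j (by simpa using hj)
      have h2 := (List.pairwise_cons.1 h).1 y (by simp)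
      simp only [List.getElem_cons_succ]
      push_cast
      linarith

/-- A chain has a subchain of at least `1 / i` times its length in which all differences of
utilities are at least `i T`. -/
theorem IsOutChain.exists_longList {n i : ℕ} {out : ℕ → List ℕ} {a : ℕ → ℤ} {T : ℤ} (hT : 0 ≤ T)
    (hi : 1 ≤ i) (ha : ∀ p < n, ∀ q ∈ out p, a p + T ≤ a q) {c : List ℕ} (hc : IsOutChain n out c) :
    ∃ w, w.Sublist c ∧ IsOutChain n (longList a (i * T) out) w ∧ c.length ≤ i * w.length := by
  induction hm : c.length using Nat.strong_induction_on generalizing c with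
  | _ m ih =>
    subst hm
    cases c with
    | nil => exact ⟨[], List.Sublist.refl _, isOutChain_nil, by simp⟩
    | cons x c =>
      -- Keep the first vertex `x` and skip to the vertex `i` places further on. From there on,
      -- every vertex differs from `x` by at least `i T`.
      obtain ⟨w, h1, h2, h3⟩ := ih ((x :: c).drop i).length (by simp; omega)
        (hc.sublist (List.drop_sublist _ _)) rfl
      have hdrop : (x :: c).drop i = c.drop (i - 1) := by
        obtain ⟨j, rfl⟩ := Nat.exists_eq_add_of_le' hi
        simp
      refine ⟨x :: w, ?_, ⟨List.pairwise_cons.2 ⟨fun z hz => ?_, h2.pairwise⟩, ?_⟩, ?_⟩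
      · rw [hdrop] at h1
        exact (h1.trans (List.drop_sublist _ _)).cons_cons x
      · obtain ⟨j, hj, rfl⟩ := List.getElem_of_mem (h1.subset hz)
        rw [List.getElem_drop]
        rw [List.length_drop] at hj
        have hx : x < n := hc.bound x (by simp)
        refine mem_longList.2 ⟨?_, ?_⟩
        · refine (List.pairwise_cons.1 hc.pairwise).1 _ ?_
          rw [hdrop] at h1
          have h4 := h1.subset hz
          rw [List.getElem_drop] at h4
          exact List.mem_of_mem_drop h4
        · have h4 := add_mul_le_getElem (hc.pairwise.imp_of_mem
            fun {p q} hp _ hq => ha p (hc.bound p hp) q hq) (i + j) (by omega)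
          push_cast at h4
          nlinarith [Int.natCast_nonneg j]
      · intro z hz
        rcases List.mem_cons.1 hz with rfl | hz
        exacts [hc.bound _ (by simp), h2.bound z hz]
      · rw [List.length_drop] at h3
        rw [List.length_cons (as := w), mul_add]
        omega

theorem IsOutChain.of_longList {n : ℕ} {out : ℕ → List ℕ} {a : ℕ → ℤ} {D : ℤ} {w : List ℕ}
    (h : IsOutChain n (longList a D out) w) : IsOutChain n out w :=
  ⟨h.pairwise.imp fun h => (mem_longList.1 h).1, h.bound⟩

/-- The input of the second part for the edges `L`. -/
structure IsGraphInput (n i : ℕ) (L : List (ℕ × ℕ)) (inp : ℤ → ℤ) : Prop where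
  n_eq : inp 0 = n
  m_eq : inp 1 = L.length
  i_eq : inp 2 = i
  edge_eq : ∀ (e : ℕ) (he : e < L.length),
    inp ((3 + e + e : ℕ) : ℤ) = L[e].1 ∧ inp ((3 + e + e + 1 : ℕ) : ℤ) = L[e].2

theorem graphClique_ok (n i K B : ℕ) (L : List (ℕ × ℕ)) (hL : IsEdges n L)
    (hwf : WellFounded fun x v => (x, v) ∈ L) (hn2 : 2 ≤ n)
    (hi1 : 1 ≤ i) (hi : i ≤ n) (hK0 : 1 ≤ K) (hK : K ≤ n)
    (hlow : ∀ R : ℕ, R ≤ K * i → ∀ β, ¬ IsPotential n (outList L) R β)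
    (hhigh : ∃ β, IsPotential n (outList L) ((K + 1) * i : ℕ) β)
    (hm : 1 ≤ L.length) (hn : n ≤ 2 * L.length)
    (hB : L.length ^ (K + 1) ≤ B ^ 2) (σ : St) (hσ : IsGraphInput n i L (σ .inp))
    (h0 : ∀ r, r ≠ .inp → ∀ a : ℤ, 0 ≤ a → σ r a = 0) :
    graphClique.Ok σ (fun s => ∃ w qs : List ℕ, IsTopoOrder n L qs ∧
      IsOutChain n (posList L qs) w ∧
      (∀ c, IsOutChain n (posList L qs) c → c.length ≤ i * w.length) ∧ s .out 0 = w.length ∧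
      ∀ (j : ℕ) (h : j < w.length), s .out (j + 1) = qs.getD w[j] 0)
      (200 * (K * ((n / (2 * i + 1) + 2) * L.length)) + 300 * (K * B)) := by
  have hmB : L.length ≤ B := (Nat.pow_le_pow_iff_left two_ne_zero).1
    ((Nat.pow_le_pow_right hm (by omega)).trans hB)
  have hkB : B ≤ K * B := Nat.le_mul_of_pos_left _ hK0
  have hkk : K ≤ K * B := Nat.le_mul_of_pos_right _ (by omega)
  set S := L.length with hS
  set P := n / (2 * i + 1) + 2 with hP
  have hcost : P * (15 * S + 75 * n + 16) ≤ P * (200 * S) := Nat.mul_le_mul_left _ (by omega)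
  have hcost' : K * (P * (15 * S + 75 * n + 16) + 6) ≤ 200 * (K * (P * S)) + 6 * K := by
    calc _ ≤ K * (P * (200 * S) + 6) := Nat.mul_le_mul_left _ (Nat.add_le_add_right hcost 6)
      _ = _ := by ring
  have hcost'' : 140 * K * B = 140 * (K * B) := by ring
  refine Cmd.Ok.seq (Q := fun s => s .n 0 = n ∧ s .m 0 = L.length ∧ s .i 0 = i ∧
    s .eb 0 = (3 : ℕ)) (T := 4) (Cmd.ok_of_exec ?_ ?_)
    (T' := 17 * S + 14 * n + 25 + (K * (P * (15 * S + 75 * n + 16) + 6) + 8 * n + 10 + 140 * K * B))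
    ?_ (by omega)
  · simp [readGraphHeader, Cmd.exec, Cmd.asg, hσ.n_eq, hσ.m_eq, hσ.i_eq]
  · simp [readGraphHeader, Cmd.cost, Cmd.asg]
  rintro s₁ hf₁ ⟨hn₁, hm₁, hi₁, heb⟩
  refine Cmd.Ok.seq (prepare_ok n 3 L hL hwf s₁ hn₁ hm₁ heb ?_ ?_)
    (T' := K * (P * (15 * S + 75 * n + 16) + 6) + 8 * n + 10 + 140 * K * B) ?_ le_rfl
  · rw [hf₁ .inp (by decide)]
    exact hσ.edge_eq
  · intro r hr a ha
    rw [hf₁ r (by fin_cases hr <;> decide)]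
    exact h0 r (by fin_cases hr <;> decide) a ha
  rintro s₂ hf₂ ⟨qs, hqs, hp⟩
  have htopo := hqs.isTopoGraph hL
  have hsum := sum_length_posList hL hqs
  refine Cmd.Ok.seq ((computeUtility_ok (n := n) (i := i) (K := K) (N := n + 4) htopo hn2 rfl hi1 hi
    hK0 hK ?_ ?_ s₂ hp.n_eq (by rw [hf₂ .i (by decide), hi₁]) hp.graph hp.row hp.big_eq).mono
    (fun _ _ h => h) (le_of_eq (by rw [hsum]))) (T' := 140 * K * B) ?_ le_rfl
  · exact fun R hR β hβ => hlow R hR _ (hβ.of_posList hL hqs)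
  · obtain ⟨β, hβ⟩ := hhigh
    exact ⟨_, hβ.posList hL hqs⟩
  rintro s₃ hf₃ ⟨hk, hd, a, hal, ha1, ha2⟩
  have hp₃ : IsPrepared n L qs s₃ := hp.congr fun r hr => hf₃ r (by fin_cases hr <;> decide)
  refine (findClique_ok (out := posList L qs) htopo hm hn hK0 hsum.le hB (a := a)
    (D := i * (n + 4)) (hasWindows_longList (by positivity) hK0 ?_) hqs.length_eq s₃ hp₃.n_eq hd hk
    hal hp₃.graph hp₃.row ?_ hp₃.ord_eq ?_).mono ?_ le_rfl
  · intro p q hpn hqn h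
    by_contra hnot
    have := ha2 p hpn q hqn hnot
    omega
  · intro p hpn
    rw [posList, dif_neg (by rw [hqs.length_eq]; omega)]
  · intro r hr a ha
    rw [hf₃ r (by fin_cases hr <;> decide), hf₂ r (by fin_cases hr <;> decide),
      hf₁ r (by fin_cases hr <;> decide)]
    exact h0 r (by fin_cases hr <;> decide) a ha
  · rintro s₄ - ⟨w, h1, h2, h3⟩
    refine ⟨w, qs, hqs, h1.of_longList, fun c hc => ?_, h3⟩
    obtain ⟨w', -, h4, h5⟩ := hc.exists_longList (by positivity) hi1 ha1
    exact h5.trans (Nat.mul_le_mul_left _ (h2 w' h4))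

/-! ### Input and output -/

/-- The register for the number of words that are still to be copied. -/
def countReg : ℤ := Reg.addr .c 0

/-- The register for the address of the next word to be copied. -/
def sourceReg : ℤ := Reg.addr .p 0

/-- The register for the address to which the next word is copied. -/
def targetReg : ℤ := Reg.addr .q 0

/-- Add a constant to a register. -/
def addConst (r d : ℤ) : RamProg := .assign (.lit r) (.plus (.cell (.lit r)) (.lit d))

/-- Copy words. -/
def copyWords (dp dq : ℤ) : RamProg :=
  .loop (.cell (.lit countReg))
    (.seq (.assign (.cell (.lit targetReg)) (.cell (.cell (.lit sourceReg))))
      (.seq (addConst sourceReg dp) (.seq (addConst targetReg dq) (addConst countReg (-1)))))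

theorem runs_addConst (r d : ℤ) (M : Memory) :
    Runs (addConst r d) M 6 (Function.update M r (M r + d)) := Runs.assign _ _ M

/-- A round costs `3` steps for the test and `24` for the body. As source, destination and the three
registers are disjoint, no word is overwritten before it is read. -/
theorem runs_copyWords {dp dq : ℤ} (hdq : dq ≠ 0) (N : ℕ) (M : Memory) (hN : M countReg = N)
    (hreg : ∀ x : ℕ, x < N → M targetReg + dq * x ∉ [countReg, sourceReg, targetReg])
    (hreg' : ∀ x : ℕ, x < N → M sourceReg + dp * x ∉ [countReg, sourceReg, targetReg])
    (hdisj : ∀ x y : ℕ, x < N → y < N → M targetReg + dq * x ≠ M sourceReg + dp * y) :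
    ∃ M' : Memory, Runs (copyWords dp dq) M (27 * N + 3) M' ∧ M' countReg = 0 ∧
      (∀ x : ℕ, x < N → M' (M targetReg + dq * x) = M (M sourceReg + dp * x)) ∧
      ∀ a, a ∉ [countReg, sourceReg, targetReg] → (∀ x : ℕ, x < N → a ≠ M targetReg + dq * x) →
        M' a = M a := by
  have d1 : countReg ≠ sourceReg := by decide
  have d2 : countReg ≠ targetReg := by decide
  have d3 : sourceReg ≠ targetReg := by decide
  induction N generalizing M with
  | zero =>
    refine ⟨M, ?_, by simpa using hN, by simp, fun a _ _ => rfl⟩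
    exact Runs.loop_false (by simp [RamExpr.eval, hN])
  | succ N ih =>
    have t0 := hreg 0 (by omega)
    simp only [Nat.cast_zero, mul_zero, add_zero, List.mem_cons, List.not_mem_nil, or_false,
      not_or] at t0
    obtain ⟨t1, t2, t3⟩ := t0
    obtain ⟨M₁, hM₁⟩ : ∃ M₁, M₁ = Function.update (Function.update (Function.update (Function.update M
      (M targetReg) (M (M sourceReg))) sourceReg (M sourceReg + dp)) targetReg (M targetReg + dq))
      countReg (M countReg + -1) := ⟨_, rfl⟩
    have hrun : Runs (.seq (.assign (.cell (.lit targetReg)) (.cell (.cell (.lit sourceReg))))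
        (.seq (addConst sourceReg dp) (.seq (addConst targetReg dq) (addConst countReg (-1)))))
        M (6 + (6 + (6 + 6))) M₁ := by
      have r1 := Runs.assign (.cell (.lit targetReg)) (.cell (.cell (.lit sourceReg))) M
      simp only [RamExpr.eval, RamExpr.cost] at r1
      have r2 := runs_addConst sourceReg dp (Function.update M (M targetReg) (M (M sourceReg)))
      rw [Function.update_of_ne (Ne.symm t2)] at r2
      have r3 := runs_addConst targetReg dq (Function.update (Function.update M (M targetReg)
        (M (M sourceReg))) sourceReg (M sourceReg + dp))
      rw [Function.update_of_ne (Ne.symm d3), Function.update_of_ne (Ne.symm t3)] at r3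
      have r4 := runs_addConst countReg (-1) (Function.update (Function.update (Function.update M
        (M targetReg) (M (M sourceReg))) sourceReg (M sourceReg + dp)) targetReg (M targetReg + dq))
      rw [Function.update_of_ne d2, Function.update_of_ne d1, Function.update_of_ne (Ne.symm t1)]
        at r4
      rw [hM₁]
      exact Runs.seq r1 (Runs.seq r2 (Runs.seq r3 r4))
    have e1 : M₁ countReg = N := by
      rw [hM₁, Function.update_self, hN]
      push_cast
      ring
    have e2 : M₁ targetReg = M targetReg + dq := by
      rw [hM₁, Function.update_of_ne (Ne.symm d2), Function.update_self]
    have e3 : M₁ sourceReg = M sourceReg + dp := by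
      rw [hM₁, Function.update_of_ne (Ne.symm d1), Function.update_of_ne d3, Function.update_self]
    have e4 : ∀ a, a ∉ [countReg, sourceReg, targetReg] → a ≠ M targetReg → M₁ a = M a := by
      intro a ha hat
      simp only [List.mem_cons, List.not_mem_nil, or_false, not_or] at ha
      rw [hM₁, Function.update_of_ne ha.1, Function.update_of_ne ha.2.2,
        Function.update_of_ne ha.2.1, Function.update_of_ne hat]
    have e5 : M₁ (M targetReg) = M (M sourceReg) := by
      rw [hM₁, Function.update_of_ne t1, Function.update_of_ne t3, Function.update_of_ne t2,
        Function.update_self]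
    have s1 : ∀ x : ℕ, M targetReg + dq + dq * x = M targetReg + dq * (x + 1 : ℕ) := by
      intro x; push_cast; ring
    have s2 : ∀ x : ℕ, M sourceReg + dp + dp * x = M sourceReg + dp * (x + 1 : ℕ) := by
      intro x; push_cast; ring
    obtain ⟨M', h1, h2, h3, h4⟩ := ih M₁ e1
      (fun x hx => by rw [e2, s1]; exact hreg _ (by omega))
      (fun x hx => by rw [e3, s2]; exact hreg' _ (by omega))
      (fun x y hx hy => by rw [e2, e3, s1, s2]; exact hdisj _ _ (by omega) (by omega))
    simp only [e2, e3, s1, s2] at h3 h4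
    have hne : ∀ x : ℕ, M targetReg ≠ M targetReg + dq * (x + 1 : ℕ) := by
      intro x hx
      have : dq * (x + 1 : ℕ) ≠ 0 := mul_ne_zero hdq (by positivity)
      omega
    refine ⟨M', ?_, h2, ?_, ?_⟩
    · have := Runs.loop_true (e := .cell (.lit countReg)) (by simp only [RamExpr.eval, hN]; positivity)
        hrun h1
      rwa [show 27 * (N + 1) + 3 = RamExpr.cost (.cell (.lit countReg)) + 1 + (6 + (6 + (6 + 6))) +
        (27 * N + 3) by simp only [RamExpr.cost]; ring]
    · intro x hx
      cases x with
      | zero =>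
        simp only [Nat.cast_zero, mul_zero, add_zero]
        rw [h4 _ (by simpa using hreg 0 (by omega)) (fun x _ => hne x), e5]
      | succ x =>
        rw [h3 x (by omega)]
        refine e4 _ (hreg' _ hx) ?_
        have := hdisj 0 (x + 1) (by omega) hx
        simpa using this.symm
    · intro a ha hax
      rw [h4 a ha fun x hx => hax (x + 1) (by omega)]
      exact e4 a ha (by simpa using hax 0 (by omega))

/-- Set a register. -/
def setConst (r d : ℤ) : RamProg := .assign (.lit r) (.lit d)

/-- Copy the input into an array. The expression `e` is the length of the input. -/
def copyIn (e : RamExpr) : RamProg :=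
  .seq (.assign (.lit countReg) e)
    (.seq (setConst targetReg (Reg.addr .inp 0)) (.seq (copyWords 1 (-128))
      (.seq (setConst sourceReg 0) (setConst targetReg 0))))

/-- Copy the output to the place where it is expected. -/
def copyOut : RamProg :=
  .seq (.assign (.lit countReg) (.plus (.cell (.lit (Reg.addr .out 0))) (.lit 1)))
    (.seq (setConst sourceReg (Reg.addr .out 0)) (.seq (setConst targetReg 0) (copyWords (-128) 1)))

theorem Reg.addr_eq (r : Reg) (a : ℤ) : r.addr a = r.addr 0 + -128 * a := by
  simp only [Reg.addr]
  ring

theorem Reg.addr_neg (r : Reg) {a : ℤ} (ha : 0 ≤ a) : r.addr a < 0 := by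
  have := r.code_nonneg
  simp only [Reg.addr]
  omega

theorem Reg.addr_notMem {r : Reg} (hr : r ∉ [Reg.c, .p, .q]) (a : ℤ) :
    r.addr a ∉ [countReg, sourceReg, targetReg] := by
  simp only [List.mem_cons, List.not_mem_nil, or_false, not_or] at hr ⊢
  simp only [countReg, sourceReg, targetReg, Reg.addr_inj, not_and]
  exact ⟨fun h => absurd h hr.1, fun h => absurd h hr.2.1, fun h => absurd h hr.2.2⟩

theorem natCast_notMem_regs (x : ℕ) : (x : ℤ) ∉ [countReg, sourceReg, targetReg] := by
  have h1 : countReg < 0 := by decide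
  have h2 : sourceReg < 0 := by decide
  have h3 : targetReg < 0 := by decide
  simp only [List.mem_cons, List.not_mem_nil, or_false, not_or]
  omega

/-- The input lies in nonnegative cells and the array `inp` in negative ones. The auxiliary
registers are entries of the arrays `c`, `p`, `q`; they end with value `0`, so that all arrays
except `inp` look untouched. -/
theorem runs_copyIn (e : RamExpr) (N : ℕ) (x : List ℤ) (he : e.eval (initMemory x) = N) :
    ∃ M : Memory, Runs (copyIn e) (initMemory x) (27 * N + e.cost + 14) M ∧
      (∀ j : ℕ, j < N → M.view .inp j = x.getD j 0) ∧
      ∀ r, r ≠ .inp → ∀ a : ℤ, 0 ≤ a → M.view r a = 0 := by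
  have d1 : countReg ≠ sourceReg := by decide
  have d2 : countReg ≠ targetReg := by decide
  have d3 : sourceReg ≠ targetReg := by decide
  have hneg : ∀ a < 0, initMemory x a = 0 := fun a ha => if_neg (by omega)
  obtain ⟨M₁, hM₁⟩ : ∃ M₁, M₁ = Function.update (Function.update (initMemory x) countReg N)
    targetReg (Reg.addr .inp 0) := ⟨_, rfl⟩
  have c1 : M₁ countReg = N := by rw [hM₁, Function.update_of_ne d2, Function.update_self]
  have c2 : M₁ targetReg = Reg.addr .inp 0 := by rw [hM₁, Function.update_self]
  have c3 : M₁ sourceReg = 0 := by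
    rw [hM₁, Function.update_of_ne d3, Function.update_of_ne d1.symm, hneg _ (by decide)]
  have c4 : ∀ a, a ∉ [countReg, sourceReg, targetReg] → M₁ a = initMemory x a := by
    intro a ha
    simp only [List.mem_cons, List.not_mem_nil, or_false, not_or] at ha
    rw [hM₁, Function.update_of_ne ha.2.2, Function.update_of_ne ha.1]
  obtain ⟨M, h1, h2, h3, h4⟩ := runs_copyWords (dp := 1) (dq := -128) (by decide) N M₁ c1
    (fun y _ => by rw [c2, ← Reg.addr_eq]; exact Reg.addr_notMem (by decide) _)
    (fun y _ => by rw [c3, zero_add, one_mul]; exact natCast_notMem_regs y)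
    (fun y z _ _ => by
      rw [c2, c3, ← Reg.addr_eq]
      have := Reg.addr_neg .inp (Int.natCast_nonneg y)
      omega)
  simp only [c2, c3, ← Reg.addr_eq, zero_add, one_mul] at h3 h4
  have r1 := Runs.assign (.lit countReg) e (initMemory x)
  rw [he] at r1
  have r2 := Runs.assign (.lit targetReg) (.lit (Reg.addr .inp 0))
    (Function.update (initMemory x) countReg N)
  have r3 := Runs.assign (.lit sourceReg) (.lit 0) M
  have r4 := Runs.assign (.lit targetReg) (.lit 0) (Function.update M sourceReg 0)
  simp only [RamExpr.eval, RamExpr.cost] at r1 r2 r3 r4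
  rw [← hM₁] at r2
  refine ⟨Function.update (Function.update M sourceReg 0) targetReg 0, ?_, ?_, ?_⟩
  · have := Runs.seq r1 (Runs.seq r2 (Runs.seq h1 (Runs.seq r3 r4)))
    rwa [show 27 * N + e.cost + 14 = 1 + e.cost + 1 + (1 + 1 + 1 + (27 * N + 3 +
      (1 + 1 + 1 + (1 + 1 + 1)))) by ring]
  · intro j hj
    have hn := Reg.addr_notMem (r := .inp) (by decide) j
    simp only [List.mem_cons, List.not_mem_nil, or_false, not_or] at hn
    rw [Memory.view, Function.update_of_ne hn.2.2, Function.update_of_ne hn.2.1, h3 j hj,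
      c4 _ (natCast_notMem_regs j), initMemory, if_pos (Int.natCast_nonneg j), Int.toNat_natCast]
  · intro r hr a ha
    rw [Memory.view]
    by_cases hrt : r.addr a = targetReg
    · rw [hrt, Function.update_self]
    rw [Function.update_of_ne hrt]
    by_cases hrs : r.addr a = sourceReg
    · rw [hrs, Function.update_self]
    rw [Function.update_of_ne hrs]
    by_cases hrc : r.addr a = countReg
    · rw [hrc, h2]
    have hn : r.addr a ∉ [countReg, sourceReg, targetReg] := by simp [hrt, hrs, hrc]
    rw [h4 _ hn fun y _ h => hr (Reg.addr_inj.1 h).1, c4 _ hn, hneg _ (Reg.addr_neg r ha)]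

theorem runs_copyOut (M : Memory) (N : ℕ) (hN : M.view .out 0 = N) :
    ∃ M' : Memory, Runs copyOut M (27 * N + 42) M' ∧
      ∀ j : ℕ, j ≤ N → M' j = M.view .out j := by
  have d1 : countReg ≠ sourceReg := by decide
  have d2 : countReg ≠ targetReg := by decide
  have d3 : sourceReg ≠ targetReg := by decide
  obtain ⟨M₁, hM₁⟩ : ∃ M₁, M₁ = Function.update (Function.update (Function.update M countReg
    (N + 1)) sourceReg (Reg.addr .out 0)) targetReg 0 := ⟨_, rfl⟩
  have c1 : M₁ countReg = (N + 1 : ℕ) := by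
    rw [hM₁, Function.update_of_ne d2, Function.update_of_ne d1, Function.update_self]
    push_cast
    rfl
  have c2 : M₁ targetReg = 0 := by rw [hM₁, Function.update_self]
  have c3 : M₁ sourceReg = Reg.addr .out 0 := by
    rw [hM₁, Function.update_of_ne d3, Function.update_self]
  have c4 : ∀ a, a ∉ [countReg, sourceReg, targetReg] → M₁ a = M a := by
    intro a ha
    simp only [List.mem_cons, List.not_mem_nil, or_false, not_or] at ha
    rw [hM₁, Function.update_of_ne ha.2.2, Function.update_of_ne ha.2.1, Function.update_of_ne ha.1]
  obtain ⟨M', h1, -, h3, -⟩ := runs_copyWords (dp := -128) (dq := 1) (by decide) (N + 1) M₁ c1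
    (fun y _ => by rw [c2, zero_add, one_mul]; exact natCast_notMem_regs y)
    (fun y _ => by rw [c3, ← Reg.addr_eq]; exact Reg.addr_notMem (by decide) _)
    (fun y z _ _ => by
      rw [c2, c3, ← Reg.addr_eq]
      have := Reg.addr_neg .out (Int.natCast_nonneg z)
      omega)
  simp only [c2, c3, ← Reg.addr_eq, zero_add, one_mul] at h3
  have r1 := Runs.assign (.lit countReg) (.plus (.cell (.lit (Reg.addr .out 0))) (.lit 1)) M
  simp only [RamExpr.eval, RamExpr.cost] at r1
  rw [show M (Reg.addr .out 0) = N from hN] at r1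
  have r2 := Runs.assign (.lit sourceReg) (.lit (Reg.addr .out 0))
    (Function.update M countReg (N + 1))
  have r3 := Runs.assign (.lit targetReg) (.lit 0) (Function.update (Function.update M countReg
    (N + 1)) sourceReg (Reg.addr .out 0))
  simp only [RamExpr.eval, RamExpr.cost] at r2 r3
  rw [← hM₁] at r3
  refine ⟨M', ?_, fun j hj => ?_⟩
  · have := Runs.seq r1 (Runs.seq r2 (Runs.seq r3 h1))
    rwa [show 1 + (1 + 1 + 1 + 1) + 1 + (1 + 1 + 1 + (1 + 1 + 1 + (27 * (N + 1) + 3))) =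
      27 * N + 42 by ring] at this
  · rw [h3 j (by omega), c4 _ (Reg.addr_notMem (by decide) _)]
    rfl

/-! ### From the machine to the theorem -/

/-- Read the input, execute a command, and write the output. -/
def wholeProgram (e : RamExpr) (c : Cmd) : RamProg :=
  .seq (copyIn e) (.seq c.compile copyOut)

/-- The running time of a whole program, if the command produces a list of numbers with the
property `R`. -/
theorem exists_runs_wholeProgram (e : RamExpr) (c : Cmd) (h : c.Wf) :
    ∃ C : ℕ, ∀ (x : List ℤ) (N T : ℕ) (R : List ℕ → Prop), e.eval (initMemory x) = N →
      (∀ l, R l → l.length ≤ T) →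
      (∀ σ : St, (∀ j : ℕ, j < N → σ .inp j = x.getD j 0) →
        (∀ r, r ≠ .inp → ∀ a : ℤ, 0 ≤ a → σ r a = 0) →
        c.Ok σ (fun s => ∃ l : List ℕ, R l ∧ s .out 0 = l.length ∧
          ∀ (j : ℕ) (h : j < l.length), s .out (j + 1) = l[j]) T) →
      ∃ (t : ℕ) (M : Memory) (l : List ℕ), Runs (wholeProgram e c) (initMemory x) t M ∧ R l ∧
        M 0 = l.length ∧ (∀ (j : ℕ) (h : j < l.length), M (j + 1) = l[j]) ∧
        t ≤ C * (N + T + 1) := by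
  obtain ⟨C, hC⟩ := c.exists_runs h
  refine ⟨C + e.cost + 100, fun x N T R he hR hc => ?_⟩
  obtain ⟨M₁, r1, h1, h2⟩ := runs_copyIn e N x he
  obtain ⟨t, M₂, r2, h3, ht⟩ := hC M₁
  obtain ⟨⟨l, hl, hl0, hl1⟩, hT⟩ := hc M₁.view h1 h2
  rw [← h3] at hl0 hl1
  obtain ⟨M₃, r3, h4⟩ := runs_copyOut M₂ l.length hl0
  refine ⟨_, M₃, l, Runs.seq r1 (Runs.seq r2 r3), hl, ?_, ?_, ?_⟩
  · rw [← hl0]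
    exact h4 0 (by omega)
  · intro j hj
    rw [← hl1 j hj]
    have := h4 (j + 1) (by omega)
    push_cast at this
    exact this
  · have h5 := hR l hl
    have h6 : t ≤ C * T := ht.trans (Nat.mul_le_mul_left _ hT)
    have h7 : 0 ≤ C * N + e.cost * (N + T) := Nat.zero_le _
    nlinarith

/-- The edges as pairs of natural numbers. -/
def natEdges {n : ℕ} (L : List (Fin n × Fin n)) : List (ℕ × ℕ) :=
  L.map fun p => ((p.1 : ℕ), (p.2 : ℕ))

theorem mem_natEdges {n : ℕ} {L : List (Fin n × Fin n)} {u v : Fin n} :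
    ((u : ℕ), (v : ℕ)) ∈ natEdges L ↔ (u, v) ∈ L := by
  simp only [natEdges, List.mem_map, Prod.mk.injEq, Prod.exists]
  constructor
  · rintro ⟨a, b, h, h1, h2⟩
    rwa [← Fin.ext h1, ← Fin.ext h2]
  · exact fun h => ⟨u, v, h, rfl, rfl⟩

theorem isEdges_natEdges {n : ℕ} {L : List (Fin n × Fin n)} (hL : L.Nodup) :
    IsEdges n (natEdges L) := by
  refine ⟨hL.map ?_, ?_⟩
  · rintro ⟨a, b⟩ ⟨c, d⟩ h
    simp only [Prod.mk.injEq] at h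
    rw [Fin.ext h.1, Fin.ext h.2]
  · intro p hp
    obtain ⟨q, -, rfl⟩ := List.mem_map.1 hp
    exact ⟨q.1.2, q.2.2⟩

theorem wellFounded_natEdges {n : ℕ} {G : Digraph (Fin n)} {L : List (Fin n × Fin n)}
    (hG : IsDag G) (hL : IsEdgeList G L) : WellFounded fun x v => (x, v) ∈ natEdges L := by
  have : Std.Irrefl (Relation.TransGen G.Adj) := ⟨hG⟩
  have hwf : WellFounded (Relation.TransGen G.Adj) := Finite.wellFounded_of_trans_of_irrefl _
  have hE := isEdges_natEdges hL.1
  have key : ∀ v : Fin n, Acc (fun x v => (x, v) ∈ natEdges L) (v : ℕ) := by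
    intro v
    induction v using hwf.induction with
    | _ v ih =>
      refine ⟨_, fun x hx => ?_⟩
      have hxn := (hE.lt _ hx).1
      exact ih ⟨x, hxn⟩ (Relation.TransGen.single ((hL.2 _ _).1 (mem_natEdges (u := ⟨x, hxn⟩).1 hx)))
  refine ⟨fun v => ?_⟩
  by_cases hv : v < n
  · exact key ⟨v, hv⟩
  · exact ⟨_, fun x hx => absurd (hE.lt _ hx).2 hv⟩

theorem edgeCount_eq_length {n : ℕ} {G : Digraph (Fin n)} {L : List (Fin n × Fin n)}
    (hL : IsEdgeList G L) : edgeCount G = L.length := by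
  rw [edgeCount, ← List.toFinset_card_of_nodup hL.1, ← Set.ncard_coe_finset]
  congr 1
  ext ⟨u, v⟩
  simp [hL.2]

/-- The only use of connectedness: the time that is linear in `n` is charged to the edges. -/
theorem le_edgeCount_add_one {n : ℕ} {G : Digraph (Fin n)} (hG : DagConnected G) :
    n ≤ edgeCount G + 1 := by
  have h := SimpleGraph.Connected.card_vert_le_card_edgeSet_add_one hG
  rw [Nat.card_fin] at h
  refine h.trans (Nat.add_le_add_right ?_ 1)
  rw [edgeCount, Nat.card_coe_set_eq]
  have hsub : G.toSimpleGraphInclusive.edgeSet ⊆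
      (fun p : Fin n × Fin n => s(p.1, p.2)) '' {p | G.Adj p.1 p.2} := by
    intro x hx
    induction x using Sym2.ind with
    | _ u v =>
      rcases (SimpleGraph.mem_edgeSet _).1 hx with ⟨-, h | h⟩
      · exact ⟨(u, v), h, rfl⟩
      · exact ⟨(v, u), h, Sym2.eq_swap⟩
  exact (Set.ncard_le_ncard hsub (Set.toFinite _)).trans (Set.ncard_image_le (Set.toFinite _))

theorem one_le_edgeCount {n : ℕ} {G : Digraph (Fin n)} (h : ¬ IsDegenerate G) :
    1 ≤ edgeCount G := by
  by_contra h0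
  have h1 : {p : Fin n × Fin n | G.Adj p.1 p.2} = ∅ :=
    (Set.ncard_eq_zero (Set.toFinite _)).1 (by rw [edgeCount] at h0; omega)
  refine h ⟨fun _ => 0, fun u v => ?_⟩
  have h2 : (u, v) ∉ {p : Fin n × Fin n | G.Adj p.1 p.2} := by rw [h1]; simp
  simpa using h2

theorem two_le_of_not_isDegenerate {n : ℕ} {G : Digraph (Fin n)} (hG : IsDag G)
    (h : ¬ IsDegenerate G) : 2 ≤ n := by
  by_contra hn
  refine h ⟨fun _ => 0, fun u v => ?_⟩
  have huv : u = v := Fin.ext (by omega)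
  simp only [lt_irrefl, iff_false, huv]
  exact fun h => hG v (Relation.TransGen.single h)

/-! ### Satisfiable ratios, `λ`, and potentials -/

theorem zero_mem_lowerBounds {n : ℕ} {G : Digraph (Fin n)} (hG : IsDag G) (hn : 0 < n) :
    0 ∈ lowerBounds (satisfiableRatios G) := by
  rintro r ⟨t₁, t₂, h1, rfl, α, -, h2⟩
  have := h2 ⟨0, hn⟩ ⟨0, hn⟩ fun h => hG _ (Relation.TransGen.single h)
  rw [sub_self] at this
  positivity

/-- The number of vertices is a satisfiable ratio. -/
theorem natCast_mem_satisfiableRatios {n : ℕ} {G : Digraph (Fin n)} (hG : IsDag G) :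
    (n : ℝ) ∈ satisfiableRatios G := by
  classical
  -- The number of ancestors is used as utility: it rises along every edge by acyclicity, and it
  -- lies between `0` and `n`.
  let S : Fin n → Finset (Fin n) := fun v => Finset.univ.filter fun u => Relation.TransGen G.Adj u v
  refine ⟨1, n, one_pos, by simp, fun v => ((S v).card : ℝ), fun u v huv => ?_, fun u v _ => ?_⟩
  · have h1 : S u ⊂ S v := by
      refine Finset.ssubset_iff_subset_ne.2 ⟨fun w hw => ?_, fun h => ?_⟩
      · simp only [S, Finset.mem_filter, Finset.mem_univ, true_and] at hw ⊢
        exact hw.tail huv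
      · have h2 : u ∈ S v := by
          simp only [S, Finset.mem_filter, Finset.mem_univ, true_and]
          exact Relation.TransGen.single huv
        rw [← h] at h2
        simp only [S, Finset.mem_filter, Finset.mem_univ, true_and] at h2
        exact hG u h2
    have h2 : ((S u).card : ℝ) + 1 ≤ (S v).card := by exact_mod_cast Finset.card_lt_card h1
    linarith
  · have h1 : ((S v).card : ℝ) ≤ n := by
      have := Finset.card_le_univ (S v)
      rw [Fintype.card_fin] at this
      exact_mod_cast this
    have h2 : (0 : ℝ) ≤ (S u).card := Nat.cast_nonneg _
    linarith

theorem lam_le_card {n : ℕ} {G : Digraph (Fin n)} (hG : IsDag G) (hn : 0 < n) : lam G ≤ n :=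
  csInf_le ⟨0, zero_mem_lowerBounds hG hn⟩ (natCast_mem_satisfiableRatios hG)

/-- There is no potential for a ratio that is at most `λ`. -/
theorem not_isPotential {n : ℕ} {G : Digraph (Fin n)} {L : List (Fin n × Fin n)} (hG : IsDag G)
    (hL : IsEdgeList G L) (hn : 0 < n) {R : ℤ} (hR : (R : ℝ) ≤ lam G) (β : ℕ → ℝ) :
    ¬ IsPotential n (outList (natEdges L)) R β := by
  classical
  intro h
  let S : Finset (Fin n × Fin n) := Finset.univ.filter fun p => ¬ G.Adj p.1 p.2
  have hS : S.Nonempty := by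
    refine ⟨(⟨0, hn⟩, ⟨0, hn⟩), ?_⟩
    simp only [S, Finset.mem_filter, Finset.mem_univ, true_and]
    exact fun h => hG _ (Relation.TransGen.single h)
  -- The condition on nonadjacent pairs is strict and there are finitely many of them, so their
  -- largest difference is a satisfiable ratio less than `R ≤ λ`.
  obtain ⟨p, hp, hmax⟩ := S.exists_max_image (fun p => β p.2 - β p.1) hS
  have hr : β p.2 - β p.1 ∈ satisfiableRatios G := by
    refine ⟨1, β p.2 - β p.1, one_pos, by simp, fun v => β v, fun u v huv => ?_, fun u v huv => ?_⟩
    · have := h.edge u u.2 v (mem_outList.2 (mem_natEdges.2 ((hL.2 u v).2 huv)))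
      linarith
    · exact hmax (u, v) (by simpa [S] using huv)
  have h1 := csInf_le ⟨0, zero_mem_lowerBounds hG hn⟩ hr
  have h2 := h.nonedge p.1 p.1.2 p.2 p.2.2 (by
    rw [mem_outList, mem_natEdges, hL.2]
    simpa [S] using hp)
  rw [lam] at hR
  linarith

/-- Some satisfiable ratio lies below `R` because `λ` is an infimum; rescale its utilities to `t₁ =
1`. -/
theorem exists_isPotential {n : ℕ} {G : Digraph (Fin n)} {L : List (Fin n × Fin n)} (hG : IsDag G)
    (hL : IsEdgeList G L) {R : ℤ} (hR : lam G < R) :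
    ∃ β, IsPotential n (outList (natEdges L)) R β := by
  obtain ⟨r, ⟨t₁, t₂, h1, rfl, α, h2, h3⟩, h4⟩ :=
    exists_lt_of_csInf_lt ⟨_, natCast_mem_satisfiableRatios hG⟩ hR
  refine ⟨fun v => if hv : v < n then α ⟨v, hv⟩ / t₁ else 0, fun p hp q hq => ?_,
    fun u hu w hw huw => ?_⟩
  · have hqn := ((isEdges_natEdges hL.1).lt _ (mem_outList.1 hq)).2
    have h5 := h2 ⟨p, hp⟩ ⟨q, hqn⟩ ((hL.2 _ _).1 (mem_natEdges.1 (mem_outList.1 hq)))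
    simp only [hp, hqn, dif_pos]
    rw [← sub_nonneg, show α ⟨q, hqn⟩ / t₁ - (α ⟨p, hp⟩ / t₁ + 1) =
      (α ⟨q, hqn⟩ - α ⟨p, hp⟩ - t₁) / t₁ by field_simp; ring]
    exact div_nonneg (by linarith) h1.le
  · have h5 := h3 ⟨u, hu⟩ ⟨w, hw⟩ fun h =>
      huw (mem_outList.2 (mem_natEdges (u := ⟨u, hu⟩) (v := ⟨w, hw⟩).2 ((hL.2 _ _).2 h)))
    simp only [hu, hw, dif_pos]
    rw [← sub_div]
    exact (div_le_div_of_nonneg_right h5 h1.le).trans_lt h4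

/-- A chain is a clique. -/
theorem IsOutChain.isClique {n : ℕ} {D : Digraph (Fin n)} {out : ℕ → List ℕ} {f : ℕ → Fin n}
    (hadj : ∀ p < n, ∀ q < n, q ∈ out p ↔ D.Adj (f p) (f q)) {w : List ℕ} (h : IsOutChain n out w) :
    D.toSimpleGraphInclusive.IsClique ((w.map f).toFinset : Set (Fin n)) := by
  have hpw : w.Pairwise fun p q => D.Adj (f p) (f q) :=
    h.pairwise.imp_of_mem fun hp hq hpq => (hadj _ (h.bound _ hp) _ (h.bound _ hq)).1 hpq
  intro u hu v hv huv
  simp only [List.coe_toFinset, List.mem_map, Set.mem_ofPred_eq] at hu hv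
  obtain ⟨p, hp, rfl⟩ := hu
  obtain ⟨q, hq, rfl⟩ := hv
  refine ⟨huv, ?_⟩
  obtain ⟨a, ha, rfl⟩ := List.getElem_of_mem hp
  obtain ⟨b, hb, rfl⟩ := List.getElem_of_mem hq
  rcases lt_trichotomy a b with h1 | rfl | h1
  · exact Or.inl (List.pairwise_iff_getElem.1 hpw a b ha hb h1)
  · exact absurd rfl huv
  · exact Or.inr (List.pairwise_iff_getElem.1 hpw b a hb ha h1)

theorem IsOutChain.nodup_map {n : ℕ} {out : ℕ → List ℕ} (hout : IsTopoGraph n out) {f : ℕ → Fin n}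
    (hinj : ∀ p < n, ∀ q < n, f p = f q → p = q) {w : List ℕ} (h : IsOutChain n out w) :
    (w.map f).Nodup :=
  (h.nodup hout).map_on fun _ hp _ hq => hinj _ (h.bound _ hp) _ (h.bound _ hq)

/-- A clique gives a chain. -/
theorem exists_isOutChain {n : ℕ} {D : Digraph (Fin n)} {out : ℕ → List ℕ}
    (hout : IsTopoGraph n out) {f : ℕ → Fin n} (hinj : ∀ p < n, ∀ q < n, f p = f q → p = q)
    (hsurj : ∀ v, ∃ p < n, f p = v) (hadj : ∀ p < n, ∀ q < n, q ∈ out p ↔ D.Adj (f p) (f q))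
    {S : Finset (Fin n)} (hS : D.toSimpleGraphInclusive.IsClique (S : Set (Fin n))) :
    ∃ c, IsOutChain n out c ∧ c.length = S.card := by
  classical
  let P := (Finset.range n).filter fun p => f p ∈ S
  have hP : ∀ p ∈ P.sort (· ≤ ·), p < n ∧ f p ∈ S := by
    intro p hp
    rw [Finset.mem_sort] at hp
    simpa [P] using hp
  refine ⟨P.sort (· ≤ ·), ⟨?_, fun p hp => (hP p hp).1⟩, ?_⟩
  · have hpw : (P.sort (· ≤ ·)).Pairwise (· < ·) := Finset.sortedLT_sort P |>.pairwise
    refine hpw.imp_of_mem fun {p q} hp hq hpq => ?_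
    obtain ⟨hp, hpS⟩ := hP p hp
    obtain ⟨hq, hqS⟩ := hP q hq
    have hne : f p ≠ f q := fun h => hpq.ne (hinj p hp q hq h)
    rcases (hS hpS hqS hne).2 with h | h
    · exact (hadj p hp q hq).2 h
    · have := hout.lt q p ((hadj q hq p hp).2 h)
      omega
  · rw [Finset.length_sort]
    refine Finset.card_nbij f (fun p hp => ?_) (fun p hp q hq h => ?_) fun v hv => ?_
    · exact (Finset.mem_filter.1 hp).2
    · simp only [P, Finset.coe_filter, Finset.mem_range, Set.mem_ofPred_eq] at hp hq
      exact hinj p hp.1 q hq.1 h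
    · obtain ⟨p, hp, rfl⟩ := hsurj v
      exact ⟨p, by simpa [P] using ⟨hp, hv⟩, rfl⟩

/-- The vertices at the positions of a topological order. -/
theorem IsTopoOrder.exists_vertex {n : ℕ} {L : List (ℕ × ℕ)} {qs : List ℕ} (hn : 0 < n)
    (h : IsTopoOrder n L qs) : ∃ f : ℕ → Fin n, (∀ p < n, (f p : ℕ) = qs.getD p 0) ∧
      (∀ p < n, ∀ q < n, f p = f q → p = q) ∧ ∀ v, ∃ p < n, f p = v := by
  have hlen := h.length_eq
  have h1 : ∀ p < n, qs.getD p 0 < n := by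
    intro p hp
    rw [List.getD_eq_getElem _ _ (by omega)]
    exact h.lt_of_mem (List.getElem_mem _)
  -- The remainder only serves to make `f` total; at positions below `n` it changes nothing.
  refine ⟨fun p => ⟨qs.getD p 0 % n, Nat.mod_lt _ hn⟩, fun p hp => Nat.mod_eq_of_lt (h1 p hp),
    fun p hp q hq hpq => ?_, fun v => ?_⟩
  · simp only [Fin.mk.injEq, Nat.mod_eq_of_lt (h1 p hp), Nat.mod_eq_of_lt (h1 q hq)] at hpq
    rw [List.getD_eq_getElem _ _ (by omega), List.getD_eq_getElem _ _ (by omega)] at hpq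
    exact (h.nodup.getElem_inj_iff).1 hpq
  · obtain ⟨p, hp, hv⟩ := h.exists_getElem v.2
    refine ⟨p, by omega, Fin.ext ?_⟩
    simp only
    rw [Nat.mod_eq_of_lt (h1 p (by omega)), List.getD_eq_getElem _ _ hp, hv]

theorem mem_posList_iff_adj {n : ℕ} {G : Digraph (Fin n)} {L : List (Fin n × Fin n)}
    (hL : IsEdgeList G L) {qs : List ℕ} (hqs : IsTopoOrder n (natEdges L) qs) {f : ℕ → Fin n}
    (hf : ∀ p < n, (f p : ℕ) = qs.getD p 0) {p q : ℕ} (hp : p < n) (hq : q < n) :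
    q ∈ posList (natEdges L) qs p ↔ G.Adj (f p) (f q) := by
  have hlen := hqs.length_eq
  have hp' : p < qs.length := by omega
  have hq' : q < qs.length := by omega
  have e1 := hf p hp
  have e2 := hf q hq
  rw [List.getD_eq_getElem _ _ hp'] at e1
  rw [List.getD_eq_getElem _ _ hq'] at e2
  rw [mem_posList (isEdges_natEdges hL.1) hqs, ← hL.2, ← mem_natEdges]
  simp [hp', hq', e1, e2]

/-! ### Decoding the input words, and numerical bounds -/

theorem getD_edgeWords {n : ℕ} (L : List (Fin n × Fin n)) (e : ℕ) (he : e < (natEdges L).length) :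
    (edgeWords L).getD (e + e) 0 = (natEdges L)[e].1 ∧
      (edgeWords L).getD (e + e + 1) 0 = (natEdges L)[e].2 := by
  induction L generalizing e with
  | nil => simp [natEdges] at he
  | cons p L ih =>
    have h1 : edgeWords (p :: L) = ((p.1 : ℕ) : ℤ) :: ((p.2 : ℕ) : ℤ) :: edgeWords L := rfl
    have h2 : natEdges (p :: L) = ((p.1 : ℕ), (p.2 : ℕ)) :: natEdges L := rfl
    cases e with
    | zero => simp [h1, h2]
    | succ e =>
      have h3 := ih e (by simpa [h2] using he)
      simp only [h2, List.getElem_cons_succ]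
      rw [h1, show e + 1 + (e + 1) = e + e + 1 + 1 by ring]
      simpa using h3

theorem length_natEdges {n : ℕ} (L : List (Fin n × Fin n)) : (natEdges L).length = L.length :=
  List.length_map _

theorem isUtilityInput {n i : ℕ} {L : List (Fin n × Fin n)} {t₁ t₂ : ℤ} {α : Fin n → ℤ}
    {α' : ℕ → ℤ} (hα : ∀ v : Fin n, α' v = α v) {inp : ℤ → ℤ}
    (h : ∀ j : ℕ, j < 5 + n + 2 * L.length → inp j = (utilityInput i t₁ t₂ α L).getD j 0) :
    IsUtilityInput n i (natEdges L) t₁ t₂ α' inp := by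
  refine ⟨?_, ?_, ?_, ?_, ?_, fun v hv => ?_, fun e he => ?_⟩
  · simpa [utilityInput] using h 0 (by omega)
  · rw [length_natEdges]
    simpa [utilityInput] using h 1 (by omega)
  · simpa [utilityInput] using h 2 (by omega)
  · simpa [utilityInput] using h 3 (by omega)
  · simpa [utilityInput] using h 4 (by omega)
  · have h1 := h (v + 5) (by omega)
    push_cast at h1
    rw [h1, utilityInput, List.append_assoc, List.getD_append_right _ _ _ _ (by simp),
      List.getD_append _ _ _ _ (by simpa using hv), List.getD_eq_getElem _ _ (by simpa using hv)]
    simpa using (hα ⟨v, hv⟩).symm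
  · have hlen := length_natEdges L
    obtain ⟨h1, h2⟩ := getD_edgeWords L e he
    rw [h _ (by omega), h _ (by omega), utilityInput,
      List.getD_append_right _ _ _ _ (by simp; omega), List.getD_append_right _ _ _ _ (by simp; omega),
      ← h1, ← h2]
    constructor <;> congr 1 <;> simp <;> omega

theorem isGraphInput {n i : ℕ} {L : List (Fin n × Fin n)} {inp : ℤ → ℤ}
    (h : ∀ j : ℕ, j < 3 + 2 * L.length → inp j = (graphInput i L).getD j 0) :
    IsGraphInput n i (natEdges L) inp := by
  refine ⟨?_, ?_, ?_, fun e he => ?_⟩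
  · simpa [graphInput] using h 0 (by omega)
  · rw [length_natEdges]
    simpa [graphInput] using h 1 (by omega)
  · simpa [graphInput] using h 2 (by omega)
  · have hlen := length_natEdges L
    obtain ⟨h1, h2⟩ := getD_edgeWords L e he
    rw [h _ (by omega), h _ (by omega), graphInput,
      List.getD_append_right _ _ _ _ (by simp; omega), List.getD_append_right _ _ _ _ (by simp; omega),
      ← h1, ← h2]
    constructor <;> congr 1 <;> simp <;> omega

/-- A whole number that replaces `m ^ ((K + 1) / 2)`. -/
theorem exists_natBound {n i : ℕ} {G : Digraph (Fin n)} (hm : 1 ≤ edgeCount G) (hi : 1 ≤ i)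
    (hiG : (i : ℝ) ≤ lam G) :
    ∃ B : ℕ, edgeCount G ^ (⌊lam G / i⌋₊ + 1) ≤ B ^ 2 ∧
      ((⌊lam G / i⌋₊ * B : ℕ) : ℝ) ≤ 2 * cliqueBound G i := by
  set K := ⌊lam G / i⌋₊ with hK
  set x : ℝ := (edgeCount G : ℝ) ^ (((K : ℝ) + 1) / 2) with hx
  have hm' : (1 : ℝ) ≤ edgeCount G := by exact_mod_cast hm
  have hi' : (0 : ℝ) < i := by exact_mod_cast hi
  have hx1 : 1 ≤ x := Real.one_le_rpow hm' (by positivity)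
  have hx2 : x ^ 2 = (edgeCount G : ℝ) ^ (K + 1) := by
    rw [hx, ← Real.rpow_natCast, ← Real.rpow_mul (by positivity), ← Real.rpow_natCast]
    congr 1
    push_cast
    ring
  have hB := Nat.le_ceil x
  have hB' := Nat.ceil_lt_add_one (show 0 ≤ x by positivity)
  have hKl : (K : ℝ) ≤ lam G / i := Nat.floor_le (div_nonneg (hi'.le.trans hiG) hi'.le)
  -- Since `x ≥ 1`, rounding up at most doubles it.
  refine ⟨⌈x⌉₊, ?_, ?_⟩
  · have : ((edgeCount G ^ (K + 1) : ℕ) : ℝ) ≤ ((⌈x⌉₊ ^ 2 : ℕ) : ℝ) := by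
      push_cast
      rw [← hx2]
      exact pow_le_pow_left₀ (by positivity) hB 2
    exact_mod_cast this
  · rw [cliqueBound, ← hx]
    push_cast
    have h1 : (⌈x⌉₊ : ℝ) ≤ 2 * x := by linarith
    calc (K : ℝ) * ⌈x⌉₊ ≤ lam G / i * (2 * x) :=
          mul_le_mul hKl h1 (by positivity) ((Nat.cast_nonneg K).trans hKl)
      _ = _ := by ring

/-- All follows from `i ≤ λ ≤ n`. The bounds by `n` allow `i` and `⌊λ / i⌋` to be handled by loops
of at most `n` rounds. -/
theorem floor_lam_bounds {n i : ℕ} {G : Digraph (Fin n)} (hG : IsDag G) (hn : 0 < n) (hi : 1 ≤ i)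
    (hiG : (i : ℝ) ≤ lam G) :
    i ≤ n ∧ 1 ≤ ⌊lam G / i⌋₊ ∧ ⌊lam G / i⌋₊ ≤ n ∧ (⌊lam G / i⌋₊ : ℝ) * i ≤ lam G ∧
      lam G < ((⌊lam G / i⌋₊ : ℝ) + 1) * i := by
  have hi' : (1 : ℝ) ≤ i := by exact_mod_cast hi
  have hi0 : (0 : ℝ) < i := by linarith
  have hln := lam_le_card hG hn
  have h0 : 0 ≤ lam G := by linarith
  refine ⟨by exact_mod_cast hiG.trans hln, ?_, ?_, ?_, ?_⟩
  · rw [Nat.one_le_floor_iff, le_div_iff₀ hi0, one_mul]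
    exact hiG
  · exact Nat.floor_le_of_le ((div_le_self h0 hi').trans hln)
  · rw [← le_div_iff₀ hi0]
    exact Nat.floor_le (by positivity)
  · rw [← div_lt_iff₀ hi0]
    exact Nat.lt_floor_add_one _

/-- The list of vertices in memory, for a chain of positions. -/
theorem holdsOutput {n : ℕ} {M : Memory} {f : ℕ → Fin n} {w qs : List ℕ}
    (hf : ∀ p < n, (f p : ℕ) = qs.getD p 0) (hw : ∀ p ∈ w, p < n) (hnd : (w.map f).Nodup)
    (h0 : M 0 = (w.map fun p => qs.getD p 0).length)
    (h1 : ∀ (j : ℕ) (h : j < (w.map fun p => qs.getD p 0).length),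
      M (j + 1) = (w.map fun p => qs.getD p 0)[j]) :
    HoldsOutput M (w.map f).toFinset := by
  refine ⟨w.map f, hnd, rfl, by simpa using h0, ?_⟩
  rintro ⟨j, hj⟩
  have hj' : j < w.length := by simpa using hj
  have := h1 j (by simpa using hj')
  simp only [List.getElem_map] at this
  rw [List.get_eq_getElem, List.getElem_map, hf _ (hw _ (List.getElem_mem hj')), ← this]

/-! ### The two programs and their running times -/

theorem exists_program_utility : ∃ (P : RamProg) (C : ℝ), ∀ (n : ℕ) (G : Digraph (Fin n)) (i : ℕ)
    (L : List (Fin n × Fin n)) (t₁ t₂ : ℤ) (α : Fin n → ℤ),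
    IsDag G → DagConnected G → ¬ IsDegenerate G → 1 ≤ i → (i : ℝ) ≤ lam G →
    IsEdgeList G L → 0 < t₁ → (t₂ : ℝ) = lam G * t₁ →
    IsSatisfying G t₁ t₂ (fun v => (α v : ℝ)) →
    ∃ (t : ℕ) (M : Memory) (K : Finset (Fin n)),
      Runs P (initMemory (utilityInput i t₁ t₂ α L)) t M ∧ HoldsOutput M K ∧
      (deleteShort G (fun v => (α v : ℝ)) (i * t₁)).toSimpleGraphInclusive.IsMaximumClique K ∧
      IsCliqueWithinFactor G i K ∧ (t : ℝ) ≤ C * cliqueBound G i := by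
  obtain ⟨C, hC⟩ := exists_runs_wholeProgram
    -- The length `5 + n + 2 m` of the input, from its first two words.
    (.plus (.lit 5) (.plus (.cell (.lit 0)) (.plus (.cell (.lit 1)) (.cell (.lit 1)))))
    utilityClique (by decide)
  refine ⟨wholeProgram
    (.plus (.lit 5) (.plus (.cell (.lit 0)) (.plus (.cell (.lit 1)) (.cell (.lit 1)))))
    utilityClique, C * 600, fun n G i L t₁ t₂ α hG hconn hdeg hi hiG hL ht ht₂ hα => ?_⟩
  have hn2 := two_le_of_not_isDegenerate hG hdeg
  have hm := one_le_edgeCount hdeg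
  have hnm := le_edgeCount_add_one hconn
  obtain ⟨hin, hK1, hKn, hKl, hKu⟩ := floor_lam_bounds hG (by omega) hi hiG
  obtain ⟨B, hB, hB'⟩ := exists_natBound hm hi hiG
  rw [edgeCount_eq_length hL, ← length_natEdges] at hm hnm hB
  set K := ⌊lam G / i⌋₊ with hKdef
  have hE := isEdges_natEdges hL.1
  have ht' : (0 : ℝ) < t₁ := by exact_mod_cast ht
  obtain ⟨α', hα'⟩ : ∃ α' : ℕ → ℤ, ∀ v : Fin n, α' v = α v :=
    ⟨fun v => if h : v < n then α ⟨v, h⟩ else 0, fun v => by simp⟩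
  have hK₁ : (K : ℤ) * (i * t₁) ≤ t₂ := by
    have : (K : ℝ) * (i * t₁) ≤ t₂ := by
      rw [ht₂, ← mul_assoc]
      exact mul_le_mul_of_nonneg_right hKl ht'.le
    exact_mod_cast this
  have hK₂ : t₂ < ((K : ℤ) + 1) * (i * t₁) := by
    have : (t₂ : ℝ) < ((K : ℝ) + 1) * (i * t₁) := by
      rw [ht₂, ← mul_assoc]
      exact mul_lt_mul_of_pos_right hKu ht'
    exact_mod_cast this
  have hmB : (natEdges L).length ≤ B := (Nat.pow_le_pow_iff_left two_ne_zero).1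
    ((Nat.pow_le_pow_right hm (by omega)).trans hB)
  have hkB : B ≤ K * B := Nat.le_mul_of_pos_left _ hK1
  have hassoc : 250 * K * B = 250 * (K * B) := by ring
  obtain ⟨t, M, l, hrun, ⟨w, qs, hqs, hw, hmax, rfl⟩, hM0, hM1, htime⟩ :=
    hC (utilityInput i t₁ t₂ α L) (5 + n + 2 * L.length) (250 * K * B)
      (fun l => ∃ w qs : List ℕ, IsTopoOrder n (natEdges L) qs ∧
        IsOutChain n (longList (fun p => α' (qs.getD p 0)) (i * t₁) (posList (natEdges L) qs)) w ∧
        (∀ w', IsOutChain n (longList (fun p => α' (qs.getD p 0)) (i * t₁)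
          (posList (natEdges L) qs)) w' → w'.length ≤ w.length) ∧
        l = w.map fun p => qs.getD p 0)
      (by simp [RamExpr.eval, initMemory, utilityInput]; ring)
      (by
        rintro l ⟨w, qs, hqs, hw, -, rfl⟩
        have := hw.length_le ((hqs.isTopoGraph hE).longList _ _)
        rw [List.length_map]
        omega)
      (fun σ hσ h0 => by
        refine (utilityClique_ok n i K B (natEdges L) hE (wellFounded_natEdges hG hL) t₁ t₂ α' ht hi
          hin hK1 hKn hK₁ hK₂ hm (by omega) ?_ hB σ (isUtilityInput hα' hσ) h0).mono ?_ le_rfl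
        · intro u v hu hv huv
          have h1 := hα.2 ⟨u, hu⟩ ⟨v, hv⟩ fun h =>
            huv (mem_natEdges (u := ⟨u, hu⟩) (v := ⟨v, hv⟩).2 ((hL.2 _ _).2 h))
          rw [hα' ⟨u, hu⟩, hα' ⟨v, hv⟩]
          beta_reduce at h1
          exact_mod_cast h1
        · rintro s - ⟨w, qs, h1, h2, h3, h4, h5⟩
          exact ⟨_, ⟨w, qs, h1, h2, h3, rfl⟩, by simpa using h4, fun j hj => by
            rw [List.getElem_map]; exact h5 j (by simpa using hj)⟩)
  obtain ⟨f, hf, hinj, hsurj⟩ := hqs.exists_vertex (by omega)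
  have htopo := hqs.isTopoGraph hE
  have hadj : ∀ p < n, ∀ q < n, q ∈ posList (natEdges L) qs p ↔ G.Adj (f p) (f q) :=
    fun p hp q hq => mem_posList_iff_adj hL hqs hf hp hq
  have hαf : ∀ p < n, α' (qs.getD p 0) = α (f p) := fun p hp => by rw [← hf p hp, hα']
  have hadj' : ∀ p < n, ∀ q < n,
      q ∈ longList (fun p => α' (qs.getD p 0)) (i * t₁) (posList (natEdges L) qs) p ↔
        (deleteShort G (fun v => (α v : ℝ)) (i * t₁)).Adj (f p) (f q) := by
    intro p hp q hq
    rw [mem_longList, hadj p hp q hq, hαf p hp, hαf q hq]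
    refine and_congr_right fun _ => ?_
    beta_reduce
    rw [← Int.cast_sub, ← Int.cast_natCast (R := ℝ) i, ← Int.cast_mul, Int.cast_le]
  have hnd := hw.nodup_map (htopo.longList _ _) hinj
  have hcard : ((w.map f).toFinset).card = w.length := by
    rw [List.toFinset_card_of_nodup hnd, List.length_map]
  refine ⟨t, M, (w.map f).toFinset, hrun, holdsOutput hf hw.bound hnd hM0 hM1,
    ⟨hw.isClique hadj', fun S hS => ?_⟩, ⟨hw.of_longList.isClique hadj, ?_⟩, ?_⟩
  · obtain ⟨c, hc, hcS⟩ := exists_isOutChain (htopo.longList _ _) hinj hsurj hadj' hS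
    rw [hcard, ← hcS]
    exact hmax c hc
  · obtain ⟨S, hS⟩ := G.toSimpleGraphInclusive.exists_isNClique_cliqueNum
    obtain ⟨c, hc, hcS⟩ := exists_isOutChain htopo hinj hsurj hadj hS.isClique
    -- A maximum clique of `G`, thinned to every `i`-th vertex, is a chain of long edges and so no
    -- longer than `w`.
    obtain ⟨w', -, h1, h2⟩ := hc.exists_longList (a := fun p => α' (qs.getD p 0)) ht.le hi (by
      intro p hp q hq
      have hqn := htopo.bound p q hq
      have h1 := hα.1 _ _ ((hadj p hp q hqn).1 hq)
      simp only [hαf p hp, hαf q hqn]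
      beta_reduce at h1
      have h2 : t₁ ≤ α (f q) - α (f p) := by exact_mod_cast h1
      omega)
    rw [hcard, ← hS.card_eq, ← hcS]
    exact h2.trans (Nat.mul_le_mul_left _ (hmax w' h1))
  · have h1 : t ≤ C * (300 * (K * B)) := by
      refine htime.trans (Nat.mul_le_mul_left _ ?_)
      have := length_natEdges L
      omega
    calc (t : ℝ) ≤ ((C * (300 * (K * B)) : ℕ) : ℝ) := by exact_mod_cast h1
      _ = C * (300 * ((K * B : ℕ) : ℝ)) := by push_cast; ring
      _ ≤ C * (300 * (2 * cliqueBound G i)) := by gcongr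
      _ = _ := by ring

/-- The cost of the search for the ratio. -/
theorem searchCost_le {n i K m B : ℕ} {l : ℝ} (hi : 1 ≤ i) (hm : 1 ≤ m) (hn : n ≤ 2 * m)
    (hK : 1 ≤ K) (hl : 0 < l) (hKl : l < (K + 1) * i) (hB : m ^ (K + 1) ≤ B ^ 2) :
    ((K * ((n / (2 * i + 1) + 2) * m) : ℕ) : ℝ) ≤ 6 * (n * m / l) + 4 * (K * B : ℕ) := by
  have hi' : (1 : ℝ) ≤ i := by exact_mod_cast hi
  have hmB : m ≤ B := (Nat.pow_le_pow_iff_left two_ne_zero).1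
    ((Nat.pow_le_pow_right hm (by omega)).trans hB)
  have hnonneg : 0 ≤ n * m / l := by positivity
  -- For `K ≥ 3` the bound `m ^ 2 ≤ B` covers even `n` phases per test. For `K ≤ 2` there are at
  -- most two tests, and `l < 3 i` turns the `n / (2 i + 1)` phases into `O(n / l)`; the two extra
  -- phases per test cost `O(m)`, at most `O(B)`.
  rcases Nat.lt_or_ge 2 K with h3 | h3
  · have h4 : m ^ 2 ≤ B := (Nat.pow_le_pow_iff_left two_ne_zero).1 (by
      rw [← pow_mul]
      exact (Nat.pow_le_pow_right hm (by omega)).trans hB)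
    have h5 : n / (2 * i + 1) + 2 ≤ 4 * m := by
      have := Nat.div_le_self n (2 * i + 1)
      omega
    have h6 : (n / (2 * i + 1) + 2) * m ≤ 4 * B := by nlinarith
    have h7 : K * ((n / (2 * i + 1) + 2) * m) ≤ 4 * (K * B) := by
      calc _ ≤ K * (4 * B) := Nat.mul_le_mul_left _ h6
        _ = _ := by ring
    have h8 : ((K * ((n / (2 * i + 1) + 2) * m) : ℕ) : ℝ) ≤ 4 * (K * B : ℕ) := by exact_mod_cast h7
    linarith
  · have h4 : ((n / (2 * i + 1) : ℕ) : ℝ) ≤ 3 * (n / l) := by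
      have hK2 : (K : ℝ) ≤ 2 := by exact_mod_cast h3
      have h5 : ((n / (2 * i + 1) : ℕ) : ℝ) ≤ n / ((2 * i + 1 : ℕ) : ℝ) := Nat.cast_div_le
      have h6 : l ≤ 3 * (2 * i + 1 : ℕ) := by
        push_cast
        nlinarith
      refine h5.trans ?_
      rw [← mul_div_assoc, div_le_div_iff₀ (by positivity) hl]
      have : (0 : ℝ) ≤ n := Nat.cast_nonneg n
      nlinarith
    have hK2 : (K : ℝ) ≤ 2 := by exact_mod_cast h3
    have hmB' : (m : ℝ) ≤ B := by exact_mod_cast hmB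
    have h5 : (K : ℝ) * (((n / (2 * i + 1) : ℕ) : ℝ) * m) ≤ 6 * (n * m / l) := by
      calc (K : ℝ) * (((n / (2 * i + 1) : ℕ) : ℝ) * m) ≤ 2 * (3 * (n / l) * m) := by gcongr
        _ = _ := by ring
    have h6 : (K : ℝ) * (2 * m) ≤ 4 * (K * B) := by
      have : (K : ℝ) * m ≤ K * B := by gcongr
      have : (0 : ℝ) ≤ K * B := by positivity
      linarith
    push_cast
    linarith

theorem exists_program_graph : ∃ (P : RamProg) (C : ℝ), ∀ (n : ℕ) (G : Digraph (Fin n)) (i : ℕ)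
    (L : List (Fin n × Fin n)),
    IsDag G → DagConnected G → ¬ IsDegenerate G → 1 ≤ i → (i : ℝ) ≤ lam G →
    IsEdgeList G L →
    ∃ (t : ℕ) (M : Memory) (K : Finset (Fin n)),
      Runs P (initMemory (graphInput i L)) t M ∧ HoldsOutput M K ∧
      IsCliqueWithinFactor G i K ∧
      (t : ℝ) ≤ C * ((n : ℝ) * (edgeCount G : ℝ) / lam G + cliqueBound G i) := by
  obtain ⟨C, hC⟩ := exists_runs_wholeProgram
    (.plus (.lit 3) (.plus (.cell (.lit 1)) (.cell (.lit 1)))) graphClique (by decide)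
  refine ⟨wholeProgram (.plus (.lit 3) (.plus (.cell (.lit 1)) (.cell (.lit 1)))) graphClique,
    C * 3000, fun n G i L hG hconn hdeg hi hiG hL => ?_⟩
  have hn2 := two_le_of_not_isDegenerate hG hdeg
  have hm := one_le_edgeCount hdeg
  have hnm := le_edgeCount_add_one hconn
  obtain ⟨hin, hK1, hKn, hKl, hKu⟩ := floor_lam_bounds hG (by omega) hi hiG
  obtain ⟨B, hB, hB'⟩ := exists_natBound hm hi hiG
  have hl0 : 0 < lam G := lt_of_lt_of_le (by exact_mod_cast hi) hiG
  set K := ⌊lam G / i⌋₊ with hKdef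
  have hcost := searchCost_le (n := n) hi hm (by omega) hK1 hl0 hKu hB
  rw [edgeCount_eq_length hL, ← length_natEdges] at hm hnm hB hcost ⊢
  have hE := isEdges_natEdges hL.1
  have hmB : (natEdges L).length ≤ B := (Nat.pow_le_pow_iff_left two_ne_zero).1
    ((Nat.pow_le_pow_right hm (by omega)).trans hB)
  have hkB : B ≤ K * B := Nat.le_mul_of_pos_left _ hK1
  obtain ⟨t, M, l, hrun, ⟨w, qs, hqs, hw, hmax, rfl⟩, hM0, hM1, htime⟩ :=
    hC (graphInput i L) (3 + 2 * L.length)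
      (200 * (K * ((n / (2 * i + 1) + 2) * (natEdges L).length)) + 300 * (K * B))
      (fun l => ∃ w qs : List ℕ, IsTopoOrder n (natEdges L) qs ∧
        IsOutChain n (posList (natEdges L) qs) w ∧
        (∀ c, IsOutChain n (posList (natEdges L) qs) c → c.length ≤ i * w.length) ∧
        l = w.map fun p => qs.getD p 0)
      (by simp [RamExpr.eval, initMemory, graphInput]; ring)
      (by
        rintro l ⟨w, qs, hqs, hw, -, rfl⟩
        have := hw.length_le (hqs.isTopoGraph hE)
        rw [List.length_map]
        omega)
      (fun σ hσ h0 => by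
        refine (graphClique_ok n i K B (natEdges L) hE (wellFounded_natEdges hG hL) hn2 hi
          hin hK1 hKn ?_ ?_ hm (by omega) hB σ (isGraphInput hσ) h0).mono ?_ le_rfl
        · intro R hR β
          refine not_isPotential hG hL (by omega) (le_trans ?_ hKl) β
          exact_mod_cast hR
        · refine exists_isPotential hG hL ?_
          push_cast
          exact hKu
        · rintro s - ⟨w, qs, h1, h2, h3, h4, h5⟩
          exact ⟨_, ⟨w, qs, h1, h2, h3, rfl⟩, by simpa using h4, fun j hj => by
            rw [List.getElem_map]; exact h5 j (by simpa using hj)⟩)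
  obtain ⟨f, hf, hinj, hsurj⟩ := hqs.exists_vertex (by omega)
  have htopo := hqs.isTopoGraph hE
  have hadj : ∀ p < n, ∀ q < n, q ∈ posList (natEdges L) qs p ↔ G.Adj (f p) (f q) :=
    fun p hp q hq => mem_posList_iff_adj hL hqs hf hp hq
  have hnd := hw.nodup_map htopo hinj
  refine ⟨t, M, (w.map f).toFinset, hrun, holdsOutput hf hw.bound hnd hM0 hM1,
    ⟨hw.isClique hadj, ?_⟩, ?_⟩
  · obtain ⟨S, hS⟩ := G.toSimpleGraphInclusive.exists_isNClique_cliqueNum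
    obtain ⟨c, hc, hcS⟩ := exists_isOutChain htopo hinj hsurj hadj hS.isClique
    rw [List.toFinset_card_of_nodup hnd, List.length_map, ← hS.card_eq, ← hcS]
    exact hmax c hc
  · set X := K * ((n / (2 * i + 1) + 2) * (natEdges L).length) with hX
    have h1 : t ≤ C * (200 * X + 400 * (K * B)) := by
      refine htime.trans (Nat.mul_le_mul_left _ ?_)
      have := length_natEdges L
      omega
    have h2 : 0 ≤ n * ((natEdges L).length : ℝ) / lam G := by positivity
    have h3 : 0 ≤ cliqueBound G i := by
      have : (0 : ℝ) ≤ ((K * B : ℕ) : ℝ) := Nat.cast_nonneg _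
      linarith
    calc (t : ℝ) ≤ ((C * (200 * X + 400 * (K * B)) : ℕ) : ℝ) := by exact_mod_cast h1
      _ = C * (200 * (X : ℝ) + 400 * ((K * B : ℕ) : ℝ)) := by push_cast; ring
      _ ≤ C * (3000 * (n * ((natEdges L).length : ℝ) / lam G + cliqueBound G i)) := by
          refine mul_le_mul_of_nonneg_left ?_ (Nat.cast_nonneg C)
          linarith
      _ = _ := by ring

theorem mainTheorem8 :
    -- with a satisfying utility function for a ratio `t₂ / t₁ = λ(G)` at hand
    (∃ (P : RamProg) (C : ℝ), ∀ (n : ℕ) (G : Digraph (Fin n)) (i : ℕ)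
        (L : List (Fin n × Fin n)) (t₁ t₂ : ℤ) (α : Fin n → ℤ),
      IsDag G → DagConnected G → ¬ IsDegenerate G → 1 ≤ i → (i : ℝ) ≤ lam G →
      IsEdgeList G L → 0 < t₁ → (t₂ : ℝ) = lam G * t₁ →
      IsSatisfying G t₁ t₂ (fun v => (α v : ℝ)) →
      ∃ (t : ℕ) (M : Memory) (K : Finset (Fin n)),
        Runs P (initMemory (utilityInput i t₁ t₂ α L)) t M ∧ HoldsOutput M K ∧
        (deleteShort G (fun v => (α v : ℝ)) (i * t₁)).toSimpleGraphInclusive.IsMaximumClique K ∧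
        IsCliqueWithinFactor G i K ∧
        (t : ℝ) ≤ C * cliqueBound G i) ∧
    -- from `G` and `i` alone
    (∃ (P : RamProg) (C : ℝ), ∀ (n : ℕ) (G : Digraph (Fin n)) (i : ℕ)
        (L : List (Fin n × Fin n)),
      IsDag G → DagConnected G → ¬ IsDegenerate G → 1 ≤ i → (i : ℝ) ≤ lam G →
      IsEdgeList G L →
      ∃ (t : ℕ) (M : Memory) (K : Finset (Fin n)),
        Runs P (initMemory (graphInput i L)) t M ∧ HoldsOutput M K ∧
        IsCliqueWithinFactor G i K ∧
        (t : ℝ) ≤ C * ((n : ℝ) * (edgeCount G : ℝ) / lam G + cliqueBound G i)) := by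
  exact ⟨exists_program_utility, exists_program_graph⟩
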